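/- Let $n\ge 1$ and let $\mathbb{R}^{2n}$ carry coordinates $(x_1,\ldots,x_{2n})$ and the symplectic form $\omega=dx_1\wedge dx_2+\cdots+dx_{2n-1}\wedge dx_{2n}$. For an open set $W\subset\mathbb{R}^{2n}$ and a smooth $f:W\to\mathbb{R}$ put $\|D^3f\|_\infty=\max_{i_1+\cdots+i_{2n}=3}\sup_W\big|\partial^3 f/(\partial x_1^{i_1}\cdots\partial x_{2n}^{i_{2n}})\big|$. For open $U\subset\mathbb{R}^{2n}$ let $\mathrm{Ham}_{\mathrm c}(U)$ denote the set of time-one maps of the Hamiltonian flows of smooth time-dependent Hamiltonians $H:[0,1]\times U\to\mathbb{R}$ with compact support in $[0,1]\times U$. **Theorem 5 (Microscale statement).** There is a constant $C=C(n)>0$, depending only on $n$, such that the following holds. Let $\varepsilon>0$ and $b\in\mathbb{R}$, and let $v:(-4\varepsilon,4\varepsilon)^{2n}\to\mathbb{R}$ be the function $$v(x_1,\ldots,x_{2n})=\frac{x_1}{\varepsilon}+b.$$ Then for every smooth function $f:(-4\varepsilon,4\varepsilon)^{2n}\to\mathbb{R}$ with support contained in $(-\varepsilon,\varepsilon)^{2n}$,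 satisfying $\|D^3f\|_\infty\le \frac{C}{\varepsilon^3}$ and $\int_{(-\varepsilon,\varepsilon)^{2n}}f\,\omega^n=0$, there exist $\Phi_{i,+},\Phi_{i,-}\in\mathrm{Ham}_{\mathrm c}\big((-4\varepsilon,4\varepsilon)^{2n}\big)$, $1\le i\le 4n$, such that $$f=\sum_{i=1}^{4n}\big(\Phi_{i,+}^*v-\Phi_{i,-}^*v\big)\quad\text{on }(-4\varepsilon,4\varepsilon)^{2n},$$ where $\Phi^*v=v\circ\Phi$. -/

import Mathlib

open scoped ContDiff

/-- The space `ℝ^{2n}`. The mathematical coordinates `(x_1, …, x_{2n})` are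
`(x 0, …, x (2n - 1))`. -/
abbrev PhaseSpace (n : ℕ) : Type := Fin (2 * n) → ℝ

/-- The open cube `(-r, r)^{2n}`. -/
def openCube (n : ℕ) (r : ℝ) : Set (PhaseSpace n) :=
  {x | ∀ i, x i ∈ Set.Ioo (-r) r}

/-- The standard symplectic form `ω = dx_1 ∧ dx_2 + ⋯ + dx_{2n-1} ∧ dx_{2n}`. -/
def stdSymplecticForm {n : ℕ} (u w : PhaseSpace n) : ℝ :=
  ∑ k : Fin n, (u ⟨2 * k, by omega⟩ * w ⟨2 * k + 1, by omega⟩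
    - u ⟨2 * k + 1, by omega⟩ * w ⟨2 * k, by omega⟩)

/-- `V` is the value at `x` of the Hamiltonian vector field `X_H`, defined by
`ω(X_H, ·) = dH`. -/
def IsHamiltonianVectorAt {n : ℕ} (H : PhaseSpace n → ℝ) (x V : PhaseSpace n) : Prop :=
  ∀ w : PhaseSpace n, stdSymplecticForm V w = fderiv ℝ H x w

/-- `φ` is the flow, for times in `[0, 1]`, of the time-dependent Hamiltonian `H`. -/
def IsHamiltonianFlow {n : ℕ} (H : ℝ → PhaseSpace n → ℝ)
    (φ : ℝ → PhaseSpace n → PhaseSpace n) : Prop :=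
  (∀ x, φ 0 x = x) ∧
    ∀ x, ∀ t ∈ Set.Icc (0 : ℝ) 1, ∃ V : PhaseSpace n,
      IsHamiltonianVectorAt (H t) (φ t x) V ∧
      HasDerivWithinAt (fun s => φ s x) V (Set.Icc 0 1) t

/-- `Φ ∈ Ham_c(U, ω)` for an open `U ⊆ ℝ^{2n}`: `Φ` is the time-one map of the flow of a smooth
time-dependent Hamiltonian on `[0, 1] × U` whose support is contained in `[0, 1] × K` for some
compact `K ⊆ U`. Such a Hamiltonian is extended by zero to `[0, 1] × ℝ^{2n}`; its flow is the
identity outside `K` and preserves `U`, so that `Φ` is given as a self-map of `ℝ^{2n}` which is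
the identity outside `K`. -/
def IsCompactlySupportedHamDiffeo {n : ℕ} (U : Set (PhaseSpace n))
    (Φ : PhaseSpace n → PhaseSpace n) : Prop :=
  ∃ (H : ℝ → PhaseSpace n → ℝ) (φ : ℝ → PhaseSpace n → PhaseSpace n)
    (K : Set (PhaseSpace n)),
    ContDiffOn ℝ ∞ (fun p : ℝ × PhaseSpace n => H p.1 p.2) (Set.Icc 0 1 ×ˢ Set.univ) ∧
    IsCompact K ∧ K ⊆ U ∧
    (∀ t ∈ Set.Icc (0 : ℝ) 1, ∀ x ∉ K, H t x = 0) ∧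
    IsHamiltonianFlow H φ ∧
    ∀ x, Φ x = φ 1 x

/-- `‖D^r f‖_∞` on an open set `W`: the supremum over `W`, and the maximum over all choices of
`r` coordinate directions, of the absolute value of the corresponding partial derivative of order
`r` of `f`. It takes values in `[0, ∞]`. -/
noncomputable def derivSupNorm {n : ℕ} (r : ℕ) (W : Set (PhaseSpace n))
    (f : PhaseSpace n → ℝ) : ENNReal :=
  ⨆ (i : Fin r → Fin (2 * n)) (x ∈ W),
    ENNReal.ofReal |iteratedFDeriv ℝ r f x (fun j => Pi.single (i j) 1)|

/-- The function `v(x_1, …, x_{2n}) = x_1 / ε + b`. -/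
noncomputable def firstCoordProfile {n : ℕ} (hn : 1 ≤ n) (ε b : ℝ) (x : PhaseSpace n) : ℝ :=
  x ⟨0, by omega⟩ / ε + b

/-! Scaling by `ε` reduces everything to the unit cube, where the profile is the coordinate x₁ (the
constant `b` cancels in differences) and smallness means a bound on all derivatives up to order
three.

The engine is energy conservation. For small w supported near the unit cube, the Hamiltonian -(x₁ +
w) generates a flow S that perturbs the unit-speed translation along e₂, the direction conjugate to
x₁, and conserves x₁ + w. Hence x₁ ∘ S_T = x₁ + w - w ∘ S_T. Compare S_{a+T} with S_T preceded by
translation by a e₂. For T long enough to cross the support of w, the two final values of w agree,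
and subtraction leaves w(x) - w(x + a e₂). After cutting off the Hamiltonians, one pair of
diffeomorphisms thus realises a coboundary of w (`exists_pair_translate`).

It remains to write f as a sum of 4n such coboundaries, up to rotation.

Directions: replace f successively, in each coordinate, by a fixed bump times its integral along
that coordinate. Each replacement changes f by a function of zero mean on the corresponding lines.
After all 2n replacements what remains is a product of bumps times ∫ f, which is zero
(`exists_coordinate_decomposition`). A symplectic quarter turn that permutes axes up to sign, and is
realised on the unit cube by a Hamiltonian diffeomorphism, moves any coordinate direction to e₂
(`IsAxisRotation.exists_hamDiffeo`, `exists_axisRotation`).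

Coboundaries: if h has zero mean on lines in one direction, its sum Ph over translates by multiples
of 1/8 has zero mean over a period. One solves G(x) - G(x + √2/8) = Ph(x) with G of period 1/8.
Since √2 is badly approximable, the divisors 1 - exp(-2πim√2) are at least 1/|m|, so G = ∫ K(t)
h'''(x + t) dt (t in units of 1/8, derivatives in the same units) for a kernel K with Fourier
coefficients O(m⁻²). As K' is still square integrable, one derivative can be moved onto K, and the
gradient of G is controlled by three derivatives of h; this is where the C³ norm enters. Localising
G by a bump whose translates sum to one gives F₂. The remainder h - F₂ + F₂(· + √2/8) has vanishing
periodisation, so it telescopes as F₁ - F₁(· + 1/8) with F₁ compactly supported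
(`exists_coboundary_decomposition`). With 2n directions, two coboundaries in each yield the 4n
pairs. -/

/-! ### Global flows of bounded Lipschitz vector fields. -/

section Flow

variable {E : Type*} [NormedAddCommGroup E] [NormedSpace ℝ E]

/-- `φ` is the global flow of the autonomous vector field `X`. -/
def IsFlowOf (X : E → E) (φ : ℝ → E → E) : Prop :=
  (∀ x, φ 0 x = x) ∧ ∀ x t, HasDerivAt (fun s => φ s x) (X (φ t x)) t

/-- A curve of speed at most `C` cannot leave the ball of radius `C * N` during [-N, N], so
Picard–Lindelöf applies on that whole interval. Uniqueness glues the solutions for different N. -/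
theorem exists_flow [CompleteSpace E] {X : E → E} {K : NNReal} {C : ℝ}
    (hL : LipschitzWith K X) (hb : ∀ x, ‖X x‖ ≤ C) : ∃ φ, IsFlowOf X φ := by
  have hC : 0 ≤ C := (norm_nonneg _).trans (hb 0)
  have local_sol : ∀ x : E, ∀ N : ℕ, ∃ γ : ℝ → E, γ 0 = x ∧
      ∀ t ∈ Set.Ioo (-(N : ℝ)) N, HasDerivAt γ (X (γ t)) t := by
    intro x N
    have h0 : (0 : ℝ) ∈ Set.Icc (-(N : ℝ)) N := by simp
    have hPL : IsPicardLindelof (fun _ => X) (tmin := -(N : ℝ)) (tmax := N) ⟨0, h0⟩ x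
        (C.toNNReal * N) 0 C.toNNReal K := by
      apply IsPicardLindelof.of_time_independent
      · intro y _
        rw [Real.coe_toNNReal _ hC]
        exact hb y
      · exact hL.lipschitzOnWith
      · simp
    obtain ⟨γ, h1, h2⟩ := hPL.exists_eq_forall_mem_Icc_hasDerivWithinAt₀
    exact ⟨γ, h1, fun t ht => (h2 t ⟨ht.1.le, ht.2.le⟩).hasDerivAt (Icc_mem_nhds ht.1 ht.2)⟩
  choose γ hγ0 hγ using local_sol
  have agree : ∀ x : E, ∀ M N : ℕ, M ≤ N → ∀ t ∈ Set.Ioo (-(M : ℝ)) M, γ x M t = γ x N t := by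
    intro x M N hMN t ht
    have hMN' : (M : ℝ) ≤ N := by exact_mod_cast hMN
    have hM : (0 : ℝ) < M := by have := ht.1.trans ht.2; linarith
    refine ODE_solution_unique_of_mem_Ioo (v := fun _ => X) (s := fun _ => Set.univ) (K := K)
      (t₀ := 0) (fun _ _ => hL.lipschitzOnWith) ⟨by linarith, hM⟩
      (fun s hs => ⟨hγ x M s hs, trivial⟩)
      (fun s hs => ⟨hγ x N s ⟨by linarith [hs.1], by linarith [hs.2]⟩, trivial⟩)
      (by rw [hγ0, hγ0]) ht
  -- The `+ 1` puts t strictly inside the open interval on which the chosen solution is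
  -- differentiable.
  refine ⟨fun t x => γ x (⌈|t|⌉₊ + 1) t, fun x => hγ0 _ _, fun x t => ?_⟩
  have key : ∀ s : ℝ, |s| < (⌈|t|⌉₊ + 2 : ℕ) →
      γ x (⌈|s|⌉₊ + 1) s = γ x (⌈|t|⌉₊ + 2) s := by
    intro s hs
    have h1 : |s| < (⌈|s|⌉₊ + 1 : ℕ) := by
      push_cast
      linarith [Nat.le_ceil |s|]
    rcases le_total (⌈|s|⌉₊ + 1) (⌈|t|⌉₊ + 2) with h | h
    · exact agree x _ _ h s (abs_lt.1 h1)
    · exact (agree x _ _ h s (abs_lt.1 hs)).symm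
  have ht : |t| < (⌈|t|⌉₊ + 2 : ℕ) := by
    push_cast
    linarith [Nat.le_ceil |t|]
  have hd := hγ x (⌈|t|⌉₊ + 2) t (abs_lt.1 ht)
  rw [← key t ht] at hd
  refine hd.congr_of_eventuallyEq ?_
  have : ∀ᶠ s : ℝ in nhds t, |s| < ((⌈|t|⌉₊ + 2 : ℕ) : ℝ) :=
    (continuous_abs.tendsto t).eventually_lt_const ht
  filter_upwards [this] with s hs using key s hs

/-- ODE uniqueness in the form used for all later comparisons of flows: two vector fields that agree
along one trajectory share that trajectory. -/
theorem IsFlowOf.eq_of_curve {X : E → E} {φ : ℝ → E → E} (hφ : IsFlowOf X φ) {K : NNReal}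
    (hL : LipschitzWith K X) {γ : ℝ → E} {T : ℝ}
    (hγ : ∀ t ∈ Set.uIcc 0 T, HasDerivAt γ (X (γ t)) t) :
    ∀ t ∈ Set.uIcc 0 T, φ t (γ 0) = γ t := by
  rcases le_total 0 T with hT | hT
  · rw [Set.uIcc_of_le hT] at hγ ⊢
    refine ODE_solution_unique_of_mem_Icc_right (v := fun _ => X) (s := fun _ => Set.univ) (K := K)
      (fun _ _ => hL.lipschitzOnWith)
      (fun s _ => (hφ.2 (γ 0) s).continuousAt.continuousWithinAt)
      (fun s _ => (hφ.2 (γ 0) s).hasDerivWithinAt) (fun _ _ => trivial)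
      (fun s hs => (hγ s hs).continuousAt.continuousWithinAt)
      (fun s hs => (hγ s ⟨hs.1, hs.2.le⟩).hasDerivWithinAt) (fun _ _ => trivial) (hφ.1 _)
  · rw [Set.uIcc_of_ge hT] at hγ ⊢
    refine ODE_solution_unique_of_mem_Icc_left (v := fun _ => X) (s := fun _ => Set.univ) (K := K)
      (fun _ _ => hL.lipschitzOnWith)
      (fun s _ => (hφ.2 (γ 0) s).continuousAt.continuousWithinAt)
      (fun s _ => (hφ.2 (γ 0) s).hasDerivWithinAt) (fun _ _ => trivial)
      (fun s hs => (hγ s hs).continuousAt.continuousWithinAt)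
      (fun s hs => (hγ s ⟨hs.1.le, hs.2⟩).hasDerivWithinAt) (fun _ _ => trivial) (hφ.1 _)

theorem IsFlowOf.add {X : E → E} {φ : ℝ → E → E} (hφ : IsFlowOf X φ) {K : NNReal}
    (hL : LipschitzWith K X) (s t : ℝ) (x : E) : φ (s + t) x = φ s (φ t x) := by
  have h := hφ.eq_of_curve hL (γ := fun r => φ (r + t) x) (T := s)
    (fun r _ => (hφ.2 x (r + t)).comp_add_const r t) s Set.right_mem_uIcc
  simpa using h.symm

theorem IsFlowOf.neg_apply {X : E → E} {φ : ℝ → E → E} (hφ : IsFlowOf X φ) {K : NNReal}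
    (hL : LipschitzWith K X) (t : ℝ) (x : E) : φ (-t) (φ t x) = x := by
  rw [← hφ.add hL, neg_add_cancel, hφ.1]

end Flow

/-! ### Hamiltonian vector fields in coordinates. -/

section HamiltonianVectorField

variable {n : ℕ}

/-- The index of the coordinate that is symplectically conjugate to the `i`-th one. -/
def conjIndex (i : Fin (2 * n)) : Fin (2 * n) :=
  if h : (i : ℕ) % 2 = 0 then ⟨i + 1, by omega⟩ else ⟨i - 1, by omega⟩

/-- The sign in Hamilton's equation for the `i`-th coordinate. -/
def conjSign (i : Fin (2 * n)) : ℝ := if (i : ℕ) % 2 = 0 then 1 else -1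

/-- The linear map sending a covector to the vector that represents it symplectically. -/
noncomputable def symplecticDual : (PhaseSpace n →L[ℝ] ℝ) →L[ℝ] PhaseSpace n :=
  ContinuousLinearMap.pi fun i =>
    conjSign i • ContinuousLinearMap.apply ℝ ℝ (Pi.single (conjIndex i) (1 : ℝ))

theorem symplecticDual_apply (l : PhaseSpace n →L[ℝ] ℝ) (i : Fin (2 * n)) :
    symplecticDual l i = conjSign i * l (Pi.single (conjIndex i) 1) := rfl

theorem sum_fin_two_mul {M : Type*} [AddCommMonoid M] (n : ℕ) (g : Fin (2 * n) → M) :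
    ∑ i, g i = ∑ k : Fin n, (g ⟨2 * k, by omega⟩ + g ⟨2 * k + 1, by omega⟩) := by
  have hr : ∀ (m : ℕ) (f : ℕ → M), ∑ i ∈ Finset.range (2 * m), f i
      = ∑ k ∈ Finset.range m, (f (2 * k) + f (2 * k + 1)) := by
    intro m f
    induction m with
    | zero => simp
    | succ m ih =>
      rw [Finset.sum_range_succ, ← ih, show 2 * (m + 1) = 2 * m + 1 + 1 by ring,
        Finset.sum_range_succ, Finset.sum_range_succ, add_assoc]
  set f : ℕ → M := fun i => if h : i < 2 * n then g ⟨i, h⟩ else 0 with hf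
  have h1 : ∑ i, g i = ∑ i : Fin (2 * n), f i := by
    refine Finset.sum_congr rfl fun i _ => ?_
    simp [hf]
  have h2 : ∑ k : Fin n, (g ⟨2 * k, by omega⟩ + g ⟨2 * k + 1, by omega⟩)
      = ∑ k : Fin n, (fun k : ℕ => f (2 * k) + f (2 * k + 1)) k := by
    refine Finset.sum_congr rfl fun k _ => ?_
    have a1 : 2 * (k : ℕ) < 2 * n := by omega
    have a2 : 2 * (k : ℕ) + 1 < 2 * n := by omega
    simp [hf, a1, a2]
  rw [h1, h2, Fin.sum_univ_eq_sum_range f, hr,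
    Fin.sum_univ_eq_sum_range (fun k : ℕ => f (2 * k) + f (2 * k + 1))]

theorem apply_eq_sum_single (l : PhaseSpace n →L[ℝ] ℝ) (w : PhaseSpace n) :
    l w = ∑ i, w i * l (Pi.single i 1) := by
  conv_lhs => rw [← Finset.univ_sum_single w]
  rw [map_sum]
  refine Finset.sum_congr rfl fun i _ => ?_
  have h : (Pi.single i (w i) : PhaseSpace n) = w i • Pi.single i (1 : ℝ) := by
    rw [← Pi.single_smul, smul_eq_mul, mul_one]
  rw [h, map_smul, smul_eq_mul]

theorem stdSymplecticForm_symplecticDual (l : PhaseSpace n →L[ℝ] ℝ) (w : PhaseSpace n) :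
    stdSymplecticForm (symplecticDual l) w = l w := by
  rw [apply_eq_sum_single l w, sum_fin_two_mul, stdSymplecticForm]
  refine Finset.sum_congr rfl fun k _ => ?_
  have h1 : (2 * (k : ℕ) + 1) % 2 ≠ 0 := by omega
  have h0 : (2 * (k : ℕ)) % 2 = 0 := by omega
  simp only [symplecticDual_apply, conjSign, conjIndex, h0, h1, if_true, if_false, dif_pos,
    dif_neg, not_false_eq_true, Nat.add_sub_cancel]
  ring

/-- The Hamiltonian vector field of `H`. -/
noncomputable def hamVF (H : PhaseSpace n → ℝ) (x : PhaseSpace n) : PhaseSpace n :=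
  symplecticDual (fderiv ℝ H x)

theorem isHamiltonianVectorAt_hamVF (H : PhaseSpace n → ℝ) (x : PhaseSpace n) :
    IsHamiltonianVectorAt H x (hamVF H x) :=
  fun w => stdSymplecticForm_symplecticDual _ w

/-- Antisymmetry of the symplectic form: the derivative along the flow is ω(X, X) = 0. -/
theorem IsFlowOf.hamiltonian_conserved {H : PhaseSpace n → ℝ}
    {φ : ℝ → PhaseSpace n → PhaseSpace n} (hφ : IsFlowOf (hamVF H) φ)
    (hH : Differentiable ℝ H) (t : ℝ) (x : PhaseSpace n) : H (φ t x) = H x := by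
  have hd : ∀ s, HasDerivAt (fun s => H (φ s x)) 0 s := by
    intro s
    have h := (hH (φ s x)).hasFDerivAt.comp_hasDerivAt s (hφ.2 x s)
    convert! h using 1
    rw [← isHamiltonianVectorAt_hamVF H (φ s x), stdSymplecticForm]
    exact (Finset.sum_eq_zero fun k _ => by ring).symm
  have := is_const_of_deriv_eq_zero (fun s => (hd s).differentiableAt) (fun s => (hd s).deriv) t 0
  simpa [hφ.1] using this

theorem contDiff_hamVF {H : PhaseSpace n → ℝ} (hH : ContDiff ℝ ∞ H) : ContDiff ℝ ∞ (hamVF H) :=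
  symplecticDual.contDiff.comp (hH.fderiv_right (by simp))

theorem lipschitz_and_bounded_hamVF {H : PhaseSpace n → ℝ} (hH : ContDiff ℝ ∞ H)
    (hc : HasCompactSupport H) :
    (∃ K, LipschitzWith K (hamVF H)) ∧ ∃ C, ∀ x, ‖hamVF H x‖ ≤ C := by
  have h1 : ContDiff ℝ 1 (hamVF H) := (contDiff_hamVF hH).of_le (by simp)
  have h2 : HasCompactSupport (hamVF H) := (hc.fderiv ℝ).comp_left (map_zero _)
  exact ⟨h1.lipschitzWith_of_hasCompactSupport h2 one_ne_zero,
    h2.exists_bound_of_continuous h1.continuous⟩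

end HamiltonianVectorField

/-! ### Compactly supported Hamiltonian diffeomorphisms: composition and rescaling. -/

section HamiltonianDiffeo

variable {n : ℕ}

theorem IsHamiltonianVectorAt.const_mul {H : PhaseSpace n → ℝ} {x V : PhaseSpace n}
    (h : IsHamiltonianVectorAt H x V) (c : ℝ) :
    IsHamiltonianVectorAt (fun y => c * H y) x (c • V) := by
  intro w
  have h1 : fderiv ℝ (fun y => c * H y) x = c • fderiv ℝ H x := by
    exact congrFun (fderiv_const_smul_field (𝕜 := ℝ) (f := H) c) x
  rw [h1, _root_.smul_apply, ← h w, stdSymplecticForm, stdSymplecticForm,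
    smul_eq_mul, Finset.mul_sum]
  refine Finset.sum_congr rfl fun k _ => ?_
  simp only [Pi.smul_apply, smul_eq_mul]
  ring

theorem IsFlowOf.isCompactlySupportedHamDiffeo {U : Set (PhaseSpace n)} {H : PhaseSpace n → ℝ}
    {φ : ℝ → PhaseSpace n → PhaseSpace n} (hφ : IsFlowOf (hamVF H) φ) (hH : ContDiff ℝ ∞ H)
    (hc : HasCompactSupport H) (hU : tsupport H ⊆ U) (T : ℝ) :
    IsCompactlySupportedHamDiffeo U (φ T) := by
  -- The flow run at speed `T` belongs to `T * H`; this also covers negative times.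
  refine ⟨fun _ x => T * H x, fun t x => φ (t * T) x, tsupport H, ?_, hc, hU, ?_, ⟨?_, ?_⟩, ?_⟩
  · exact (contDiff_const.mul (hH.comp contDiff_snd)).contDiffOn
  · intro t _ x hx
    simp only [image_eq_zero_of_notMem_tsupport hx, mul_zero]
  · intro x
    simp [hφ.1]
  · intro x t _
    refine ⟨T • hamVF H (φ (t * T) x), (isHamiltonianVectorAt_hamVF H _).const_mul T, ?_⟩
    have h := (hφ.2 x (t * T)).scomp t ((hasDerivAt_id t).mul_const T)
    simpa using! h.hasDerivWithinAt
  · intro x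
    simp

theorem exists_flow_hamVF {H : PhaseSpace n → ℝ} (hH : ContDiff ℝ ∞ H)
    (hc : HasCompactSupport H) : ∃ φ, IsFlowOf (hamVF H) φ := by
  obtain ⟨⟨K, hK⟩, C, hC⟩ := lipschitz_and_bounded_hamVF hH hc
  exact exists_flow hK hC

/-- A smooth reparametrisation of `[0, 1]` that is constant before time `c / 3` and after time
`(c + 1) / 3`. -/
noncomputable def timeRamp (c t : ℝ) : ℝ := Real.smoothTransition (3 * t - c)

theorem contDiff_timeRamp (c : ℝ) : ContDiff ℝ ∞ (timeRamp c) :=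
  Real.smoothTransition.contDiff.comp ((contDiff_const.mul contDiff_id).sub contDiff_const)

theorem timeRamp_mem (c t : ℝ) : timeRamp c t ∈ Set.Icc (0 : ℝ) 1 :=
  ⟨Real.smoothTransition.nonneg _, Real.smoothTransition.le_one _⟩

theorem hasDerivAt_timeRamp (c t : ℝ) : HasDerivAt (timeRamp c) (deriv (timeRamp c) t) t :=
  ((contDiff_timeRamp c).differentiable (by simp) t).hasDerivAt

theorem timeRamp_of_le {c t : ℝ} (h : 3 * t ≤ c) : timeRamp c t = 0 :=
  Real.smoothTransition.zero_of_nonpos (by linarith)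

theorem timeRamp_of_ge {c t : ℝ} (h : c + 1 ≤ 3 * t) : timeRamp c t = 1 :=
  Real.smoothTransition.one_of_one_le (by linarith)

theorem deriv_timeRamp_of_lt {c t : ℝ} (h : 3 * t < c) : deriv (timeRamp c) t = 0 := by
  have : timeRamp c =ᶠ[nhds t] fun _ => 0 := by
    filter_upwards [gt_mem_nhds (show t < c / 3 by linarith)] with s hs
    exact timeRamp_of_le (by linarith)
  rw [this.deriv_eq, deriv_const]

theorem deriv_timeRamp_of_gt {c t : ℝ} (h : c + 1 < 3 * t) : deriv (timeRamp c) t = 0 := by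
  have : timeRamp c =ᶠ[nhds t] fun _ => 1 := by
    filter_upwards [lt_mem_nhds (show (c + 1) / 3 < t by linarith)] with s hs
    exact timeRamp_of_ge (by linarith)
  rw [this.deriv_eq, deriv_const]

/-- The ramp takes values in [0, 1], so a Hamiltonian known to be smooth only for those times
becomes smooth for all times after reparametrisation. -/
theorem contDiffOn_timeRamp_hamiltonian {H : ℝ → PhaseSpace n → ℝ}
    (hH : ContDiffOn ℝ ∞ (fun p : ℝ × PhaseSpace n => H p.1 p.2) (Set.Icc 0 1 ×ˢ Set.univ))
    (c : ℝ) :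
    ContDiff ℝ ∞ (fun p : ℝ × PhaseSpace n =>
      deriv (timeRamp c) p.1 * H (timeRamp c p.1) p.2) := by
  have h1 : ContDiff ℝ ∞ (fun p : ℝ × PhaseSpace n => deriv (timeRamp c) p.1) := by
    have h := contDiff_infty_iff_deriv.1 (contDiff_timeRamp c)
    exact h.2.comp contDiff_fst
  have h2 : ContDiff ℝ ∞ (fun p : ℝ × PhaseSpace n => (timeRamp c p.1, p.2)) :=
    ((contDiff_timeRamp c).comp contDiff_fst).prodMk contDiff_snd
  have h3 := hH.comp h2.contDiffOn (s := Set.univ) (fun p _ => ⟨timeRamp_mem c p.1, trivial⟩)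
  exact h1.mul (contDiffOn_univ.1 h3)

theorem hasDerivWithinAt_timeRamp_flow {H : ℝ → PhaseSpace n → ℝ}
    {φ : ℝ → PhaseSpace n → PhaseSpace n} (hφ : IsHamiltonianFlow H φ) (c : ℝ)
    (x : PhaseSpace n) (t : ℝ) :
    ∃ V, IsHamiltonianVectorAt (fun y => deriv (timeRamp c) t * H (timeRamp c t) y)
        (φ (timeRamp c t) x) V ∧
      HasDerivWithinAt (fun s => φ (timeRamp c s) x) V (Set.Icc 0 1) t := by
  obtain ⟨V, hV, hd⟩ := hφ.2 x (timeRamp c t) (timeRamp_mem c t)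
  exact ⟨deriv (timeRamp c) t • V, hV.const_mul _,
    hd.scomp t (hasDerivAt_timeRamp c t).hasDerivWithinAt (fun s _ => timeRamp_mem c s)⟩

/-- The two isotopies are run one after the other, the inner one during [0, 1/3] and the outer one
during [2/3, 1]. The rest in between makes the concatenated Hamiltonian smooth in time. -/
theorem IsCompactlySupportedHamDiffeo.comp {U : Set (PhaseSpace n)}
    {Φ Ψ : PhaseSpace n → PhaseSpace n} (hΦ : IsCompactlySupportedHamDiffeo U Φ)
    (hΨ : IsCompactlySupportedHamDiffeo U Ψ) :
    IsCompactlySupportedHamDiffeo U (Φ ∘ Ψ) := by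
  obtain ⟨H₁, φ₁, K₁, hH₁, hK₁, hKU₁, hz₁, hf₁, he₁⟩ := hΦ
  obtain ⟨H₂, φ₂, K₂, hH₂, hK₂, hKU₂, hz₂, hf₂, he₂⟩ := hΨ
  refine ⟨fun t x => deriv (timeRamp 0) t * H₂ (timeRamp 0 t) x
      + deriv (timeRamp 2) t * H₁ (timeRamp 2 t) x,
    fun t x => φ₁ (timeRamp 2 t) (φ₂ (timeRamp 0 t) x), K₁ ∪ K₂, ?_, hK₁.union hK₂,
    Set.union_subset hKU₁ hKU₂, ?_, ⟨?_, ?_⟩, ?_⟩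
  · exact ((contDiffOn_timeRamp_hamiltonian hH₂ 0).add
      (contDiffOn_timeRamp_hamiltonian hH₁ 2)).contDiffOn
  · intro t _ x hx
    rw [Set.mem_union, not_or] at hx
    simp only [hz₁ _ (timeRamp_mem 2 t) x hx.1, hz₂ _ (timeRamp_mem 0 t) x hx.2, mul_zero,
      add_zero]
  · intro x
    simp only [timeRamp_of_le (show 3 * (0 : ℝ) ≤ 2 by norm_num),
      timeRamp_of_le (show 3 * (0 : ℝ) ≤ 0 by norm_num), hf₁.1, hf₂.1]
  · intro x t _
    -- The time 1/2 lies in the resting interval, so on either side only one of the two flows moves.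
    rcases lt_or_ge t (1 / 2) with ht | ht
    · obtain ⟨V, hV, hd⟩ := hasDerivWithinAt_timeRamp_flow hf₂ 0 x t
      have h0 : ∀ s : ℝ, s < 2 / 3 → ∀ y, φ₁ (timeRamp 2 s) y = y := fun s hs y => by
        rw [timeRamp_of_le (by linarith), hf₁.1]
      refine ⟨V, ?_, ?_⟩
      · simpa only [deriv_timeRamp_of_lt (show 3 * t < 2 by linarith), h0 t (by linarith),
          zero_mul, add_zero] using hV
      · refine hd.congr_of_eventuallyEq ?_ (h0 t (by linarith) _)
        filter_upwards [mem_nhdsWithin_of_mem_nhds (gt_mem_nhds (show t < 2 / 3 by linarith))]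
          with s hs using h0 s hs _
    · obtain ⟨V, hV, hd⟩ := hasDerivWithinAt_timeRamp_flow hf₁ 2 (φ₂ 1 x) t
      have h0 : ∀ s : ℝ, 1 / 3 < s → φ₂ (timeRamp 0 s) x = φ₂ 1 x := fun s hs => by
        rw [timeRamp_of_ge (by linarith)]
      refine ⟨V, ?_, ?_⟩
      · simpa only [deriv_timeRamp_of_gt (show 0 + 1 < 3 * t by linarith), h0 t (by linarith),
          zero_mul, zero_add] using hV
      · refine hd.congr_of_eventuallyEq ?_ (by simp only [h0 t (by linarith)])
        filter_upwards [mem_nhdsWithin_of_mem_nhds (lt_mem_nhds (show 1 / 3 < t by linarith))]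
          with s hs
        simp only [h0 s hs]
  · intro x
    simp only [timeRamp_of_ge (show (2 : ℝ) + 1 ≤ 3 * 1 by norm_num),
      timeRamp_of_ge (show (0 : ℝ) + 1 ≤ 3 * 1 by norm_num), Function.comp, he₁, he₂]

theorem IsCompactlySupportedHamDiffeo.rescale {r ε : ℝ} (hε : 0 < ε)
    {Φ : PhaseSpace n → PhaseSpace n} (hΦ : IsCompactlySupportedHamDiffeo (openCube n r) Φ) :
    IsCompactlySupportedHamDiffeo (openCube n (r * ε)) (fun x => ε • Φ (ε⁻¹ • x)) := by
  obtain ⟨H, φ, K, hH, hK, hKU, hz, hf, he⟩ := hΦ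
  have hε' := hε.ne'
  -- The factor `ε ^ 2` is the scaling weight of ω: differentiating in rescaled variables costs one
  -- factor, and the trajectory itself is multiplied by `ε`.
  refine ⟨fun t x => ε ^ 2 * H t (ε⁻¹ • x), fun t x => ε • φ t (ε⁻¹ • x), (fun x => ε • x) '' K,
    ?_, hK.image (continuous_const_smul ε), ?_, ?_, ⟨?_, ?_⟩, fun x => by simp only [he]⟩
  · refine contDiffOn_const.mul (hH.comp (g := fun p : ℝ × PhaseSpace n => H p.1 p.2)
      (f := fun p : ℝ × PhaseSpace n => (p.1, ε⁻¹ • p.2)) ?_ fun p hp => ⟨hp.1, trivial⟩)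
    exact (contDiff_fst.prodMk (contDiff_snd.const_smul ε⁻¹)).contDiffOn
  · rintro _ ⟨x, hx, rfl⟩ i
    have h := hKU hx i
    simp only [Pi.smul_apply, smul_eq_mul, Set.mem_Ioo]
    constructor <;> nlinarith [h.1, h.2]
  · intro t ht x hx
    have h : ε⁻¹ • x ∉ K := fun h => hx ⟨_, h, by simp [smul_smul, hε']⟩
    simp only [hz t ht _ h, mul_zero]
  · intro x
    simp [hf.1, smul_smul, hε']
  · intro x t ht
    obtain ⟨V, hV, hd⟩ := hf.2 (ε⁻¹ • x) t ht
    refine ⟨ε • V, ?_, hd.const_smul ε⟩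
    have h1 : IsHamiltonianVectorAt (fun y => H t (ε⁻¹ • y)) (ε • φ t (ε⁻¹ • x)) (ε⁻¹ • V) := by
      intro w
      rw [fderiv_comp_smul, smul_smul, inv_mul_cancel₀ hε', one_smul,
        _root_.smul_apply, ← hV w, stdSymplecticForm, stdSymplecticForm,
        smul_eq_mul, Finset.mul_sum]
      refine Finset.sum_congr rfl fun k _ => ?_
      simp only [Pi.smul_apply, smul_eq_mul]
      ring
    have h2 := h1.const_mul (ε ^ 2)
    rwa [smul_smul, show ε ^ 2 * ε⁻¹ = ε by field_simp] at h2

end HamiltonianDiffeo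

/-! ### The perturbed translation flow. -/

section PairLemma

variable {n : ℕ}

/-- The index of the first coordinate. -/
def firstIndex (hn : 1 ≤ n) : Fin (2 * n) := ⟨0, by omega⟩

/-- The index of the second coordinate, conjugate to the first one. -/
def secondIndex (hn : 1 ≤ n) : Fin (2 * n) := ⟨1, by omega⟩

theorem symplecticDual_neg_proj (hn : 1 ≤ n) :
    symplecticDual (-ContinuousLinearMap.proj (R := ℝ) (φ := fun _ : Fin (2 * n) => ℝ)
      (firstIndex hn)) = Pi.single (secondIndex hn) 1 := by
  ext i
  rw [symplecticDual_apply]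
  by_cases hi : i = secondIndex hn
  · subst hi
    have h : conjIndex (secondIndex hn) = firstIndex hn := by
      simp [conjIndex, secondIndex, firstIndex]
    rw [h]
    simp [conjSign, secondIndex]
  · have h : firstIndex hn ≠ conjIndex i := by
      intro h
      apply hi
      have h' := congrArg Fin.val h
      ext
      simp only [firstIndex, conjIndex, secondIndex] at h' ⊢
      split_ifs at h' with h2 <;> (simp at h'; omega)
    simp [Pi.single_eq_of_ne h, Pi.single_eq_of_ne hi]

/-- The Hamiltonian `-(x₁ + w)`, whose flow is a perturbation of the translation flow along the
second coordinate. -/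
def shearHam (hn : 1 ≤ n) (w : PhaseSpace n → ℝ) (x : PhaseSpace n) : ℝ :=
  -(x (firstIndex hn) + w x)

theorem contDiff_shearHam (hn : 1 ≤ n) {w : PhaseSpace n → ℝ} (hw : ContDiff ℝ ∞ w) :
    ContDiff ℝ ∞ (shearHam hn w) :=
  ((contDiff_apply ℝ ℝ (firstIndex hn)).add hw).neg

theorem hamVF_shearHam (hn : 1 ≤ n) {w : PhaseSpace n → ℝ} (hw : ContDiff ℝ ∞ w)
    (x : PhaseSpace n) :
    hamVF (shearHam hn w) x = Pi.single (secondIndex hn) 1 - hamVF w x := by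
  have h1 : HasFDerivAt (shearHam hn w)
      (-(ContinuousLinearMap.proj (R := ℝ) (φ := fun _ : Fin (2 * n) => ℝ) (firstIndex hn)
        + fderiv ℝ w x)) x :=
    ((hasFDerivAt_apply (𝕜 := ℝ) (firstIndex hn) x).add
      ((hw.differentiable (by simp)) x).hasFDerivAt).neg
  rw [hamVF, h1.fderiv, neg_add, map_add, symplecticDual_neg_proj, map_neg, hamVF, sub_eq_add_neg]

theorem hamVF_zero (x : PhaseSpace n) : hamVF (fun _ : PhaseSpace n => (0 : ℝ)) x = 0 := by
  rw [hamVF, fderiv_fun_const, Pi.zero_apply, map_zero]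

theorem hamVF_congr {H H' : PhaseSpace n → ℝ} {x : PhaseSpace n} (h : H =ᶠ[nhds x] H') :
    hamVF H x = hamVF H' x := by
  rw [hamVF, hamVF, h.fderiv_eq]

theorem hasCompactSupport_of_forall_norm_le {w : PhaseSpace n → ℝ} {r : ℝ}
    (h : ∀ x, w x ≠ 0 → ‖x‖ ≤ r) : HasCompactSupport w :=
  HasCompactSupport.intro (isCompact_closedBall 0 r) fun x hx => by
    by_contra h'
    exact hx (by simpa using h x h')

theorem tsupport_subset_closedBall {w : PhaseSpace n → ℝ} {r : ℝ}
    (h : ∀ x, w x ≠ 0 → ‖x‖ ≤ r) : tsupport w ⊆ Metric.closedBall 0 r :=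
  closure_minimal (fun x hx => by simpa using h x hx) Metric.isClosed_closedBall

theorem ball_subset_openCube {r : ℝ} (hr : 0 < r) :
    Metric.ball (0 : PhaseSpace n) r = openCube n r := by
  ext x
  simp [openCube, pi_norm_lt_iff hr, abs_lt]

/-- The Hamiltonian lacks compact support, but its field is a constant vector minus a smooth
compactly supported field, hence bounded and Lipschitz. -/
theorem exists_flow_shearHam (hn : 1 ≤ n) {w : PhaseSpace n → ℝ} (hw : ContDiff ℝ ∞ w)
    (hc : HasCompactSupport w) :
    ∃ φ K, IsFlowOf (hamVF (shearHam hn w)) φ ∧ LipschitzWith K (hamVF (shearHam hn w)) := by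
  obtain ⟨⟨K, hK⟩, C, hC⟩ := lipschitz_and_bounded_hamVF hw hc
  have hK' : LipschitzWith (0 + K) (hamVF (shearHam hn w)) := by
    rw [funext (hamVF_shearHam hn hw)]
    exact (LipschitzWith.const _).sub hK
  obtain ⟨φ, hφ⟩ := exists_flow (C := ‖(Pi.single (secondIndex hn) 1 : PhaseSpace n)‖ + C) hK' (by
    intro x
    rw [hamVF_shearHam hn hw]
    exact (norm_sub_le _ _).trans (by gcongr; exact hC x))
  exact ⟨φ, _, hφ, hK'⟩

theorem abs_conjSign (i : Fin (2 * n)) : |conjSign i| = 1 := by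
  rw [conjSign]
  split_ifs <;> simp

/-- Along the perturbed translation flow every coordinate stays close to its unperturbed
evolution. -/
theorem abs_shear_flow_sub_le (hn : 1 ≤ n) {w : PhaseSpace n → ℝ} (hw : ContDiff ℝ ∞ w) {η : ℝ}
    (hη : ∀ x i, |fderiv ℝ w x (Pi.single i 1)| ≤ η) {φ : ℝ → PhaseSpace n → PhaseSpace n}
    (hφ : IsFlowOf (hamVF (shearHam hn w)) φ) (x : PhaseSpace n) {s t : ℝ} (hst : s ≤ t)
    (i : Fin (2 * n)) :
    |φ t x i - φ s x i - (t - s) * (Pi.single (secondIndex hn) 1 : PhaseSpace n) i|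
      ≤ η * (t - s) := by
  have hd : ∀ r, HasDerivAt
      (fun r => φ r x i - r * (Pi.single (secondIndex hn) 1 : PhaseSpace n) i)
      (-hamVF w (φ r x) i) r := by
    intro r
    have h1 := (hasDerivAt_pi.1 (hφ.2 x r) i).sub
      ((hasDerivAt_id r).mul_const ((Pi.single (secondIndex hn) 1 : PhaseSpace n) i))
    convert! h1 using 1
    rw [hamVF_shearHam hn hw]
    simp
  have h := (convex_univ (𝕜 := ℝ) (E := ℝ)).norm_image_sub_le_of_norm_hasDerivWithin_le (C := η)
    (fun r _ => (hd r).hasDerivWithinAt) (fun r _ => by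
      rw [norm_neg, hamVF, symplecticDual_apply, norm_mul, Real.norm_eq_abs, abs_conjSign, one_mul]
      exact hη _ _) (Set.mem_univ s) (Set.mem_univ t)
  rw [Real.norm_eq_abs, Real.norm_eq_abs, abs_of_nonneg (sub_nonneg.2 hst)] at h
  convert h using 2
  ring

/-- Conservation of x₁ + w. This identity turns values of w into displacements of the first
coordinate and is the source of every coboundary below. -/
theorem shear_flow_first (hn : 1 ≤ n) {w : PhaseSpace n → ℝ} (hw : ContDiff ℝ ∞ w)
    {φ : ℝ → PhaseSpace n → PhaseSpace n} (hφ : IsFlowOf (hamVF (shearHam hn w)) φ) (t : ℝ)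
    (x : PhaseSpace n) :
    φ t x (firstIndex hn) = x (firstIndex hn) + w x - w (φ t x) := by
  have h := hφ.hamiltonian_conserved ((contDiff_shearHam hn hw).differentiable (by simp)) t x
  simp only [shearHam] at h
  linarith

/-- After flowing for a time `b` that is long enough to leave the support of `w`, it does not
matter for `w` whether the preceding time `a` was spent in the perturbed flow or in the
translation flow. -/
theorem w_shear_flow_eq (hn : 1 ≤ n) {w : PhaseSpace n → ℝ} (hw : ContDiff ℝ ∞ w)
    (hs : ∀ x, w x ≠ 0 → ‖x‖ ≤ 11 / 10) (hη : ∀ x i, |fderiv ℝ w x (Pi.single i 1)| ≤ 1 / 50)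
    {φ : ℝ → PhaseSpace n → PhaseSpace n} {K : NNReal}
    (hφ : IsFlowOf (hamVF (shearHam hn w)) φ) (hL : LipschitzWith K (hamVF (shearHam hn w)))
    {a : ℝ} (ha : 0 ≤ a) (x : PhaseSpace n) :
    w (φ (a + 23 / 10) x) = w (φ (23 / 10) (x + a • Pi.single (secondIndex hn) 1)) := by
  set e : PhaseSpace n := Pi.single (secondIndex hn) 1 with he
  have heq : e (secondIndex hn) = 1 := by simp [he]
  -- The support has width 22/10 along the flow direction and the speed is at least 49/50. Since
  -- 23/10 · 49/50 > 22/10, a point that lies in the support at time 23/10 started below it.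
  have hlow : ∀ y, w (φ (23 / 10) y) ≠ 0 → y (secondIndex hn) < -11 / 10 := by
    intro y hy
    have h1 := abs_le.1 ((norm_le_pi_norm _ (secondIndex hn)).trans (hs _ hy))
    have h2 := abs_le.1 (abs_shear_flow_sub_le hn hw hη hφ y
      (show (0 : ℝ) ≤ 23 / 10 by norm_num) (secondIndex hn))
    rw [hφ.1, ← he, heq] at h2
    linarith [h1.2, h2.1]
  have hvf : ∀ y : PhaseSpace n, y (secondIndex hn) < -11 / 10 →
      hamVF (shearHam hn w) y = e := by
    intro y hy
    rw [hamVF_shearHam hn hw, ← he]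
    have : w =ᶠ[nhds y] fun _ => 0 := by
      have hopen : {z : PhaseSpace n | z (secondIndex hn) < -11 / 10} ∈ nhds y :=
        (isOpen_lt (continuous_apply _) continuous_const).mem_nhds hy
      filter_upwards [hopen] with z hz
      by_contra h
      have h1 := abs_le.1 ((norm_le_pi_norm _ (secondIndex hn)).trans (hs _ h))
      have hz' : z (secondIndex hn) < -11 / 10 := hz
      linarith [h1.1]
    rw [hamVF_congr this, hamVF_zero, sub_zero]
  have hφe : φ (a + 23 / 10) x = φ (23 / 10) (φ a x) := by rw [add_comm, hφ.add hL]
  -- Below the support the field is exactly `e`. A trajectory that ends there after time a ≥ 0 was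
  -- there throughout, since the second coordinate increases; either endpoint lying below therefore
  -- suffices.
  have key : (φ a x (secondIndex hn) < -11 / 10 ∨ x (secondIndex hn) + a < -11 / 10) →
      φ a x = x + a • e := by
    rintro (h | h)
    · have hmono : ∀ s ∈ Set.Icc 0 a, φ s x (secondIndex hn) < -11 / 10 := by
        intro s hs'
        have h2 := abs_le.1 (abs_shear_flow_sub_le hn hw hη hφ x hs'.2 (secondIndex hn))
        rw [← he, heq] at h2
        linarith [h2.1, hs'.2]
      have hd : ∀ s ∈ Set.Icc 0 a, HasDerivWithinAt (fun s => φ s x - s • e) 0 (Set.Icc 0 a) s := by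
        intro s hs'
        have h3 := (hφ.2 x s).sub ((hasDerivAt_id s).smul_const e)
        rw [hvf _ (hmono s hs'), one_smul, sub_self] at h3
        exact h3.hasDerivWithinAt
      have h4 := (convex_Icc 0 a).norm_image_sub_le_of_norm_hasDerivWithin_le (C := 0) hd
        (by simp) (Set.left_mem_Icc.2 ha) (Set.right_mem_Icc.2 ha)
      rw [zero_mul, norm_le_zero_iff, hφ.1, zero_smul, sub_zero, sub_eq_zero] at h4
      exact sub_eq_iff_eq_add.1 h4
    · have h5 := hφ.eq_of_curve hL (γ := fun s => x + s • e) (T := a) (by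
        intro s hs'
        rw [Set.uIcc_of_le ha] at hs'
        rw [hvf]
        · simpa using! ((hasDerivAt_id s).smul_const e).const_add x
        · simp only [Pi.add_apply, Pi.smul_apply, heq, smul_eq_mul]
          linarith [hs'.2]) a Set.right_mem_uIcc
      simpa using h5
  by_cases h1 : w (φ (a + 23 / 10) x) = 0
  · by_cases h2 : w (φ (23 / 10) (x + a • e)) = 0
    · rw [h1, h2]
    · have h3 := hlow _ h2
      simp only [Pi.add_apply, Pi.smul_apply, heq, smul_eq_mul, mul_one] at h3
      rw [hφe, key (Or.inr h3)]
  · rw [hφe] at h1 ⊢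
    rw [key (Or.inl (hlow _ h1))]

end PairLemma

/-! ### A coboundary from one pair of diffeomorphisms. -/

section ExistsPair

variable {n : ℕ}

theorem exists_cutoff (n : ℕ) : ∃ χ : PhaseSpace n → ℝ, ContDiff ℝ ∞ χ ∧
    (∀ x, ‖x‖ ≤ 37 / 10 → χ x = 1) ∧ HasCompactSupport χ ∧ tsupport χ ⊆ openCube n 4 := by
  -- The radii leave room for trajectories that stay within 73/20 < 37/10, while the support stays
  -- inside the cube of half-width 4.
  let B : ContDiffBump (0 : PhaseSpace n) := ⟨37 / 10, 39 / 10, by norm_num, by norm_num⟩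
  refine ⟨B, B.contDiff, fun x hx => B.one_of_mem_closedBall (by simpa using hx),
    B.hasCompactSupport, ?_⟩
  rw [B.tsupport_eq, ← ball_subset_openCube (by norm_num)]
  exact Metric.closedBall_subset_ball (by norm_num)

/-- Cutting off a Hamiltonian does not change its vector field inside the smaller cube. -/
theorem hamVF_cutoff {χ H : PhaseSpace n → ℝ} (hχ : ∀ x, ‖x‖ ≤ 37 / 10 → χ x = 1)
    {x : PhaseSpace n} (hx : ‖x‖ < 37 / 10) : hamVF (fun y => χ y * H y) x = hamVF H x := by
  refine hamVF_congr ?_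
  filter_upwards [(isOpen_lt continuous_norm continuous_const).mem_nhds hx] with y hy
  rw [hχ y (le_of_lt hy), one_mul]

theorem norm_le_of_coord {x y : PhaseSpace n} (hn : 1 ≤ n) {r c : ℝ} (hr : 0 ≤ r)
    (h1 : ∀ i ≠ secondIndex hn, |y i - x i| ≤ c ∧ |x i| + c ≤ r)
    (h2 : |y (secondIndex hn)| ≤ r) : ‖y‖ ≤ r := by
  rw [pi_norm_le_iff_of_nonneg hr]
  intro i
  by_cases hi : i = secondIndex hn
  · rw [hi]; exact h2
  · have h3 := abs_le.1 (h1 i hi).1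
    have h4 := (h1 i hi).2
    rw [Real.norm_eq_abs, abs_le]
    constructor <;> linarith [neg_abs_le (x i), le_abs_self (x i)]

/-- The difference of a small bump `w` and its translate along the second coordinate is realised
by a single pair of compactly supported Hamiltonian diffeomorphisms. -/
theorem exists_pair_translate (hn : 1 ≤ n) {w : PhaseSpace n → ℝ} (hw : ContDiff ℝ ∞ w)
    (hs : ∀ x, w x ≠ 0 → ‖x‖ ≤ 11 / 10) (hη : ∀ x i, |fderiv ℝ w x (Pi.single i 1)| ≤ 1 / 50)
    {a : ℝ} (ha0 : 0 ≤ a) (ha : a ≤ 1 / 5) :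
    ∃ Φ Ψ : PhaseSpace n → PhaseSpace n, IsCompactlySupportedHamDiffeo (openCube n 4) Φ ∧
      IsCompactlySupportedHamDiffeo (openCube n 4) Ψ ∧
      ∀ x, w x - w (x + a • Pi.single (secondIndex hn) 1)
        = Φ x (firstIndex hn) - Ψ x (firstIndex hn) := by
  obtain ⟨χ, hχs, hχ1, hχc, hχt⟩ := exists_cutoff n
  have hwc := hasCompactSupport_of_forall_norm_le hs
  set q := secondIndex hn with hq
  set e : PhaseSpace n := Pi.single q 1 with he
  have heq : e q = 1 := by simp [he]
  have hei : ∀ i ≠ q, e i = 0 := fun i hi => by simp [he, hi]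
  have hz : ContDiff ℝ ∞ (fun _ : PhaseSpace n => (0 : ℝ)) := contDiff_const
  have mk : ∀ u : PhaseSpace n → ℝ, ContDiff ℝ ∞ u →
      ContDiff ℝ ∞ (fun x => χ x * shearHam hn u x) ∧
      HasCompactSupport (fun x => χ x * shearHam hn u x) ∧
      tsupport (fun x => χ x * shearHam hn u x) ⊆ openCube n 4 := fun u hu =>
    ⟨hχs.mul (contDiff_shearHam hn hu), hχc.mul_right,
      (tsupport_mul_subset_left (f := χ) (g := shearHam hn u)).trans hχt⟩
  obtain ⟨hN1, hN2, hN3⟩ := mk _ hz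
  obtain ⟨hM1, hM2, hM3⟩ := mk _ hw
  set HN : PhaseSpace n → ℝ := fun x => χ x * shearHam hn (fun _ => 0) x with hHN
  set HM : PhaseSpace n → ℝ := fun x => χ x * shearHam hn w x with hHM
  obtain ⟨N, hN⟩ := exists_flow_hamVF hN1 hN2
  obtain ⟨M, hM⟩ := exists_flow_hamVF hM1 hM2
  obtain ⟨KN, hKN⟩ := (lipschitz_and_bounded_hamVF hN1 hN2).1
  obtain ⟨KM, hKM⟩ := (lipschitz_and_bounded_hamVF hM1 hM2).1
  obtain ⟨S, KS, hS, hKS⟩ := exists_flow_shearHam hn hw hwc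
  have hNe : ∀ y : PhaseSpace n, ‖y‖ < 37 / 10 → hamVF HN y = e := fun y hy => by
    rw [hHN, hamVF_cutoff hχ1 hy, hamVF_shearHam hn hz, hamVF_zero, sub_zero]
  have hMS : ∀ y : PhaseSpace n, ‖y‖ < 37 / 10 → hamVF HM y = hamVF (shearHam hn w) y :=
    fun y hy => hamVF_cutoff hχ1 hy
  have hMN : ∀ y : PhaseSpace n, 11 / 10 < ‖y‖ → hamVF HM y = hamVF HN y := by
    intro y hy
    refine hamVF_congr ?_
    filter_upwards [(isOpen_lt continuous_const continuous_norm).mem_nhds hy] with z hz'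
    have : w z = 0 := by
      by_contra h
      exact absurd (hs z h) (not_le.2 hz')
    simp [hHM, hHN, shearHam, this]
  -- straight segments inside the small cube are trajectories of the cut-off translation
  have hstraight : ∀ (y : PhaseSpace n) (T : ℝ), (∀ s ∈ Set.uIcc 0 T, ‖y + s • e‖ < 37 / 10) →
      ∀ s ∈ Set.uIcc 0 T, N s y = y + s • e := by
    intro y T h s hs'
    have := hN.eq_of_curve hKN (γ := fun s => y + s • e) (T := T) (fun s hs' => by
      rw [hNe _ (h s hs')]
      simpa using! ((hasDerivAt_id s).smul_const e).const_add y) s hs'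
    simpa using this
  have hMSflow : ∀ (y : PhaseSpace n) (T : ℝ), (∀ s ∈ Set.uIcc 0 T, ‖S s y‖ < 37 / 10) →
      M T y = S T y := by
    intro y T h
    have := hM.eq_of_curve hKM (γ := fun s => S s y) (T := T) (fun s hs' => by
      rw [hMS _ (h s hs')]
      exact hS.2 y s) T Set.right_mem_uIcc
    simpa [hS.1] using this
  have hMNflow : ∀ (y : PhaseSpace n) (T : ℝ), (∀ s ∈ Set.uIcc 0 T, 11 / 10 < ‖N s y‖) →
      M T y = N T y := by
    intro y T h
    have := hM.eq_of_curve hKM (γ := fun s => N s y) (T := T) (fun s hs' => by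
      rw [hMN _ (h s hs')]
      exact hN.2 y s) T Set.right_mem_uIcc
    simpa [hN.1] using this
  -- `M` and `N` are the cut-off versions of the perturbed and of the pure translation. Both maps
  -- last a + 23/10 in total; they differ only in whether the first time `a` is spent in the
  -- perturbed flow.
  refine ⟨M (a + 23 / 10), M (23 / 10) ∘ N a,
    hM.isCompactlySupportedHamDiffeo hM1 hM2 hM3 _,
    (hM.isCompactlySupportedHamDiffeo hM1 hM2 hM3 _).comp
      (hN.isCompactlySupportedHamDiffeo hN1 hN2 hN3 _), fun x => ?_⟩
  have hT : 0 ≤ a + 23 / 10 := by linarith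
  -- Either the unperturbed trajectory meets the cube containing the support of `w`, and then the
  -- cut-off is invisible throughout, or it misses that cube, and then `M` and `N` coincide along
  -- it.
  by_cases hcase : ∃ t ∈ Set.Icc 0 (a + 23 / 10), ‖N t x‖ ≤ 11 / 10
  · obtain ⟨t, ht, hxt⟩ := hcase
    set y := N t x with hy
    have hyi : ∀ i, |y i| ≤ 11 / 10 := fun i => (norm_le_pi_norm y i).trans hxt
    have hxy : x = y + (-t) • e := by
      rw [← hstraight y (-t) ?_ (-t) Set.right_mem_uIcc, hy, hN.neg_apply hKN]
      intro s hs'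
      rw [Set.uIcc_of_ge (by linarith [ht.1])] at hs'
      -- 36/10 = 11/10 + 5/2: the half-width of the cube plus the longest possible total time.
      refine lt_of_le_of_lt (b := 36 / 10) ?_ (by norm_num)
      have h2 := abs_le.1 (hyi q)
      refine norm_le_of_coord hn (x := y) (c := 0) (by norm_num) (fun i hi => ⟨?_, ?_⟩) ?_
      · simp [hei i hi]
      · linarith [hyi i]
      · simp only [Pi.add_apply, Pi.smul_apply, heq, smul_eq_mul, ← hq]
        rw [abs_le]
        constructor <;> linarith [hs'.1, hs'.2, ht.2, h2.1, h2.2]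
    have hxq : x q = y q - t := by
      rw [hxy]
      simp only [Pi.add_apply, Pi.smul_apply, heq, smul_eq_mul]
      ring
    have hxi : ∀ i ≠ q, |x i| ≤ 11 / 10 := fun i hi => by
      rw [hxy]
      simpa [hei i hi] using hyi i
    have hxl : -36 / 10 ≤ x q := by
      rw [hxq]
      linarith [(abs_le.1 (hyi q)).1, ht.2]
    have hxu : x q ≤ 11 / 10 := by
      rw [hxq]
      linarith [(abs_le.1 (hyi q)).2, ht.1]
    have hShort : ∀ (z : PhaseSpace n) (T : ℝ), 0 ≤ T → T ≤ 5 / 2 → (∀ i ≠ q, z i = x i) →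
        -36 / 10 ≤ z q → z q + T ≤ 36 / 10 → M T z = S T z := by
      intro z T h0 h5 hzi hzl hzu
      refine hMSflow z T fun s hs' => ?_
      rw [Set.uIcc_of_le h0] at hs'
      have hdr := fun i => abs_shear_flow_sub_le hn hw hη hS z hs'.1 i
      simp only [hS.1, ← hq, ← he, sub_zero] at hdr
      -- The drift from the straight path is at most 1/50 · 5/2 = 1/20, and 73/20 = 36/10 + 1/20.
      refine lt_of_le_of_lt (b := 73 / 20) ?_ (by norm_num)
      refine norm_le_of_coord hn (x := z) (c := 1 / 20) (by norm_num) (fun i hi => ⟨?_, ?_⟩) ?_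
      · have := hdr i
        rw [hei i hi, mul_zero, sub_zero] at this
        linarith [hs'.2]
      · rw [hzi i hi]
        linarith [hxi i hi]
      · have := abs_le.1 (hdr q)
        rw [heq] at this
        rw [← hq, abs_le]
        constructor <;> linarith [hs'.1, hs'.2, this.1, this.2]
    have hNa : N a x = x + a • e := by
      refine hstraight x a (fun s hs' => ?_) a Set.right_mem_uIcc
      rw [Set.uIcc_of_le ha0] at hs'
      refine lt_of_le_of_lt (b := 36 / 10) ?_ (by norm_num)
      refine norm_le_of_coord hn (x := x) (c := 0) (by norm_num) (fun i hi => ⟨?_, ?_⟩) ?_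
      · simp [hei i hi]
      · linarith [hxi i hi]
      · simp only [Pi.add_apply, Pi.smul_apply, heq, smul_eq_mul, ← hq]
        rw [abs_le]
        constructor <;> linarith [hs'.1, hs'.2]
    have h1 : M (a + 23 / 10) x = S (a + 23 / 10) x :=
      hShort x _ hT (by linarith) (fun _ _ => rfl) hxl (by linarith)
    have h2 : M (23 / 10) (x + a • e) = S (23 / 10) (x + a • e) := by
      refine hShort _ _ (by norm_num) (by norm_num) (fun i hi => by simp [hei i hi]) ?_ ?_
      · simp only [Pi.add_apply, Pi.smul_apply, heq, smul_eq_mul]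
        linarith
      · simp only [Pi.add_apply, Pi.smul_apply, heq, smul_eq_mul]
        linarith
    have hpq : firstIndex hn ≠ q := by simp [hq, firstIndex, secondIndex]
    rw [Function.comp_apply, hNa, h1, h2, shear_flow_first hn hw hS, shear_flow_first hn hw hS,
      w_shear_flow_eq hn hw hs hη hS hKS ha0 x]
    simp only [Pi.add_apply, Pi.smul_apply, hei _ hpq, smul_eq_mul, ← hq, ← he]
    ring
  · push Not at hcase
    have hwx : w x = 0 := by
      by_contra h
      have h0 := hcase 0 ⟨le_rfl, hT⟩
      rw [hN.1] at h0
      exact absurd (hs x h) (not_le.2 h0)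
    -- If `x + a • e` were in the cube, flowing back for time `a` would be a straight segment ending
    -- at `x`, so the trajectory of `x` would meet the cube at time `a`.
    have hwx' : w (x + a • e) = 0 := by
      by_contra h
      have hy := hs _ h
      have h3 : N (-a) (x + a • e) = x + a • e + (-a) • e := by
        refine hstraight _ (-a) (fun s hs' => ?_) (-a) Set.right_mem_uIcc
        rw [Set.uIcc_of_ge (by linarith)] at hs'
        refine lt_of_le_of_lt (norm_add_le _ _) ?_
        have he1 : ‖e‖ ≤ 1 := by
          rw [pi_norm_le_iff_of_nonneg zero_le_one]
          intro i
          by_cases hi : i = q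
          · rw [hi, heq]; simp
          · rw [hei i hi]; simp
        have hsa : |s| ≤ 1 / 5 := abs_le.2 ⟨by linarith [hs'.1], by linarith [hs'.2]⟩
        have : ‖s • e‖ ≤ 1 / 5 * 1 := by
          rw [norm_smul]
          exact mul_le_mul hsa he1 (norm_nonneg _) (by norm_num)
        linarith
      rw [add_assoc, ← add_smul, add_neg_cancel, zero_smul, add_zero] at h3
      have h4 := hcase a ⟨ha0, by linarith⟩
      have h5 := hN.neg_apply hKN (-a) (x + a • e)
      rw [h3, neg_neg] at h5
      rw [h5] at h4
      exact absurd hy (not_le.2 h4)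
    have h1 : M (a + 23 / 10) x = N (a + 23 / 10) x := by
      refine hMNflow x _ fun s hs' => hcase s ?_
      rwa [Set.uIcc_of_le hT] at hs'
    have h2 : M (23 / 10) (N a x) = N (23 / 10) (N a x) := by
      refine hMNflow _ _ fun s hs' => ?_
      rw [Set.uIcc_of_le (by norm_num)] at hs'
      rw [← hN.add hKN]
      exact hcase _ ⟨by linarith [hs'.1], by linarith [hs'.2]⟩
    rw [Function.comp_apply, h1, h2, ← hN.add hKN, hwx, hwx', add_comm a, sub_self, sub_self]

end ExistsPair

/-! ### Small divisors and the kernel for the rotation by √2. -/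

section Kernel

open Complex

/-- The `1`-periodic exponential of frequency `m`. -/
noncomputable def fourierMode (m : ℤ) (t : ℝ) : ℂ := exp (2 * Real.pi * I * m * t)

theorem norm_fourierMode (m : ℤ) (t : ℝ) : ‖fourierMode m t‖ = 1 := by
  rw [fourierMode, show (2 * Real.pi * I * m * t : ℂ) = ((2 * Real.pi * m * t : ℝ) : ℂ) * I by
    push_cast; ring]
  exact norm_exp_ofReal_mul_I _

theorem fourierMode_add (m : ℤ) (s t : ℝ) :
    fourierMode m (s + t) = fourierMode m s * fourierMode m t := by
  rw [fourierMode, fourierMode, fourierMode, ← exp_add]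
  congr 1
  push_cast
  ring

theorem fourierMode_int (m k : ℤ) : fourierMode m k = 1 := by
  rw [fourierMode, exp_eq_one_iff]
  exact ⟨m * k, by push_cast; ring⟩

theorem fourierMode_mul_conj (m k : ℤ) (t : ℝ) :
    fourierMode m t * (starRingEnd ℂ) (fourierMode k t) = fourierMode (m - k) t := by
  rw [fourierMode, fourierMode, fourierMode, ← exp_conj, ← exp_add]
  congr 1
  simp only [map_mul, conj_ofReal, conj_I, map_ofNat, map_intCast]
  push_cast
  ring

theorem hasDerivAt_fourierMode (m : ℤ) (t : ℝ) :
    HasDerivAt (fourierMode m) (2 * Real.pi * I * m * fourierMode m t) t := by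
  have h1 : HasDerivAt (fun s : ℝ => (2 * Real.pi * I * m * s : ℂ)) (2 * Real.pi * I * m) t := by
    simpa using! (ofRealCLM.hasDerivAt (x := t)).const_mul (2 * Real.pi * I * m : ℂ)
  have h2 := h1.cexp
  rw [mul_comm (exp _)] at h2
  exact h2

theorem continuous_fourierMode (m : ℤ) : Continuous (fourierMode m) := by
  unfold fourierMode
  fun_prop

theorem integral_fourierMode (N : ℕ) (m : ℤ) :
    ∫ t in (-(N : ℝ))..N, fourierMode m t = if m = 0 then 2 * (N : ℂ) else 0 := by
  split_ifs with h
  · simp only [h, fourierMode, Int.cast_zero, mul_zero, zero_mul, exp_zero]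
    rw [intervalIntegral.integral_const]
    simp
    ring
  · have hne : (2 * Real.pi * I * m : ℂ) ≠ 0 := by
      simp [Real.pi_ne_zero, h]
    have h1 := integral_exp_mul_complex (a := -(N : ℝ)) (b := N) hne
    simp only [fourierMode]
    rw [h1]
    have h2 := fourierMode_int m N
    have h3 := fourierMode_int m (-N)
    simp only [fourierMode] at h2 h3
    push_cast at h2 h3 ⊢
    rw [h2, h3, sub_self, zero_div]

/-- Parseval over 2N periods, by orthogonality of the modes. -/
theorem integral_normSq_trigPolynomial (N : ℕ) (s : Finset ℤ) (c : ℤ → ℂ) :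
    ∫ t in (-(N : ℝ))..N, ‖∑ m ∈ s, c m * fourierMode m t‖ ^ 2
      = 2 * N * ∑ m ∈ s, ‖c m‖ ^ 2 := by
  have hexp : ∀ t : ℝ, ((‖∑ m ∈ s, c m * fourierMode m t‖ ^ 2 : ℝ) : ℂ)
      = ∑ m ∈ s, ∑ k ∈ s, c m * (starRingEnd ℂ) (c k) * fourierMode (m - k) t := by
    intro t
    rw [ofReal_pow, ← mul_conj', map_sum, Finset.sum_mul_sum]
    refine Finset.sum_congr rfl fun m _ => Finset.sum_congr rfl fun k _ => ?_
    rw [map_mul, ← fourierMode_mul_conj]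
    ring
  have hc : ∀ m k, Continuous fun t => c m * (starRingEnd ℂ) (c k) * fourierMode (m - k) t :=
    fun m k => continuous_const.mul (continuous_fourierMode _)
  apply ofReal_injective
  rw [← intervalIntegral.integral_ofReal]
  simp only [hexp]
  rw [intervalIntegral.integral_finsetSum fun m _ =>
    (continuous_finsetSum s fun k _ => hc m k).intervalIntegrable _ _]
  push_cast
  rw [Finset.mul_sum]
  refine Finset.sum_congr rfl fun m hm => ?_
  rw [intervalIntegral.integral_finsetSum fun k _ => (hc m k).intervalIntegrable _ _]
  simp only [intervalIntegral.integral_const_mul, integral_fourierMode, sub_eq_zero]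
  rw [Finset.sum_eq_single m (fun k _ hk => by rw [if_neg (Ne.symm hk), mul_zero])
    (fun h => absurd hm h), if_pos rfl, mul_conj']
  ring

/-- Liouville's argument: (m√2 - k)(m√2 + k) = 2m² - k² is an integer, nonzero because √2 is
irrational, and the second factor is at most 4|m|. -/
theorem one_le_abs_mul_round_sqrt_two {m : ℤ} (hm : m ≠ 0) :
    1 ≤ 4 * |(m : ℝ)| * |m * √2 - round ((m : ℝ) * √2)| := by
  set k := round ((m : ℝ) * √2) with hk
  have hr : |m * √2 - k| ≤ 1 / 2 := abs_sub_round _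
  have hm1 : (1 : ℝ) ≤ |(m : ℝ)| := by exact_mod_cast Int.one_le_abs hm
  have h2 : √2 ^ 2 = 2 := Real.sq_sqrt (by norm_num)
  have h2' : √2 ≤ 3 / 2 := by
    rw [Real.sqrt_le_left (by norm_num)]
    norm_num
  have hprod : (1 : ℝ) ≤ |m * √2 - k| * |m * √2 + k| := by
    rw [← abs_mul, show ((m : ℝ) * √2 - k) * (m * √2 + k) = ((2 * m ^ 2 - k ^ 2 : ℤ) : ℝ) by
      push_cast
      linear_combination (m : ℝ) ^ 2 * h2]
    have hne : 2 * m ^ 2 - k ^ 2 ≠ 0 := by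
      intro h
      have h3 : ((k : ℚ) / m) ^ 2 = 2 := by
        have hmq : (m : ℚ) ≠ 0 := by exact_mod_cast hm
        rw [div_pow, div_eq_iff (pow_ne_zero 2 hmq)]
        have : (2 : ℚ) * m ^ 2 - k ^ 2 = 0 := by exact_mod_cast h
        linarith
      have h4 : |(((k : ℚ) / m : ℚ) : ℝ)| = √2 := by
        rw [← Real.sqrt_sq_eq_abs]
        congr 1
        exact_mod_cast h3
      exact irrational_sqrt_two ⟨|(k : ℚ) / m|, by rw [← h4]; push_cast; rfl⟩
    exact_mod_cast Int.one_le_abs hne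
  have hsum : |m * √2 + k| ≤ 4 * |(m : ℝ)| := by
    have h5 : (m * √2 + k : ℝ) = 2 * (m * √2) - (m * √2 - k) := by ring
    rw [h5]
    refine (abs_sub _ _).trans ?_
    rw [abs_mul, abs_mul, abs_of_nonneg (Real.sqrt_nonneg 2), abs_two]
    nlinarith
  calc (1 : ℝ) ≤ |m * √2 - k| * |m * √2 + k| := hprod
    _ ≤ |m * √2 - k| * (4 * |(m : ℝ)|) := by gcongr
    _ = _ := by ring

theorem one_le_abs_mul_norm_one_sub_fourierMode {m : ℤ} (hm : m ≠ 0) :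
    1 ≤ |(m : ℝ)| * ‖1 - fourierMode m (-√2)‖ := by
  set k := round ((m : ℝ) * √2) with hk
  set d : ℝ := m * √2 - k with hd
  have h1 := one_le_abs_mul_round_sqrt_two hm
  rw [← hk, ← hd] at h1
  have hr : |d| ≤ 1 / 2 := abs_sub_round _
  have h2 : fourierMode m (-√2) = exp (I * ((-(2 * Real.pi * d) : ℝ) : ℂ)) := by
    rw [fourierMode, exp_eq_exp_iff_exists_int]
    refine ⟨-k, ?_⟩
    rw [hd]
    push_cast
    ring
  rw [h2, norm_sub_rev, norm_exp_I_mul_ofReal_sub_one, Real.norm_eq_abs, abs_mul, abs_two,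
    show -(2 * Real.pi * d) / 2 = -(Real.pi * d) by ring, Real.sin_neg, abs_neg]
  -- Jordan's inequality sin y ≥ 2y/π on [0, π/2], available because |d| ≤ 1/2.
  have h3 : 2 * |d| ≤ |Real.sin (Real.pi * d)| := by
    have h4 : |Real.sin (Real.pi * d)| = |Real.sin (Real.pi * |d|)| := by
      rcases abs_cases d with ⟨h, _⟩ | ⟨h, _⟩
      · rw [h]
      · rw [h, mul_neg, Real.sin_neg, abs_neg]
    rw [h4]
    have h5 := Real.mul_le_sin (x := Real.pi * |d|) (by positivity) (by
      nlinarith [Real.pi_pos])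
    rw [show 2 / Real.pi * (Real.pi * |d|) = 2 * |d| by field_simp] at h5
    exact h5.trans (le_abs_self _)
  nlinarith [abs_nonneg (m : ℝ)]

/-- Fourier coefficients of the kernel solving the cohomological equation over the rotation by
`√2`. -/
noncomputable def kernelCoeff (m : ℤ) : ℂ :=
  (1 - fourierMode m (-√2))⁻¹ / (2 * Real.pi * I * m) ^ 3

theorem norm_two_pi_I_mul (m : ℤ) : ‖(2 * Real.pi * I * m : ℂ)‖ = 2 * Real.pi * |(m : ℝ)| := by
  simp [abs_of_pos Real.pi_pos]

/-- The small divisor costs one power of m out of three and the derivative another, so the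
derivative of the kernel keeps square-summable coefficients. -/
theorem norm_deriv_kernelCoeff_le (m : ℤ) :
    ‖2 * Real.pi * I * m * kernelCoeff m‖ ≤ 1 / (2 * Real.pi * |(m : ℝ)|) := by
  by_cases hm : m = 0
  · simp [hm]
  have hm1 : (1 : ℝ) ≤ |(m : ℝ)| := by exact_mod_cast Int.one_le_abs hm
  have h1 := one_le_abs_mul_norm_one_sub_fourierMode hm
  have hpos : 0 < ‖1 - fourierMode m (-√2)‖ := by
    by_contra h
    nlinarith [norm_nonneg (1 - fourierMode m (-√2))]
  have h2 : ‖(1 - fourierMode m (-√2))⁻¹‖ ≤ |(m : ℝ)| := by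
    rw [norm_inv, inv_le_iff_one_le_mul₀ hpos]
    exact h1
  have hpi := Real.pi_gt_three
  rw [kernelCoeff, norm_mul, norm_div, norm_pow, norm_two_pi_I_mul]
  set M := |(m : ℝ)| with hM
  rw [mul_div_assoc', div_le_div_iff₀ (by positivity) (by positivity)]
  have h3 : 2 * Real.pi * M * ‖(1 - fourierMode m (-√2))⁻¹‖ ≤ 2 * Real.pi * M * M := by gcongr
  have h4 : M ≤ 2 * Real.pi * M := by nlinarith
  calc _ ≤ 2 * Real.pi * M * M * (2 * Real.pi * M) := by gcongr
    _ ≤ 2 * Real.pi * M * (2 * Real.pi * M) * (2 * Real.pi * M) := by gcongr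
    _ = _ := by ring

theorem norm_deriv_kernelCoeff_sq_le (m : ℤ) :
    ‖2 * Real.pi * I * m * kernelCoeff m‖ ^ 2 ≤ 1 / (m : ℝ) ^ 2 := by
  by_cases hm : m = 0
  · simp [hm]
  have hm1 : (1 : ℝ) ≤ |(m : ℝ)| := by exact_mod_cast Int.one_le_abs hm
  have hpi := Real.pi_gt_three
  calc _ ≤ (1 / (2 * Real.pi * |(m : ℝ)|)) ^ 2 := by
        gcongr
        exact norm_deriv_kernelCoeff_le m
    _ ≤ (1 / |(m : ℝ)|) ^ 2 := by
        gcongr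
        nlinarith
    _ = _ := by rw [div_pow, sq_abs, one_pow]

theorem norm_kernelCoeff_le (m : ℤ) : ‖kernelCoeff m‖ ≤ 1 / (m : ℝ) ^ 2 := by
  by_cases hm : m = 0
  · simp [hm, kernelCoeff]
  have hm1 : (1 : ℝ) ≤ |(m : ℝ)| := by exact_mod_cast Int.one_le_abs hm
  have hpi := Real.pi_gt_three
  have h := norm_deriv_kernelCoeff_le m
  rw [norm_mul, norm_two_pi_I_mul] at h
  have h1 : |(m : ℝ)| ≤ 2 * Real.pi * |(m : ℝ)| := by nlinarith
  rw [← sq_abs, le_div_iff₀ (by positivity)]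
  rw [le_div_iff₀ (by positivity)] at h
  calc ‖kernelCoeff m‖ * |(m : ℝ)| ^ 2
      = |(m : ℝ)| * ‖kernelCoeff m‖ * |(m : ℝ)| := by ring
    _ ≤ (2 * Real.pi * |(m : ℝ)|) * ‖kernelCoeff m‖ * (2 * Real.pi * |(m : ℝ)|) := by gcongr
    _ ≤ 1 := h

theorem summable_inv_int_sq : Summable fun m : ℤ => 1 / (m : ℝ) ^ 2 :=
  Real.summable_one_div_int_pow.2 (by norm_num)

/-- The kernel solving the cohomological equation over the rotation by `√2`. -/
noncomputable def cohomKernel (t : ℝ) : ℝ := -(∑' m : ℤ, kernelCoeff m * fourierMode m t).re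

theorem norm_kernel_term_le (m : ℤ) (t : ℝ) :
    ‖kernelCoeff m * fourierMode m t‖ ≤ 1 / (m : ℝ) ^ 2 := by
  rw [norm_mul, norm_fourierMode, mul_one]
  exact norm_kernelCoeff_le m

theorem summable_kernel_term (t : ℝ) : Summable fun m : ℤ => kernelCoeff m * fourierMode m t :=
  Summable.of_norm_bounded summable_inv_int_sq fun m => norm_kernel_term_le m t

theorem continuous_cohomKernel : Continuous cohomKernel :=
  (continuous_re.comp (continuous_tsum (fun m => continuous_const.mul (continuous_fourierMode m))
    summable_inv_int_sq norm_kernel_term_le)).neg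

theorem cohomKernel_add_int (t : ℝ) (k : ℤ) : cohomKernel (t + k) = cohomKernel t := by
  simp only [cohomKernel, fourierMode_add, fourierMode_int, mul_one]

theorem bernoulliFun_three (x : ℝ) : bernoulliFun 3 x = x ^ 3 - 3 / 2 * x ^ 2 + x / 2 := by
  simp [bernoulliFun, Polynomial.bernoulli, Finset.sum_range_succ, bernoulli]
  norm_num [Nat.choose]
  ring

/-- Translation by -√2 multiplies the m-th mode by the quantity whose difference from 1 was divided
out, so the small divisor cancels and 1/(2πim)³ remains. These are the Fourier coefficients of
-B₃/6; the minus sign in `cohomKernel` compensates. -/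
theorem cohomKernel_sub {t : ℝ} (ht : t ∈ Set.Icc (0 : ℝ) 1) :
    cohomKernel t - cohomKernel (t - √2) = (t ^ 3 - 3 / 2 * t ^ 2 + t / 2) / 6 := by
  have h1 := (hasSum_one_div_pow_mul_fourier_mul_bernoulliFun (k := 3) (by norm_num) ht).div_const
    ((2 * Real.pi * I : ℂ) ^ 3)
  have hne : (2 * Real.pi * I : ℂ) ≠ 0 := by simp [Real.pi_ne_zero]
  have h2 := (summable_kernel_term t).hasSum.sub (summable_kernel_term (t - √2)).hasSum
  have h3 : (fun m : ℤ => kernelCoeff m * fourierMode m t - kernelCoeff m * fourierMode m (t - √2))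
      = fun m : ℤ => 1 / (m : ℂ) ^ 3 * fourier m (t : UnitAddCircle) / (2 * Real.pi * I) ^ 3 := by
    funext m
    have hf : fourier m (t : UnitAddCircle) = fourierMode m t := by
      rw [fourier_coe_apply, fourierMode]
      simp
    rw [hf]
    by_cases hm : m = 0
    -- At m = 0 both sides are zero by the convention for division by zero; this matches the
    -- vanishing mean of B₃.
    · simp [hm, kernelCoeff]
    have hm' : (m : ℂ) ≠ 0 := by exact_mod_cast hm
    have h4 : 1 - fourierMode m (-√2) ≠ 0 := by
      intro h
      have := one_le_abs_mul_norm_one_sub_fourierMode hm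
      rw [h, norm_zero, mul_zero] at this
      linarith
    rw [sub_eq_add_neg t, fourierMode_add, kernelCoeff]
    have h5 : (2 * Real.pi * I * m : ℂ) ≠ 0 := mul_ne_zero hne hm'
    rw [mul_pow (2 * Real.pi * I : ℂ) (m : ℂ)]
    generalize fourierMode m (-√2) = z at h4 ⊢
    generalize (2 * Real.pi * I : ℂ) = w at hne ⊢
    field_simp
  rw [h3] at h2
  have h6 := h2.unique h1
  rw [show ((Nat.factorial 3 : ℕ) : ℂ) = 6 by norm_num [Nat.factorial],
    show -(2 * Real.pi * I : ℂ) ^ 3 / 6 * (bernoulliFun 3 t : ℂ) / (2 * Real.pi * I) ^ 3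
      = ((-(bernoulliFun 3 t / 6) : ℝ) : ℂ) by push_cast; field_simp] at h6
  have h7 := congrArg re h6
  rw [sub_re, ofReal_re, bernoulliFun_three] at h7
  simp only [cohomKernel]
  linarith

theorem exists_bound_cohomKernel : ∃ C, ∀ t, |cohomKernel t| ≤ C := by
  refine ⟨∑' m : ℤ, 1 / (m : ℝ) ^ 2, fun t => ?_⟩
  rw [cohomKernel, abs_neg]
  exact (abs_re_le_norm _).trans
    (tsum_of_norm_bounded summable_inv_int_sq.hasSum fun m => norm_kernel_term_le m t)

/-- Integrating the kernel against a derivative costs only the supremum of the primitive. -/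
theorem exists_bound_integral_cohomKernel_mul_deriv (N : ℕ) :
    ∃ C, 0 ≤ C ∧ ∀ (p p' : ℝ → ℝ) (S : ℝ), (∀ t, HasDerivAt p (p' t) t) → Continuous p' →
      p N = 0 → p (-N) = 0 → (∀ t, |p t| ≤ S) →
      |∫ t in (-(N : ℝ))..N, cohomKernel t * p' t| ≤ C * S := by
  set D := ∑' m : ℤ, 1 / (m : ℝ) ^ 2 with hD
  have hD0 : 0 ≤ D := tsum_nonneg fun m => by positivity
  refine ⟨2 * N + 2 * N * D, by positivity, fun p p' S hp hp' hN hN' hS => ?_⟩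
  have hS0 : 0 ≤ S := (abs_nonneg _).trans (hS 0)
  have hpc : Continuous p := continuous_iff_continuousAt.2 fun t => (hp t).continuousAt
  set Q : Finset ℤ → ℝ → ℂ := fun s t => ∑ m ∈ s, kernelCoeff m * fourierMode m t with hQ
  set Q' : Finset ℤ → ℝ → ℂ :=
    fun s t => ∑ m ∈ s, (2 * Real.pi * I * m * kernelCoeff m) * fourierMode m t with hQ'
  have hQc : ∀ s, Continuous (Q s) := fun s =>
    continuous_finsetSum _ fun m _ => continuous_const.mul (continuous_fourierMode m)
  have hQ'c : ∀ s, Continuous (Q' s) := fun s =>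
    continuous_finsetSum _ fun m _ => continuous_const.mul (continuous_fourierMode m)
  have hQd : ∀ s t, HasDerivAt (Q s) (Q' s t) t := by
    intro s t
    refine HasDerivAt.fun_sum fun m _ => ?_
    convert! (hasDerivAt_fourierMode m t).const_mul (kernelCoeff m) using 1
    ring
  have hQre : ∀ s t, HasDerivAt (fun t => (Q s t).re) (Q' s t).re t := fun s t =>
    (reCLM.hasFDerivAt (x := Q s t)).comp_hasDerivAt t (hQd s t)
  -- Integration by parts is done for finite partial sums only, so the kernel itself need not be
  -- differentiated; dominated convergence then passes to the limit.
  have hbound : ∀ s, |∫ t in (-(N : ℝ))..N, (Q s t).re * p' t| ≤ (2 * N + 2 * N * D) * S := by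
    intro s
    rw [intervalIntegral.integral_mul_deriv_eq_deriv_mul (fun t _ => hQre s t) (fun t _ => hp t)
      ((continuous_re.comp (hQ'c s)).intervalIntegrable _ _) (hp'.intervalIntegrable _ _),
      hN, hN', mul_zero, mul_zero, sub_zero, zero_sub, abs_neg]
    have h1 : ∀ t, ‖(Q' s t).re * p t‖ ≤ (1 + ‖Q' s t‖ ^ 2) * S := by
      intro t
      rw [norm_mul, Real.norm_eq_abs, Real.norm_eq_abs]
      have h2 := abs_re_le_norm (Q' s t)
      -- The crude inequality y ≤ 1 + y² lets Parseval do the work of Cauchy–Schwarz. It accounts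
      -- for the two terms 2N and 2ND of the constant.
      have h3 : |(Q' s t).re| ≤ 1 + ‖Q' s t‖ ^ 2 := by nlinarith [norm_nonneg (Q' s t)]
      exact mul_le_mul h3 (hS t) (abs_nonneg _) (by positivity)
    have hle : -(N : ℝ) ≤ N := by linarith [Nat.cast_nonneg (α := ℝ) N]
    have hsq : Continuous fun t => ‖Q' s t‖ ^ 2 := (hQ'c s).norm.pow 2
    have h4 := intervalIntegral.norm_integral_le_of_norm_le (μ := MeasureTheory.volume) hle
      (Filter.Eventually.of_forall fun t _ => h1 t)
      ((((continuous_const (y := (1 : ℝ))).add hsq).mul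
        continuous_const).intervalIntegrable _ _)
    refine (Real.norm_eq_abs _ ▸ h4).trans ?_
    rw [intervalIntegral.integral_mul_const, intervalIntegral.integral_add
      (continuous_const.intervalIntegrable _ _) (hsq.intervalIntegrable _ _),
      integral_normSq_trigPolynomial, intervalIntegral.integral_const, smul_eq_mul, mul_one]
    have h5 : ∑ m ∈ s, ‖2 * Real.pi * I * m * kernelCoeff m‖ ^ 2 ≤ D :=
      (Finset.sum_le_sum fun m _ => norm_deriv_kernelCoeff_sq_le m).trans
        (summable_inv_int_sq.sum_le_tsum s fun m _ => by positivity)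
    gcongr
    linarith
  have hlim : Filter.Tendsto (fun s => ∫ t in (-(N : ℝ))..N, (Q s t).re * p' t) Filter.atTop
      (nhds (∫ t in (-(N : ℝ))..N, (∑' m : ℤ, kernelCoeff m * fourierMode m t).re * p' t)) := by
    refine intervalIntegral.tendsto_integral_filter_of_dominated_convergence
      (fun t => D * |p' t|) ?_ ?_ ?_ ?_
    · exact Filter.Eventually.of_forall fun s =>
        ((continuous_re.comp (hQc s)).mul hp').aestronglyMeasurable
    · refine Filter.Eventually.of_forall fun s => Filter.Eventually.of_forall fun t _ => ?_
      rw [norm_mul, Real.norm_eq_abs, Real.norm_eq_abs]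
      gcongr
      refine (abs_re_le_norm _).trans ((norm_sum_le _ _).trans ?_)
      exact (Finset.sum_le_sum fun m _ => norm_kernel_term_le m t).trans
        (summable_inv_int_sq.sum_le_tsum s fun m _ => by positivity)
    · exact (continuous_const.mul hp'.abs).intervalIntegrable _ _
    · refine Filter.Eventually.of_forall fun t _ => ?_
      exact ((continuous_re.tendsto _).comp (summable_kernel_term t).hasSum).mul_const _
  have h := le_of_tendsto hlim.abs (Filter.Eventually.of_forall hbound)
  simpa only [cohomKernel, neg_mul, intervalIntegral.integral_neg, abs_neg] using h

end Kernel

/-! ### Weighted averages along segments. -/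

section LineAverage

open MeasureTheory

/-- The weighted average of `g` along the segments in direction `e`. -/
noncomputable def lineAvg {E F : Type*} [NormedAddCommGroup E] [NormedSpace ℝ E]
    [NormedAddCommGroup F] [NormedSpace ℝ F] (k : ℝ → ℝ) (c : ℝ) (e : E) (g : E → F) (x : E) : F :=
  ∫ t in (-c)..c, k t • g (x + t • e)

variable {E : Type} [NormedAddCommGroup E] [NormedSpace ℝ E]

theorem continuous_lineAvg_integrand {F : Type*} [NormedAddCommGroup F] [NormedSpace ℝ F]
    {k : ℝ → ℝ} (hk : Continuous k) (e : E) {g : E → F} (hg : Continuous g) (x : E) :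
    Continuous fun t : ℝ => k t • g (x + t • e) :=
  hk.smul (hg.comp (continuous_const.add (continuous_id.smul continuous_const)))

theorem hasFDerivAt_lineAvg {F : Type*} [NormedAddCommGroup F] [NormedSpace ℝ F] {k : ℝ → ℝ}
    (hk : Continuous k) (c : ℝ) (e : E) {g : E → F} (hg : ContDiff ℝ 1 g)
    (hc : HasCompactSupport g) (x : E) :
    HasFDerivAt (lineAvg k c e g) (lineAvg k c e (fderiv ℝ g) x) x := by
  have hg' : Continuous (fderiv ℝ g) := hg.continuous_fderiv one_ne_zero
  obtain ⟨C, hC⟩ := (hc.fderiv ℝ).exists_bound_of_continuous hg'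
  refine intervalIntegral.hasFDerivAt_integral_of_dominated_of_fderiv_le (𝕜 := ℝ) (s := Set.univ)
    (F := fun x t => k t • g (x + t • e)) (F' := fun x t => k t • fderiv ℝ g (x + t • e))
    (bound := fun t => |k t| * C) Filter.univ_mem ?_ ?_ ?_ ?_ ?_ ?_
  · exact Filter.Eventually.of_forall fun y =>
      (continuous_lineAvg_integrand hk e hg.continuous y).aestronglyMeasurable
  · exact (continuous_lineAvg_integrand hk e hg.continuous x).intervalIntegrable _ _
  · exact (continuous_lineAvg_integrand hk e hg' x).aestronglyMeasurable
  · refine Filter.Eventually.of_forall fun t _ y _ => ?_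
    rw [norm_smul, Real.norm_eq_abs]
    gcongr
    exact hC _
  · exact (hk.abs.mul continuous_const).intervalIntegrable _ _
  · refine Filter.Eventually.of_forall fun t _ y _ => ?_
    have h := (hg.differentiable one_ne_zero (y + t • e)).hasFDerivAt
    exact ((hasFDerivAt_comp_add_right (t • e)).2 h).const_smul (k t)

theorem contDiff_lineAvg {k : ℝ → ℝ} (hk : Continuous k) (c : ℝ) (e : E) {F : Type}
    [NormedAddCommGroup F] [NormedSpace ℝ F] {g : E → F} (hg : ContDiff ℝ ∞ g)
    (hc : HasCompactSupport g) : ContDiff ℝ ∞ (lineAvg k c e g) := by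
  rw [contDiff_infty]
  intro n
  -- The derivative of an average is the average of the derivative, which has values in another
  -- space; hence the target must vary in the induction.
  induction n generalizing F with
  | zero =>
    rw [Nat.cast_zero, contDiff_zero]
    exact continuous_iff_continuousAt.2 fun x =>
      (hasFDerivAt_lineAvg hk c e (hg.of_le (by simp)) hc x).continuousAt
  | succ n ih =>
    have hd := hasFDerivAt_lineAvg hk c e (hg.of_le (by simp)) hc
    rw [Nat.cast_succ, contDiff_succ_iff_fderiv]
    refine ⟨fun x => (hd x).differentiableAt, by simp, ?_⟩
    rw [show fderiv ℝ (lineAvg k c e g) = lineAvg k c e (fderiv ℝ g) from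
      funext fun x => (hd x).fderiv]
    exact ih (hg.fderiv_right (by simp)) (hc.fderiv ℝ)

theorem norm_lineAvg_le {F : Type*} [NormedAddCommGroup F] [NormedSpace ℝ F] {k : ℝ → ℝ} {c : ℝ}
    (hc : 0 ≤ c) {B M : ℝ} (hB : ∀ t, |k t| ≤ B) (e : E) {g : E → F} (hM : ∀ y, ‖g y‖ ≤ M)
    (x : E) : ‖lineAvg k c e g x‖ ≤ 2 * c * B * M := by
  have hB0 := (abs_nonneg _).trans (hB 0)
  have h := intervalIntegral.norm_integral_le_of_norm_le_const (a := -c) (b := c) (C := B * M)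
    (f := fun t => k t • g (x + t • e)) (fun t _ => by
      rw [norm_smul, Real.norm_eq_abs]
      exact mul_le_mul (hB t) (hM _) (norm_nonneg _) hB0)
  rw [show c - -c = 2 * c by ring, abs_of_nonneg (by linarith)] at h
  refine h.trans (le_of_eq ?_)
  ring

theorem norm_iteratedFDeriv_lineAvg_le {k : ℝ → ℝ} (hk : Continuous k) {c : ℝ} (hc : 0 ≤ c)
    {B M : ℝ} (hB : ∀ t, |k t| ≤ B) (e : E) (n : ℕ) {F : Type} [NormedAddCommGroup F]
    [NormedSpace ℝ F] {g : E → F} (hg : ContDiff ℝ ∞ g) (hs : HasCompactSupport g)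
    (hM : ∀ y, ‖iteratedFDeriv ℝ n g y‖ ≤ M) (x : E) :
    ‖iteratedFDeriv ℝ n (lineAvg k c e g) x‖ ≤ 2 * c * B * M := by
  induction n generalizing F with
  | zero =>
    simp only [norm_iteratedFDeriv_zero] at hM ⊢
    exact norm_lineAvg_le hc hB e hM x
  | succ n ih =>
    have hd := hasFDerivAt_lineAvg hk c e (hg.of_le (by simp)) hs
    rw [← norm_iteratedFDeriv_fderiv, show fderiv ℝ (lineAvg k c e g) = lineAvg k c e (fderiv ℝ g)
      from funext fun x => (hd x).fderiv]
    refine ih (hg.fderiv_right (by simp)) (hs.fderiv ℝ) fun y => ?_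
    rw [norm_iteratedFDeriv_fderiv]
    exact hM y

end LineAverage

/-! ### Directional derivatives. -/

section DirectionalDerivative

variable {E F : Type*} [NormedAddCommGroup E] [NormedSpace ℝ E] [NormedAddCommGroup F]
  [NormedSpace ℝ F]

/-- The derivative of `h` in direction `e`. -/
noncomputable def dirDeriv (e : E) (h : E → F) (x : E) : F := fderiv ℝ h x e

theorem ContDiff.dirDeriv {h : E → F} (hh : ContDiff ℝ ∞ h) (e : E) :
    ContDiff ℝ ∞ (dirDeriv e h) :=
  (hh.fderiv_right (by simp)).clm_apply contDiff_const

theorem HasCompactSupport.dirDeriv {h : E → F} (hh : HasCompactSupport h) (e : E) :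
    HasCompactSupport (dirDeriv e h) :=
  (hh.fderiv ℝ).comp_left (g := fun l : E →L[ℝ] F => l e) rfl

theorem hasDerivAt_line {h : E → F} (hh : ContDiff ℝ ∞ h) (x e : E) (t : ℝ) :
    HasDerivAt (fun s : ℝ => h (x + s • e)) (dirDeriv e h (x + t • e)) t := by
  have h1 : HasDerivAt (fun s : ℝ => x + s • e) e t := by
    simpa using! ((hasDerivAt_id t).smul_const e).const_add x
  exact ((hh.differentiable (by simp)) _).hasFDerivAt.comp_hasDerivAt t h1

/-- Needed to exhibit a gradient component of the solution as the integral of a derivative along the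
line, ready for integration by parts. -/
theorem dirDeriv_comm {h : E → F} (hh : ContDiff ℝ ∞ h) (e v : E) :
    dirDeriv v (dirDeriv e h) = dirDeriv e (dirDeriv v h) := by
  funext x
  have hs : IsSymmSndFDerivAt ℝ h x := hh.contDiffAt.isSymmSndFDerivAt (by
    simp only [minSmoothness_of_isRCLikeNormedField]
    exact WithTop.coe_le_coe.2 (le_top (a := (2 : ℕ∞))))
  have key : ∀ u : E, fderiv ℝ (dirDeriv u h) x = (fderiv ℝ (fderiv ℝ h) x).flip u := by
    intro u
    have hd : HasFDerivAt (fderiv ℝ h) (fderiv ℝ (fderiv ℝ h) x) x :=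
      ((hh.fderiv_right (m := ∞) (by simp)).differentiable (by simp) x).hasFDerivAt
    have h2 := hd.clm_apply (hasFDerivAt_const u x)
    refine (HasFDerivAt.fderiv (f := dirDeriv u h) h2).trans ?_
    ext w
    simp
  rw [_root_.dirDeriv, _root_.dirDeriv, key, key]
  exact hs.eq v e

theorem norm_iteratedFDeriv_dirDeriv_le {h : E → F} (hh : ContDiff ℝ ∞ h) (e : E) (k : ℕ) (x : E) :
    ‖iteratedFDeriv ℝ k (dirDeriv e h) x‖ ≤ ‖e‖ * ‖iteratedFDeriv ℝ (k + 1) h x‖ := by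
  have h1 := (ContinuousLinearMap.apply ℝ F e).norm_iteratedFDeriv_comp_left (f := fderiv ℝ h)
    (x := x) (n := k) (N := ∞) (hh.fderiv_right (by simp)).contDiffAt (by exact_mod_cast le_top)
  rw [norm_iteratedFDeriv_fderiv] at h1
  refine h1.trans ?_
  gcongr
  refine ContinuousLinearMap.opNorm_le_bound _ (norm_nonneg _) fun l => ?_
  rw [mul_comm]
  exact l.le_opNorm e

end DirectionalDerivative

/-! ### Euler–Maclaurin summation with the third Bernoulli polynomial. -/

section BernoulliSum

open MeasureTheory

/-- Three integrations by parts against B₃/6, whose successive derivatives are B₂/2, B₁ and 1. The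
first boundary term vanishes because B₃(0) = B₃(1) = 0. -/
theorem integral_bernoulli_mul_deriv {g₀ g₁ g₂ g₃ : ℝ → ℝ} (h₀ : ∀ t, HasDerivAt g₀ (g₁ t) t)
    (h₁ : ∀ t, HasDerivAt g₁ (g₂ t) t) (h₂ : ∀ t, HasDerivAt g₂ (g₃ t) t) (h₃ : Continuous g₃) :
    ∫ t in (0 : ℝ)..1, (t ^ 3 - 3 / 2 * t ^ 2 + t / 2) / 6 * g₃ t
      = -(g₁ 1 - g₁ 0) / 12 + (g₀ 1 + g₀ 0) / 2 - ∫ t in (0 : ℝ)..1, g₀ t := by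
  have hc₀ : Continuous g₀ := continuous_iff_continuousAt.2 fun t => (h₀ t).continuousAt
  have hd : ∀ t ∈ Set.uIcc (0 : ℝ) 1, HasDerivAt (fun t =>
      (t ^ 3 - 3 / 2 * t ^ 2 + t / 2) / 6 * g₂ t - (3 * t ^ 2 - 3 * t + 1 / 2) / 6 * g₁ t
        + (t - 1 / 2) * g₀ t)
      ((t ^ 3 - 3 / 2 * t ^ 2 + t / 2) / 6 * g₃ t + g₀ t) t := by
    intro t _
    have p1 : HasDerivAt (fun t : ℝ => (t ^ 3 - 3 / 2 * t ^ 2 + t / 2) / 6)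
        ((3 * t ^ 2 - 3 * t + 1 / 2) / 6) t := by
      convert! ((((hasDerivAt_id t).pow 3).sub (((hasDerivAt_id t).pow 2).const_mul (3 / 2))).add
        ((hasDerivAt_id t).div_const 2)).div_const 6 using 1
      simp
      ring
    have p2 : HasDerivAt (fun t : ℝ => (3 * t ^ 2 - 3 * t + 1 / 2) / 6) (t - 1 / 2) t := by
      convert! (((((hasDerivAt_id t).pow 2).const_mul 3).sub
        ((hasDerivAt_id t).const_mul 3)).add_const (1 / 2)).div_const 6 using 1
      simp
      ring
    have p3 : HasDerivAt (fun t : ℝ => t - 1 / 2) 1 t := (hasDerivAt_id t).sub_const _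
    convert! ((p1.mul (h₂ t)).sub (p2.mul (h₁ t))).add (p3.mul (h₀ t)) using 1
    ring
  have hi1 : IntervalIntegrable (fun t : ℝ => (t ^ 3 - 3 / 2 * t ^ 2 + t / 2) / 6 * g₃ t)
      volume 0 1 := (by fun_prop : Continuous _).intervalIntegrable _ _
  have hi2 : IntervalIntegrable g₀ volume 0 1 := hc₀.intervalIntegrable _ _
  have h := intervalIntegral.integral_eq_sub_of_hasDerivAt hd (hi1.add hi2)
  rw [intervalIntegral.integral_add hi1 hi2] at h
  rw [eq_sub_iff_add_eq, h]
  ring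

/-- The periodised sum of a function with zero mean, as an integral against the kernel. -/
theorem integral_cohomKernel_sub {g₀ g₁ g₂ g₃ : ℝ → ℝ} (h₀ : ∀ t, HasDerivAt g₀ (g₁ t) t)
    (h₁ : ∀ t, HasDerivAt g₁ (g₂ t) t) (h₂ : ∀ t, HasDerivAt g₂ (g₃ t) t) (h₃ : Continuous g₃)
    (N : ℕ) (z₀ : g₀ N = 0) (z₀' : g₀ (-N) = 0) (z₁ : g₁ N = 0) (z₁' : g₁ (-N) = 0)
    (hint : ∫ t in (-(N : ℝ))..N, g₀ t = 0) :
    ∫ t in (-(N : ℝ))..N, (cohomKernel t - cohomKernel (t - √2)) * g₃ t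
      = ∑ k ∈ Finset.range (2 * N), g₀ (k - N) := by
  have hc₀ : Continuous g₀ := continuous_iff_continuousAt.2 fun t => (h₀ t).continuousAt
  have hcK : Continuous fun t => (cohomKernel t - cohomKernel (t - √2)) * g₃ t :=
    (continuous_cohomKernel.sub (continuous_cohomKernel.comp (continuous_id.sub
      continuous_const))).mul h₃
  have hends : ((0 : ℕ) - N : ℝ) = -N ∧ ((2 * N : ℕ) - N : ℝ) = N := by
    constructor <;> push_cast <;> ring
  have hunit : ∀ k : ℕ, ∫ t in ((k : ℝ) - N)..(((k + 1 : ℕ) : ℝ) - N),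
      (cohomKernel t - cohomKernel (t - √2)) * g₃ t
      = -(g₁ (((k + 1 : ℕ) : ℝ) - N) - g₁ (k - N)) / 12
        + (g₀ (((k + 1 : ℕ) : ℝ) - N) + g₀ (k - N)) / 2
        - ∫ t in ((k : ℝ) - N)..(((k + 1 : ℕ) : ℝ) - N), g₀ t := by
    intro k
    set a : ℝ := k - N with ha
    have ha1 : (((k + 1 : ℕ) : ℝ) - N) = 1 + a := by push_cast; ring
    have h := integral_bernoulli_mul_deriv (g₀ := fun t => g₀ (t + a)) (g₁ := fun t => g₁ (t + a))
      (g₂ := fun t => g₂ (t + a)) (g₃ := fun t => g₃ (t + a))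
      (fun t => (h₀ (t + a)).comp_add_const t a) (fun t => (h₁ (t + a)).comp_add_const t a)
      (fun t => (h₂ (t + a)).comp_add_const t a) (h₃.comp (continuous_id.add continuous_const))
    rw [intervalIntegral.integral_comp_add_right (fun t => g₀ t), zero_add] at h
    rw [ha1, ← h]
    have h2 := intervalIntegral.integral_comp_add_right (a := 0) (b := 1)
      (fun t => (cohomKernel t - cohomKernel (t - √2)) * g₃ t) a
    rw [zero_add] at h2
    rw [← h2]
    refine intervalIntegral.integral_congr fun t ht => ?_
    rw [Set.uIcc_of_le zero_le_one] at ht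
    have e1 : t + a = t + ((k - N : ℤ) : ℝ) := by rw [ha]; push_cast; ring
    have e2 : t + a - √2 = t - √2 + ((k - N : ℤ) : ℝ) := by rw [ha]; push_cast; ring
    have e3 : cohomKernel (t + a) = cohomKernel t := by rw [e1, cohomKernel_add_int]
    have e4 : cohomKernel (t + a - √2) = cohomKernel (t - √2) := by rw [e2, cohomKernel_add_int]
    simp only [e3, e4, cohomKernel_sub ht]
  have hsum := intervalIntegral.sum_integral_adjacent_intervals (n := 2 * N)
    (a := fun k : ℕ => (k : ℝ) - N) (f := fun t => (cohomKernel t - cohomKernel (t - √2)) * g₃ t)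
    (μ := volume) fun k _ => hcK.intervalIntegrable _ _
  have hsum0 := intervalIntegral.sum_integral_adjacent_intervals (n := 2 * N)
    (a := fun k : ℕ => (k : ℝ) - N) (f := g₀)
    (μ := volume) fun k _ => hc₀.intervalIntegrable _ _
  simp only [hends.1, hends.2] at hsum hsum0
  rw [← hsum, Finset.sum_congr rfl fun k _ => hunit k, Finset.sum_sub_distrib, hsum0, hint,
    sub_zero, Finset.sum_add_distrib, ← Finset.sum_div, Finset.sum_neg_distrib,
    Finset.sum_range_sub (fun k : ℕ => g₁ ((k : ℝ) - N)), hends.1, hends.2, z₁, z₁', sub_zero,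
    neg_zero, zero_div, zero_add, ← Finset.sum_div, Finset.sum_add_distrib]
  -- Since `g₀` vanishes at both ends, its sums over left and over right endpoints agree, and the
  -- trapezoidal sum becomes the plain one.
  have h5 := Finset.sum_range_sub (fun k : ℕ => g₀ ((k : ℝ) - N)) (2 * N)
  rw [hends.1, hends.2, z₀, z₀', sub_zero, Finset.sum_sub_distrib, sub_eq_zero] at h5
  rw [h5]
  ring

end BernoulliSum

/-! ### The cohomological equation along one coordinate. -/

section Cohomology

open MeasureTheory

variable {n : ℕ}

/-- All derivatives of order at most `k` are bounded by `M`. -/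
def DerivBound (k : ℕ) (g : PhaseSpace n → ℝ) (M : ℝ) : Prop :=
  ∀ j ≤ k, ∀ x, ‖iteratedFDeriv ℝ j g x‖ ≤ M

theorem DerivBound.nonneg {k : ℕ} {g : PhaseSpace n → ℝ} {M : ℝ} (h : DerivBound k g M) : 0 ≤ M :=
  (norm_nonneg _).trans (h 0 (Nat.zero_le k) 0)

theorem DerivBound.abs_le {k : ℕ} {g : PhaseSpace n → ℝ} {M : ℝ} (h : DerivBound k g M)
    (x : PhaseSpace n) : |g x| ≤ M := by
  simpa using h 0 (Nat.zero_le k) x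

theorem DerivBound.norm_fderiv_le {k : ℕ} {g : PhaseSpace n → ℝ} {M : ℝ}
    (h : DerivBound (k + 1) g M) (x : PhaseSpace n) : ‖fderiv ℝ g x‖ ≤ M := by
  have := h 1 (by omega) x
  rwa [← norm_iteratedFDeriv_fderiv, norm_iteratedFDeriv_zero] at this

theorem DerivBound.dirDeriv {k : ℕ} {g : PhaseSpace n → ℝ} {M : ℝ} (h : DerivBound (k + 1) g M)
    (hg : ContDiff ℝ ∞ g) (e : PhaseSpace n) : DerivBound k (dirDeriv e g) (‖e‖ * M) := by
  intro j hj x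
  refine (norm_iteratedFDeriv_dirDeriv_le hg e j x).trans ?_
  gcongr
  exact h _ (by omega) x

theorem norm_fderiv_eq_zero_of_lt {F : PhaseSpace n → ℝ} {r : ℝ} (h : ∀ x, F x ≠ 0 → ‖x‖ ≤ r)
    {x : PhaseSpace n} (hx : r < ‖x‖) : fderiv ℝ F x = 0 := by
  refine image_eq_zero_of_notMem_tsupport fun h' => ?_
  have := tsupport_subset_closedBall h (tsupport_fderiv_subset ℝ h')
  rw [mem_closedBall_zero_iff] at this
  linarith

theorem abs_dirDeriv_eq_zero {F : PhaseSpace n → ℝ} {r : ℝ} (h : ∀ x, F x ≠ 0 → ‖x‖ ≤ r)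
    (e x : PhaseSpace n) (hx : dirDeriv e F x ≠ 0) : ‖x‖ ≤ r := by
  by_contra h'
  exact hx (by rw [dirDeriv, norm_fderiv_eq_zero_of_lt h (not_le.1 h')]; rfl)

theorem norm_fderiv_coord_mul_le (i : Fin (2 * n)) {a : ℝ → ℝ} {u : PhaseSpace n → ℝ}
    (ha : ContDiff ℝ ∞ a) {x : PhaseSpace n} (hu : DifferentiableAt ℝ u x) {A M : ℝ}
    (h1 : |a (x i)| ≤ A) (h2 : |deriv a (x i)| ≤ A) (h3 : |u x| ≤ M) (h4 : ‖fderiv ℝ u x‖ ≤ M) :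
    ‖fderiv ℝ (fun y => a (y i) * u y) x‖ ≤ 2 * A * M := by
  have hA : 0 ≤ A := (abs_nonneg _).trans h1
  have hM : 0 ≤ M := (abs_nonneg _).trans h3
  have hp : HasFDerivAt (fun y : PhaseSpace n => y i)
      (ContinuousLinearMap.proj (R := ℝ) (φ := fun _ : Fin (2 * n) => ℝ) i) x :=
    hasFDerivAt_apply (𝕜 := ℝ) i x
  have ha' : HasFDerivAt (fun y : PhaseSpace n => a (y i))
      (deriv a (x i) • ContinuousLinearMap.proj (R := ℝ) (φ := fun _ : Fin (2 * n) => ℝ) i) x :=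
    ((ha.differentiable (by simp)) (x i)).hasDerivAt.comp_hasFDerivAt x hp
  rw [HasFDerivAt.fderiv (f := fun y => a (y i) * u y) (ha'.mul hu.hasFDerivAt)]
  have hproj : ‖ContinuousLinearMap.proj (R := ℝ) (φ := fun _ : Fin (2 * n) => ℝ) i‖ ≤ 1 :=
    ContinuousLinearMap.opNorm_le_bound _ zero_le_one fun y => by
      rw [one_mul]; exact norm_le_pi_norm y i
  refine (norm_add_le _ _).trans ?_
  rw [norm_smul, norm_smul, norm_smul, Real.norm_eq_abs, Real.norm_eq_abs, Real.norm_eq_abs]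
  have e1 : |a (x i)| * ‖fderiv ℝ u x‖ ≤ A * M := by gcongr
  have e2 : |u x| * (|deriv a (x i)| *
      ‖ContinuousLinearMap.proj (R := ℝ) (φ := fun _ : Fin (2 * n) => ℝ) i‖) ≤ M * (A * 1) := by
    gcongr
  linarith

/-- A smooth step from `0` on `(-∞, 0]` to `1` on `[1/8, ∞)`. -/
noncomputable def smoothStep (s : ℝ) : ℝ := Real.smoothTransition (8 * s)

theorem contDiff_smoothStep : ContDiff ℝ ∞ smoothStep :=
  Real.smoothTransition.contDiff.comp (contDiff_const.mul contDiff_id)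

theorem smoothStep_of_le {s : ℝ} (hs : s ≤ 0) : smoothStep s = 0 :=
  Real.smoothTransition.zero_of_nonpos (by linarith)

theorem smoothStep_of_ge {s : ℝ} (hs : 1 / 8 ≤ s) : smoothStep s = 1 :=
  Real.smoothTransition.one_of_one_le (by linarith)

theorem exists_bound_on_Icc {a : ℝ → ℝ} (ha : ContDiff ℝ ∞ a) (R : ℝ) :
    ∃ A, 0 ≤ A ∧ ∀ s, |s| ≤ R → |a s| ≤ A ∧ |deriv a s| ≤ A := by
  obtain ⟨A₁, h₁⟩ := isCompact_Icc.exists_bound_of_continuousOn (s := Set.Icc (-R) R)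
    ha.continuous.continuousOn
  obtain ⟨A₂, h₂⟩ := isCompact_Icc.exists_bound_of_continuousOn (s := Set.Icc (-R) R)
    (ha.continuous_deriv (by simp)).continuousOn
  refine ⟨max 0 (max A₁ A₂), le_max_left _ _, fun s hs => ?_⟩
  exact ⟨(h₁ s (abs_le.1 hs)).trans ((le_max_left _ _).trans (le_max_right _ _)),
    (h₂ s (abs_le.1 hs)).trans ((le_max_right _ _).trans (le_max_right _ _))⟩

/-- One eighth of a coordinate vector. -/
noncomputable def eighth (i : Fin (2 * n)) : PhaseSpace n := (1 / 8 : ℝ) • Pi.single i 1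

theorem add_smul_eighth_self (x : PhaseSpace n) (i : Fin (2 * n)) (t : ℝ) :
    (x + t • eighth i) i = x i + t / 8 := by
  simp [eighth]
  ring

theorem add_smul_eighth_ne (x : PhaseSpace n) {i j : Fin (2 * n)} (h : j ≠ i) (t : ℝ) :
    (x + t • eighth i) j = x j := by
  simp [eighth, h]

theorem norm_eighth_le (i : Fin (2 * n)) : ‖(eighth i : PhaseSpace n)‖ ≤ 1 := by
  rw [pi_norm_le_iff_of_nonneg zero_le_one]
  intro j
  by_cases h : j = i
  · subst h
    norm_num [eighth]
  · simp [eighth, h]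

/-- The solution, along the `i`-th coordinate, of the cohomological equation over the translation
by `√2 / 8` modulo `1 / 8`. -/
noncomputable def cohomSol (i : Fin (2 * n)) (h : PhaseSpace n → ℝ) : PhaseSpace n → ℝ :=
  lineAvg cohomKernel (40 : ℕ) (eighth i)
    (dirDeriv (eighth i) (dirDeriv (eighth i) (dirDeriv (eighth i) h)))

theorem contDiff_cohomSol (i : Fin (2 * n)) {h : PhaseSpace n → ℝ} (hh : ContDiff ℝ ∞ h)
    (hs : ∀ x, h x ≠ 0 → ‖x‖ ≤ 1) : ContDiff ℝ ∞ (cohomSol i h) :=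
  contDiff_lineAvg continuous_cohomKernel _ _ (((hh.dirDeriv _).dirDeriv _).dirDeriv _)
    ((((hasCompactSupport_of_forall_norm_le hs).dirDeriv _).dirDeriv _).dirDeriv _)

theorem cohomSol_support (i : Fin (2 * n)) {h : PhaseSpace n → ℝ}
    (hs : ∀ x, h x ≠ 0 → ‖x‖ ≤ 1) {x : PhaseSpace n} (hx : cohomSol i h x ≠ 0) :
    ∀ j ≠ i, |x j| ≤ 1 := by
  intro j hj
  by_contra hlt
  apply hx
  have hz : ∀ t : ℝ, dirDeriv (eighth i) (dirDeriv (eighth i) (dirDeriv (eighth i) h))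
      (x + t • eighth i) = 0 := by
    intro t
    by_contra hne
    have h1 := abs_dirDeriv_eq_zero (abs_dirDeriv_eq_zero (abs_dirDeriv_eq_zero hs _) _) _ _ hne
    have h2 := (norm_le_pi_norm _ j).trans h1
    rw [add_smul_eighth_ne x hj] at h2
    exact hlt h2
  simp [cohomSol, lineAvg, hz]

/-- A change of variable moves the translation from the function to the kernel. Periodicity and the
difference equation for the solution then become properties of the kernel. -/
theorem cohomSol_shift (i : Fin (2 * n)) {h : PhaseSpace n → ℝ}
    (hs : ∀ x, h x ≠ 0 → ‖x‖ ≤ 1) {x : PhaseSpace n} (hx : |x i| ≤ 3) {s : ℝ} (hxs : |x i + s / 8| ≤ 3) :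
    cohomSol i h (x + s • eighth i) = ∫ t in (-((40 : ℕ) : ℝ))..(40 : ℕ), cohomKernel (t - s) *
      dirDeriv (eighth i) (dirDeriv (eighth i) (dirDeriv (eighth i) h)) (x + t • eighth i) := by
  set g := dirDeriv (eighth i) (dirDeriv (eighth i) (dirDeriv (eighth i) h)) with hg
  have hgs : ∀ y, g y ≠ 0 → |y i| ≤ 1 := fun y hy =>
    (norm_le_pi_norm _ i).trans
      (abs_dirDeriv_eq_zero (abs_dirDeriv_eq_zero (abs_dirDeriv_eq_zero hs _) _) _ _ hy)
  -- The integrand needs |y i + t/8| ≤ 1, so |y i| ≤ 3 forces |t| ≤ 32. Truncation at 40 therefore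
  -- loses nothing and the integral may be taken over the whole line.
  have hsub : ∀ (y : PhaseSpace n) (k : ℝ → ℝ), |y i| ≤ 3 →
      Function.support (fun t : ℝ => k t * g (y + t • eighth i))
        ⊆ Set.Ioc (-((40 : ℕ) : ℝ)) (40 : ℕ) := by
    intro y k hy t ht
    have h1 := hgs _ (right_ne_zero_of_mul ht)
    rw [add_smul_eighth_self, abs_le] at h1
    rw [abs_le] at hy
    push_cast
    constructor <;> linarith [h1.1, h1.2, hy.1, hy.2]
  rw [cohomSol, lineAvg]
  simp only [smul_eq_mul]
  rw [intervalIntegral.integral_eq_integral_of_support_subset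
      (hsub _ cohomKernel (by rwa [add_smul_eighth_self])),
    intervalIntegral.integral_eq_integral_of_support_subset (hsub _ (fun t => cohomKernel (t - s)) hx),
    ← integral_add_right_eq_self (fun t => cohomKernel (t - s) * g (x + t • eighth i)) s]
  congr 1
  funext t
  rw [add_sub_cancel_right, add_assoc, ← add_smul, add_comm s t]

theorem cohomSol_add_nat (i : Fin (2 * n)) {h : PhaseSpace n → ℝ}
    (hs : ∀ x, h x ≠ 0 → ‖x‖ ≤ 1) {x : PhaseSpace n} (hx : |x i| ≤ 3) {k : ℕ} (hxk : |x i + k / 8| ≤ 3) :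
    cohomSol i h (x + (k : ℝ) • eighth i) = cohomSol i h x := by
  have h0 := cohomSol_shift i hs hx (s := 0) (by simpa using hx)
  rw [zero_smul, add_zero] at h0
  rw [cohomSol_shift i hs hx hxk, h0]
  refine intervalIntegral.integral_congr fun t _ => ?_
  have e1 := cohomKernel_add_int (t - k) k
  rw [Int.cast_natCast, sub_add_cancel] at e1
  simp only [sub_zero, e1]

theorem cohomSol_sub (i : Fin (2 * n)) {h : PhaseSpace n → ℝ} (hh : ContDiff ℝ ∞ h)
    (hs : ∀ x, h x ≠ 0 → ‖x‖ ≤ 1)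
    (hint : ∀ x, ∫ t : ℝ, h (x + t • Pi.single i 1) = 0) {x : PhaseSpace n}
    (hx : |x i| ≤ 3) (hx' : |x i + √2 / 8| ≤ 3) :
    cohomSol i h x - cohomSol i h (x + √2 • eighth i)
      = ∑ k ∈ Finset.range 80, h (x + ((k : ℝ) - 40) • eighth i) := by
  have h0 := cohomSol_shift i hs hx (s := 0) (by simpa using hx)
  rw [zero_smul, add_zero] at h0
  set g := dirDeriv (eighth i) (dirDeriv (eighth i) (dirDeriv (eighth i) h)) with hg
  have hgc : ContDiff ℝ ∞ g := ((hh.dirDeriv _).dirDeriv _).dirDeriv _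
  have hgl : Continuous fun t : ℝ => g (x + t • eighth i) :=
    hgc.continuous.comp (continuous_const.add (continuous_id.smul continuous_const))
  have hc1 : Continuous fun t : ℝ => cohomKernel (t - 0) * g (x + t • eighth i) :=
    (continuous_cohomKernel.comp (continuous_id.sub continuous_const)).mul hgl
  have hc2 : Continuous fun t : ℝ => cohomKernel (t - √2) * g (x + t • eighth i) :=
    (continuous_cohomKernel.comp (continuous_id.sub continuous_const)).mul hgl
  have hout : ∀ u : PhaseSpace n → ℝ, (∀ y, u y ≠ 0 → ‖y‖ ≤ 1) → ∀ t : ℝ, 40 ≤ |t| →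
      u (x + t • eighth i) = 0 := by
    intro u hu t ht
    by_contra hne
    have h1 := (norm_le_pi_norm _ i).trans (hu _ hne)
    rw [add_smul_eighth_self, Real.norm_eq_abs, abs_le] at h1
    rw [abs_le] at hx
    rcases le_abs.1 ht with h2 | h2 <;> linarith [h1.1, h1.2, hx.1, hx.2]
  have a1 : (40 : ℝ) ≤ |((40 : ℕ) : ℝ)| := by norm_num
  have a2 : (40 : ℝ) ≤ |(-((40 : ℕ) : ℝ))| := by norm_num
  have hline : ∫ t in (-((40 : ℕ) : ℝ))..(40 : ℕ), h (x + t • eighth i) = 0 := by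
    rw [intervalIntegral.integral_eq_integral_of_support_subset]
    · have h2 := Measure.integral_comp_mul_right (fun t : ℝ => h (x + t • Pi.single i 1)) (1 / 8)
      rw [hint, smul_zero] at h2
      rw [← h2]
      congr 1
      funext t
      rw [eighth, smul_smul]
    · intro t ht
      have h1 := (norm_le_pi_norm _ i).trans (hs _ ht)
      rw [add_smul_eighth_self, Real.norm_eq_abs, abs_le] at h1
      rw [abs_le] at hx
      push_cast
      constructor <;> linarith [h1.1, h1.2, hx.1, hx.2]
  have key := integral_cohomKernel_sub (hasDerivAt_line hh x (eighth i))
    (hasDerivAt_line (hh.dirDeriv _) x (eighth i))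
    (hasDerivAt_line ((hh.dirDeriv _).dirDeriv _) x (eighth i)) hgl 40
    (hout _ hs _ a1) (hout _ hs _ a2) (hout _ (abs_dirDeriv_eq_zero hs _) _ a1)
    (hout _ (abs_dirDeriv_eq_zero hs _) _ a2) hline
  rw [h0, cohomSol_shift i hs hx hx', ← intervalIntegral.integral_sub (hc1.intervalIntegrable _ _)
    (hc2.intervalIntegrable _ _)]
  simp only [sub_zero, ← sub_mul]
  rw [key]
  norm_num

/-- Differentiation under the integral would need four derivatives of h for the gradient. One
derivative along the line is moved onto the kernel instead, so three suffice. -/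
theorem exists_bound_cohomSol (i : Fin (2 * n)) : ∃ C, 0 ≤ C ∧ ∀ h : PhaseSpace n → ℝ,
    ContDiff ℝ ∞ h → (∀ x, h x ≠ 0 → ‖x‖ ≤ 1) → ∀ M, DerivBound 3 h M → ∀ x, |x i| ≤ 3 →
      |cohomSol i h x| ≤ C * M ∧ ‖fderiv ℝ (cohomSol i h) x‖ ≤ C * M := by
  obtain ⟨C₁, hC₁⟩ := exists_bound_cohomKernel
  obtain ⟨C₂, hC₂0, hC₂⟩ := exists_bound_integral_cohomKernel_mul_deriv 40
  have hC₁0 : 0 ≤ C₁ := (abs_nonneg _).trans (hC₁ 0)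
  refine ⟨2 * (40 : ℕ) * C₁ + C₂, by positivity, fun h hh hs M hM x hx => ?_⟩
  have hM0 := hM.nonneg
  have he := norm_eighth_le i
  have hd2 : ContDiff ℝ ∞ (dirDeriv (eighth i) (dirDeriv (eighth i) h)) :=
    (hh.dirDeriv _).dirDeriv _
  have hb2 : DerivBound 1 (dirDeriv (eighth i) (dirDeriv (eighth i) h)) M := by
    have h1 := (hM.dirDeriv hh (eighth i)).dirDeriv (hh.dirDeriv _) (eighth i)
    intro j hj y
    refine (h1 j hj y).trans ?_
    calc _ ≤ 1 * (1 * M) := by gcongr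
      _ = M := by ring
  have hvb : ∀ v y, |dirDeriv v (dirDeriv (eighth i) (dirDeriv (eighth i) h)) y| ≤ M * ‖v‖ := by
    intro v y
    exact ((hb2.dirDeriv hd2 v).abs_le y).trans_eq (mul_comm _ _)
  constructor
  · have h3 := norm_lineAvg_le (c := (40 : ℕ)) (by positivity) hC₁ (eighth i)
      (g := dirDeriv (eighth i) (dirDeriv (eighth i) (dirDeriv (eighth i) h))) (M := M)
      (fun y => (hvb (eighth i) y).trans (mul_le_of_le_one_right hM0 he)) x
    refine h3.trans ?_
    nlinarith
  · refine ContinuousLinearMap.opNorm_le_bound _ (by positivity) fun v => ?_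
    have hg1 : ContDiff ℝ ∞ (dirDeriv (eighth i) (dirDeriv (eighth i) (dirDeriv (eighth i) h))) :=
      hd2.dirDeriv _
    have hD := hasFDerivAt_lineAvg continuous_cohomKernel (40 : ℕ) (eighth i)
      (hg1.of_le (by simp)) ((((hasCompactSupport_of_forall_norm_le hs).dirDeriv _).dirDeriv
        _).dirDeriv _) x
    have hfd : Continuous (fderiv ℝ
        (dirDeriv (eighth i) (dirDeriv (eighth i) (dirDeriv (eighth i) h)))) :=
      hg1.continuous_fderiv (by simp)
    rw [cohomSol, hD.fderiv, lineAvg, ContinuousLinearMap.intervalIntegral_apply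
      ((continuous_lineAvg_integrand continuous_cohomKernel _ hfd x).intervalIntegrable _ _)]
    have hv := hd2.dirDeriv v
    have hout : ∀ t : ℝ, 40 ≤ |t| →
        dirDeriv v (dirDeriv (eighth i) (dirDeriv (eighth i) h)) (x + t • eighth i) = 0 := by
      intro t ht
      by_contra hne
      have h1 := (norm_le_pi_norm _ i).trans
        (abs_dirDeriv_eq_zero (abs_dirDeriv_eq_zero (abs_dirDeriv_eq_zero hs _) _) _ _ hne)
      rw [add_smul_eighth_self, Real.norm_eq_abs, abs_le] at h1
      rw [abs_le] at hx
      rcases le_abs.1 ht with h2 | h2 <;> linarith [h1.1, h1.2, hx.1, hx.2]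
    -- The primitive along the line is the v-derivative of the second derivative of h, which
    -- involves only three derivatives.
    have key := hC₂ _ _ (M * ‖v‖) (hasDerivAt_line hv x (eighth i))
      ((hv.dirDeriv _).continuous.comp (continuous_const.add (continuous_id.smul continuous_const)))
      (hout _ (by norm_num)) (hout _ (by norm_num)) (fun t => hvb v _)
    rw [← dirDeriv_comm hd2] at key
    have heq : ∀ t : ℝ, (cohomKernel t • fderiv ℝ
        (dirDeriv (eighth i) (dirDeriv (eighth i) (dirDeriv (eighth i) h))) (x + t • eighth i)) v
        = cohomKernel t * dirDeriv v
          (dirDeriv (eighth i) (dirDeriv (eighth i) (dirDeriv (eighth i) h)))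
          (x + t • eighth i) := fun t => rfl
    simp only [heq]
    refine (Real.norm_eq_abs _ ▸ key).trans ?_
    have : 0 ≤ 2 * ((40 : ℕ) : ℝ) * C₁ * (M * ‖v‖) := by positivity
    nlinarith

end Cohomology

/-! ### Functions of zero line mean as sums of two coboundaries. -/

section CoboundaryDecomposition

variable {n : ℕ}

theorem norm_le_one_of_coord {x : PhaseSpace n} (i : Fin (2 * n)) (h1 : |x i| ≤ 1)
    (h2 : ∀ j ≠ i, |x j| ≤ 1) : ‖x‖ ≤ 1 := by
  rw [pi_norm_le_iff_of_nonneg zero_le_one]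
  intro j
  by_cases hj : j = i
  · rw [hj]; exact h1
  · exact h2 j hj

/-- The bump whose translates by multiples of `1 / 8` sum to one. -/
noncomputable def unitBump (s : ℝ) : ℝ := smoothStep s - smoothStep (s - 1 / 8)

theorem contDiff_unitBump : ContDiff ℝ ∞ unitBump :=
  contDiff_smoothStep.sub (contDiff_smoothStep.comp (contDiff_id.sub contDiff_const))

theorem unitBump_support {s : ℝ} (hs : unitBump s ≠ 0) : 0 ≤ s ∧ s ≤ 1 / 4 := by
  constructor
  · by_contra h
    exact hs (by rw [unitBump, smoothStep_of_le (by linarith), smoothStep_of_le (by linarith),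
      sub_self])
  · by_contra h
    exact hs (by rw [unitBump, smoothStep_of_ge (by linarith), smoothStep_of_ge (by linarith),
      sub_self])

/-- The sum telescopes in the smooth step; 32 translates reach from any s in the given range past
the top of the step. -/
theorem sum_unitBump {s : ℝ} (h1 : -3 ≤ s) (h2 : s ≤ 1 / 8) :
    ∑ k ∈ Finset.range 32, unitBump (s + k / 8) = 1 := by
  have h : ∀ k : ℕ, unitBump (s + k / 8)
      = smoothStep (s + ((k + 1 : ℕ) : ℝ) / 8 - 1 / 8) - smoothStep (s + (k : ℝ) / 8 - 1 / 8) := by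
    intro k
    rw [unitBump]
    congr 2
    push_cast
    ring
  rw [Finset.sum_congr rfl fun k _ => h k,
    Finset.sum_range_sub (fun k : ℕ => smoothStep (s + (k : ℝ) / 8 - 1 / 8)),
    smoothStep_of_ge (by push_cast; linarith), smoothStep_of_le (by push_cast; linarith), sub_zero]

theorem sqrt_two_bounds : 1 ≤ √2 ∧ √2 ≤ 3 / 2 := by
  constructor
  · rw [Real.one_le_sqrt]; norm_num
  · rw [Real.sqrt_le_left (by norm_num)]; norm_num

/-- A function with zero mean along the lines in the `i`-th direction is the sum of two
coboundaries for translations in that direction. -/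
theorem exists_coboundary_decomposition (i : Fin (2 * n)) : ∃ C, 0 < C ∧
    ∀ h : PhaseSpace n → ℝ, ContDiff ℝ ∞ h → (∀ x, h x ≠ 0 → ‖x‖ ≤ 1) →
    (∀ x, ∫ t : ℝ, h (x + t • Pi.single i 1) = 0) → ∀ M, DerivBound 3 h M →
    ∃ F : Fin 2 → PhaseSpace n → ℝ, (∀ l, ContDiff ℝ ∞ (F l)) ∧
      (∀ l x, F l x ≠ 0 → ‖x‖ ≤ 1) ∧ (∀ l x, ‖fderiv ℝ (F l) x‖ ≤ C * M) ∧
      ∀ x, h x = (F 0 x - F 0 (x + (1 / 8 : ℝ) • Pi.single i 1))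
        + (F 1 x - F 1 (x + (√2 / 8) • Pi.single i 1)) := by
  obtain ⟨C, hC0, hC⟩ := exists_bound_cohomSol i
  set cut : ℝ → ℝ := fun s => smoothStep (s + 9 / 8) with hcut
  have hcuts : ContDiff ℝ ∞ cut := contDiff_smoothStep.comp (contDiff_id.add contDiff_const)
  obtain ⟨A, hA0, hA⟩ := exists_bound_on_Icc contDiff_unitBump 1
  obtain ⟨A', hA'0, hA'⟩ := exists_bound_on_Icc hcuts 1
  set B := 2 * A * C with hB
  -- The product rule with the cut-off gives 2A', the 32 translates give 32, and the remainder is h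
  -- plus two copies of F₂.
  set B' := 2 * A' * (32 * (1 + 2 * (A * C + B))) with hB'
  have hB0 : 0 ≤ B := by positivity
  have hB'0 : 0 ≤ B' := by positivity
  refine ⟨B + B' + A * C + 1, by positivity, fun h hh hs hint M hM => ?_⟩
  have hM0 := hM.nonneg
  obtain ⟨hr1, hr2⟩ := sqrt_two_bounds
  set e : PhaseSpace n := eighth i with he
  set G := cohomSol i h with hG
  have hGs : ContDiff ℝ ∞ G := contDiff_cohomSol i hh hs
  have hxi : ∀ x : PhaseSpace n, ‖x‖ ≤ 1 → |x i| ≤ 1 := fun x hx => (norm_le_pi_norm x i).trans hx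
  -- the coboundary that solves the equation modulo `1 / 8`
  set F₂ : PhaseSpace n → ℝ := fun x => unitBump (x i) * G x with hF₂
  have hF₂s : ContDiff ℝ ∞ F₂ := (contDiff_unitBump.comp (contDiff_apply ℝ ℝ i)).mul hGs
  have hF₂supp' : ∀ x, F₂ x ≠ 0 → (0 ≤ x i ∧ x i ≤ 1 / 4) ∧ ∀ j ≠ i, |x j| ≤ 1 := fun x hx =>
    ⟨unitBump_support (left_ne_zero_of_mul hx), cohomSol_support i hs (right_ne_zero_of_mul hx)⟩
  have hF₂supp : ∀ x, F₂ x ≠ 0 → ‖x‖ ≤ 1 := fun x hx => by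
    obtain ⟨⟨h1, h2⟩, h3⟩ := hF₂supp' x hx
    exact norm_le_one_of_coord i (abs_le.2 ⟨by linarith, by linarith⟩) h3
  have hF₂b : ∀ x, |F₂ x| ≤ A * C * M ∧ ‖fderiv ℝ F₂ x‖ ≤ B * M := by
    intro x
    by_cases hx : ‖x‖ ≤ 1
    · obtain ⟨g1, g2⟩ := hC h hh hs M hM x ((hxi x hx).trans (by norm_num))
      obtain ⟨a1, a2⟩ := hA (x i) (hxi x hx)
      constructor
      · rw [hF₂, abs_mul, mul_assoc]
        gcongr
      · refine (norm_fderiv_coord_mul_le i contDiff_unitBump (hGs.differentiable (by simp) x)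
          a1 a2 g1 g2).trans (le_of_eq ?_)
        rw [hB]
        ring
    · have h1 : F₂ x = 0 := by
        by_contra h'
        exact hx (hF₂supp x h')
      rw [h1, norm_fderiv_eq_zero_of_lt hF₂supp (not_le.1 hx), abs_zero, norm_zero]
      exact ⟨by positivity, by positivity⟩
  -- the remainder
  set r : PhaseSpace n → ℝ := fun x => h x - F₂ x + F₂ (x + √2 • e) with hr
  have hsh : ContDiff ℝ ∞ fun x : PhaseSpace n => F₂ (x + √2 • e) :=
    hF₂s.comp (contDiff_id.add contDiff_const)
  have hrs : ContDiff ℝ ∞ r := (hh.sub hF₂s).add hsh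
  have hrsupp : ∀ x, r x ≠ 0 → ‖x‖ ≤ 1 := by
    intro x hx
    by_contra hn
    have h1 : h x = 0 := by_contra fun h' => hn (hs x h')
    have h2 : F₂ x = 0 := by_contra fun h' => hn (hF₂supp x h')
    have h3 : F₂ (x + √2 • e) = 0 := by
      by_contra h'
      obtain ⟨⟨b1, b2⟩, b3⟩ := hF₂supp' _ h'
      rw [he, add_smul_eighth_self] at b1 b2
      refine hn (norm_le_one_of_coord i (abs_le.2 ⟨by linarith, by linarith⟩) fun j hj => ?_)
      have := b3 j hj
      rwa [he, add_smul_eighth_ne x hj] at this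
    exact hx (by simp [hr, h1, h2, h3])
  have hrb : ∀ x, |r x| ≤ (1 + 2 * (A * C)) * M ∧ ‖fderiv ℝ r x‖ ≤ (1 + 2 * B) * M := by
    intro x
    obtain ⟨b1, b2⟩ := hF₂b x
    obtain ⟨b3, b4⟩ := hF₂b (x + √2 • e)
    constructor
    · rw [hr]
      refine (abs_add_le _ _).trans ?_
      have := abs_sub (h x) (F₂ x)
      linarith [hM.abs_le x]
    · have hd : HasFDerivAt r (fderiv ℝ h x - fderiv ℝ F₂ x + fderiv ℝ F₂ (x + √2 • e)) x := by
        refine (((hh.differentiable (by simp)) x).hasFDerivAt.sub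
          ((hF₂s.differentiable (by simp)) x).hasFDerivAt).add ?_
        exact (hasFDerivAt_comp_add_right (√2 • e)).2
          ((hF₂s.differentiable (by simp)) _).hasFDerivAt
      rw [hd.fderiv]
      refine (norm_add_le _ _).trans ?_
      have h5 := norm_sub_le (fderiv ℝ h x) (fderiv ℝ F₂ x)
      have h6 : ‖fderiv ℝ h x‖ ≤ M := DerivBound.norm_fderiv_le (k := 2) hM x
      linarith
  have hrz : ∀ x : PhaseSpace n, 1 < |x i| → r x = 0 := fun x hx => by
    by_contra h'
    linarith [hxi x (hrsupp x h')]
  -- the sum of its translates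
  set S : PhaseSpace n → ℝ := fun x => ∑ k ∈ Finset.range 32, r (x + (k : ℝ) • e) with hS
  have hSs : ContDiff ℝ ∞ S := ContDiff.sum fun k _ => hrs.comp (contDiff_id.add contDiff_const)
  have hcoord : ∀ (x : PhaseSpace n) (t : ℝ), (x + t • e) i = x i + t / 8 :=
    fun x t => add_smul_eighth_self x i t
  have hFsum : ∀ x : PhaseSpace n, -29 / 10 ≤ x i → x i ≤ 1 / 8 →
      ∑ k ∈ Finset.range 32, F₂ (x + (k : ℝ) • e) = G x := by
    intro x h1 h2
    rw [← mul_one (G x), ← sum_unitBump (s := x i) (by linarith) h2, Finset.mul_sum]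
    refine Finset.sum_congr rfl fun k _ => ?_
    simp only [hF₂, hcoord]
    by_cases hz : unitBump (x i + k / 8) = 0
    · rw [hz, zero_mul, mul_zero]
    · obtain ⟨b1, b2⟩ := unitBump_support hz
      rw [hG, he, cohomSol_add_nat i hs (abs_le.2 ⟨by linarith, by linarith⟩)
        (abs_le.2 ⟨by linarith, by linarith⟩), mul_comm]
  -- In this range the 32 translates sweep the whole support, so the sum is a full periodisation:
  -- that of h is G - G(· + √2 e), and those of F₂ and of its shift are G and G(· + √2 e).
  have hS0 : ∀ x : PhaseSpace n, -29 / 10 ≤ x i → x i ≤ -1 → S x = 0 := by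
    intro x h1 h2
    have e1 : S x = (∑ k ∈ Finset.range 32, h (x + (k : ℝ) • e))
        - (∑ k ∈ Finset.range 32, F₂ (x + (k : ℝ) • e))
        + ∑ k ∈ Finset.range 32, F₂ ((x + √2 • e) + (k : ℝ) • e) := by
      rw [← Finset.sum_sub_distrib, ← Finset.sum_add_distrib]
      refine Finset.sum_congr rfl fun k _ => ?_
      simp only [hr, add_right_comm]
    have e2 : ∑ k ∈ Finset.range 32, h (x + (k : ℝ) • e) = G x - G (x + √2 • e) := by
      rw [hG, he, cohomSol_sub i hh hs hint (abs_le.2 ⟨by linarith, by linarith⟩)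
        (abs_le.2 ⟨by linarith, by linarith⟩)]
      have hz : ∀ t : ℝ, (t ≤ -1 ∨ 32 ≤ t) → h (x + t • eighth i) = 0 := by
        intro t ht
        by_contra h'
        have b := hxi _ (hs _ h')
        rw [add_smul_eighth_self, abs_le] at b
        rcases ht with ht | ht <;> linarith [b.1, b.2]
      -- Of the shifts -40, …, 39, the negative ones and those from 32 on carry x outside the
      -- support of h.
      rw [show (80 : ℕ) = 40 + 32 + 8 by norm_num, Finset.sum_range_add, Finset.sum_range_add,
        Finset.sum_eq_zero (s := Finset.range 40), Finset.sum_eq_zero (s := Finset.range 8),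
        zero_add, add_zero]
      · refine Finset.sum_congr rfl fun k _ => ?_
        congr 3
        push_cast
        ring
      · intro k _
        refine hz _ (Or.inr ?_)
        push_cast
        linarith [Nat.cast_nonneg (α := ℝ) k]
      · intro k hk
        refine hz _ (Or.inl ?_)
        have : (k : ℝ) + 1 ≤ 40 := by exact_mod_cast Finset.mem_range.1 hk
        linarith
    rw [e1, e2, hFsum x h1 (by linarith), hFsum _ (by rw [hcoord]; linarith)
      (by rw [hcoord]; linarith)]
    ring
  have hSshift : ∀ x, S x - S (x + e) = r x - r (x + (32 : ℝ) • e) := by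
    intro x
    have e1 : S (x + e) = ∑ k ∈ Finset.range 32, r (x + ((k + 1 : ℕ) : ℝ) • e) := by
      refine Finset.sum_congr rfl fun k _ => ?_
      congr 1
      push_cast
      module
    have e2 := Finset.sum_range_sub' (fun k : ℕ => r (x + (k : ℝ) • e)) 32
    rw [e1, hS, ← Finset.sum_sub_distrib, e2]
    simp
  -- `S` is the one-sided sum that solves the difference equation, truncated to 32 terms. Where the
  -- coordinate is below -29/10 the truncation is not a full sum, so the cut-off removes that part;
  -- its transition from -9/8 to -1 lies where `S` vanishes.
  set F₁ : PhaseSpace n → ℝ := fun x => cut (x i) * S x with hF₁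
  have hF₁low : ∀ x : PhaseSpace n, x i ≤ -1 → F₁ x = 0 := by
    intro x hx
    by_cases h1 : -29 / 10 ≤ x i
    · simp only [hF₁, hS0 x h1 hx, mul_zero]
    · have : cut (x i) = 0 := smoothStep_of_le (by linarith)
      simp only [hF₁, this, zero_mul]
  have hF₁high : ∀ x : PhaseSpace n, -1 ≤ x i → F₁ x = S x := by
    intro x hx
    have : cut (x i) = 1 := smoothStep_of_ge (by linarith)
    simp only [hF₁, this, one_mul]
  have hF₁s : ContDiff ℝ ∞ F₁ := (hcuts.comp (contDiff_apply ℝ ℝ i)).mul hSs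
  have hF₁supp : ∀ x, F₁ x ≠ 0 → ‖x‖ ≤ 1 := by
    intro x hx
    obtain ⟨k, -, hk⟩ := Finset.exists_ne_zero_of_sum_ne_zero (right_ne_zero_of_mul hx)
    have h1 := hrsupp _ hk
    have h2 := abs_le.1 (hxi _ h1)
    rw [hcoord] at h2
    have hk0 : (0 : ℝ) ≤ k := Nat.cast_nonneg k
    refine norm_le_one_of_coord i (abs_le.2 ⟨?_, by linarith [h2.2]⟩) fun j hj => ?_
    · by_contra hlt
      exact hx (hF₁low x (by linarith))
    · have := (norm_le_pi_norm _ j).trans h1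
      rwa [he, add_smul_eighth_ne x hj] at this
  have hSb : ∀ x, |S x| ≤ 32 * (1 + 2 * (A * C + B)) * M ∧
      ‖fderiv ℝ S x‖ ≤ 32 * (1 + 2 * (A * C + B)) * M := by
    intro x
    have hAC : 0 ≤ A * C := by positivity
    constructor
    · refine (Finset.abs_sum_le_sum_abs _ _).trans
        ((Finset.sum_le_card_nsmul _ _ _ fun k _ => (hrb _).1).trans ?_)
      rw [Finset.card_range, nsmul_eq_mul]
      push_cast
      nlinarith [mul_nonneg hB0 hM0]
    · have hd : HasFDerivAt S (∑ k ∈ Finset.range 32, fderiv ℝ r (x + (k : ℝ) • e)) x := by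
        refine HasFDerivAt.fun_sum fun k _ => ?_
        exact (hasFDerivAt_comp_add_right ((k : ℝ) • e)).2
          ((hrs.differentiable (by simp)) _).hasFDerivAt
      rw [hd.fderiv]
      refine (norm_sum_le _ _).trans
        ((Finset.sum_le_card_nsmul _ _ _ fun k _ => (hrb _).2).trans ?_)
      rw [Finset.card_range, nsmul_eq_mul]
      push_cast
      nlinarith [mul_nonneg hAC hM0]
  have hF₁b : ∀ x, ‖fderiv ℝ F₁ x‖ ≤ B' * M := by
    intro x
    by_cases hx : ‖x‖ ≤ 1
    · obtain ⟨g1, g2⟩ := hSb x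
      obtain ⟨a1, a2⟩ := hA' (x i) (hxi x hx)
      refine (norm_fderiv_coord_mul_le i hcuts (hSs.differentiable (by simp) x)
        a1 a2 g1 g2).trans (le_of_eq ?_)
      rw [hB']
      ring
    · rw [norm_fderiv_eq_zero_of_lt hF₁supp (not_le.1 hx), norm_zero]
      positivity
  have hcoord1 : ∀ x : PhaseSpace n, (x + e) i = x i + 1 / 8 := fun x => by
    have := hcoord x 1
    rwa [one_smul] at this
  have hF₁eq : ∀ x, F₁ x - F₁ (x + e) = r x := by
    intro x
    have key := hSshift x
    have hfar : -29 / 10 ≤ x i → r (x + (32 : ℝ) • e) = 0 := fun h' => by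
      refine hrz _ ?_
      rw [hcoord]
      exact lt_of_lt_of_le (by linarith) (le_abs_self _)
    by_cases hx : -1 ≤ x i
    · rw [hF₁high x hx, hF₁high _ (by rw [hcoord1]; linarith), key, hfar (by linarith), sub_zero]
    · have hrx : r x = 0 := hrz x (by rw [lt_abs]; right; linarith)
      rw [hF₁low x (by linarith), hrx]
      by_cases h1 : (x + e) i ≤ -1
      · rw [hF₁low _ h1, sub_zero]
      -- Here x lies below -1 and x + e above. The telescoping identity at x forces S(x + e) = 0, so
      -- both sides vanish.
      · rw [hcoord1] at h1
        rw [hF₁high _ (by rw [hcoord1]; linarith)]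
        rw [hS0 x (by linarith) (by linarith), hrx, hfar (by linarith)] at key
        linarith
  have hfin : ∀ x, ‖fderiv ℝ F₁ x‖ ≤ (B + B' + A * C + 1) * M ∧
      ‖fderiv ℝ F₂ x‖ ≤ (B + B' + A * C + 1) * M := fun x => by
    have h1 : 0 ≤ A * C * M := by positivity
    have h2 : 0 ≤ B * M := by positivity
    have h3 : 0 ≤ B' * M := by positivity
    have h4 := hF₁b x
    have h5 := (hF₂b x).2
    constructor <;> linarith
  have he1 : ((1 / 8 : ℝ) • Pi.single i 1 : PhaseSpace n) = e := rfl
  have he2 : ((√2 / 8 : ℝ) • Pi.single i 1 : PhaseSpace n) = √2 • e := by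
    rw [he, eighth, smul_smul]
    ring_nf
  refine ⟨![F₁, F₂], ?_, ?_, ?_, fun x => ?_⟩
  · exact Fin.forall_fin_two.2 ⟨hF₁s, hF₂s⟩
  · exact Fin.forall_fin_two.2 ⟨hF₁supp, hF₂supp⟩
  · exact Fin.forall_fin_two.2 ⟨fun x => (hfin x).1, fun x => (hfin x).2⟩
  · change h x = F₁ x - F₁ _ + (F₂ x - F₂ _)
    rw [he1, he2, hF₁eq x]
    simp only [hr]
    ring

end CoboundaryDecomposition

/-! ### Splitting a function of zero integral by coordinate directions. -/

section CoordinateDecomposition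

open MeasureTheory

variable {n : ℕ}

theorem add_smul_single_self (x : PhaseSpace n) (i : Fin (2 * n)) (t : ℝ) :
    (x + t • Pi.single i 1 : PhaseSpace n) i = x i + t := by
  simp

theorem add_smul_single_ne (x : PhaseSpace n) {i j : Fin (2 * n)} (h : j ≠ i) (t : ℝ) :
    (x + t • Pi.single i 1 : PhaseSpace n) j = x j := by
  simp [h]

/-- A smooth bump function on the line, supported in `[-1, 1]`, with integral one. -/
noncomputable def massBump : ℝ → ℝ :=
  (⟨1 / 2, 1, by norm_num, by norm_num⟩ : ContDiffBump (0 : ℝ)).normed volume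

theorem contDiff_massBump : ContDiff ℝ ∞ massBump := ContDiffBump.contDiff_normed _

theorem abs_le_of_massBump_ne_zero {s : ℝ} (hs : massBump s ≠ 0) : |s| ≤ 1 := by
  have h : s ∈ Function.support massBump := hs
  rw [massBump, ContDiffBump.support_normed_eq, mem_ball_zero_iff] at h
  exact h.le

theorem integral_massBump : ∫ s, massBump s = 1 := ContDiffBump.integral_normed _

theorem hasCompactSupport_massBump : HasCompactSupport massBump :=
  HasCompactSupport.intro (isCompact_Icc (a := (-1 : ℝ)) (b := 1)) fun s hs => by
    by_contra h
    exact hs (abs_le.1 (abs_le_of_massBump_ne_zero h))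

theorem DerivBound.mono {k : ℕ} {g : PhaseSpace n → ℝ} {M M' : ℝ} (h : DerivBound k g M)
    (hM : M ≤ M') : DerivBound k g M' := fun j hj x => (h j hj x).trans hM

theorem DerivBound.mul {k : ℕ} {g h : PhaseSpace n → ℝ} {A M : ℝ} (hg : ContDiff ℝ ∞ g)
    (hh : ContDiff ℝ ∞ h) (hA : DerivBound k g A) (hM : DerivBound k h M) :
    DerivBound k (fun x => g x * h x) (2 ^ k * A * M) := by
  intro j hj x
  have hA0 := hA.nonneg
  have hM0 := hM.nonneg
  refine (norm_iteratedFDeriv_mul_le hg hh x (by exact_mod_cast le_top)).trans ?_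
  calc ∑ i ∈ Finset.range (j + 1), ↑(j.choose i) * ‖iteratedFDeriv ℝ i g x‖ *
          ‖iteratedFDeriv ℝ (j - i) h x‖
      ≤ ∑ i ∈ Finset.range (j + 1), ↑(j.choose i) * A * M := by
        refine Finset.sum_le_sum fun i hi => ?_
        have hi' := Finset.mem_range.1 hi
        gcongr
        · exact hA i (by omega) x
        · exact hM (j - i) (by omega) x
    _ = 2 ^ j * A * M := by
        rw [← Finset.sum_mul, ← Finset.sum_mul, ← Nat.cast_sum, Nat.sum_range_choose]
        push_cast
        ring
    _ ≤ 2 ^ k * A * M := by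
        gcongr
        norm_num

theorem DerivBound.sub {k : ℕ} {g h : PhaseSpace n → ℝ} {A M : ℝ} (hg : ContDiff ℝ ∞ g)
    (hh : ContDiff ℝ ∞ h) (hA : DerivBound k g A) (hM : DerivBound k h M) :
    DerivBound k (fun x => g x - h x) (A + M) := by
  intro j hj x
  have h1 := iteratedFDeriv_sub_apply (i := j) (x := x) (f := g) (g := h)
    (hg.contDiffAt.of_le (by exact_mod_cast le_top)) (hh.contDiffAt.of_le (by exact_mod_cast le_top))
  rw [show (fun x => g x - h x) = g - h from rfl, h1]
  exact (norm_sub_le _ _).trans (add_le_add (hA j hj x) (hM j hj x))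

/-- Composition with a linear map of norm at most one preserves derivative bounds. -/
theorem iteratedFDeriv_comp_le {E : Type*} [NormedAddCommGroup E] [NormedSpace ℝ E] {g : E → ℝ}
    {M : ℝ} {j : ℕ} (L : PhaseSpace n →L[ℝ] E) (hL : ‖L‖ ≤ 1) (hg : ContDiff ℝ ∞ g)
    (h : ∀ y, ‖iteratedFDeriv ℝ j g y‖ ≤ M) (x : PhaseSpace n) :
    ‖iteratedFDeriv ℝ j (g ∘ L) x‖ ≤ M := by
  rw [L.iteratedFDeriv_comp_right hg x (by exact_mod_cast le_top)]
  refine (ContinuousMultilinearMap.norm_compContinuousLinearMap_le _ _).trans ?_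
  rw [Finset.prod_const, Finset.card_univ, Fintype.card_fin]
  have h1 : ‖L‖ ^ j ≤ 1 := pow_le_one₀ (norm_nonneg _) hL
  nlinarith [h (L x), norm_nonneg (iteratedFDeriv ℝ j g (L x)), pow_nonneg (norm_nonneg L) j]

theorem exists_derivBound_massBump (i : Fin (2 * n)) (k : ℕ) :
    ∃ A, DerivBound k (fun x : PhaseSpace n => massBump (x i)) A := by
  have h : ∀ j : ℕ, ∃ A, ∀ s, ‖iteratedFDeriv ℝ j massBump s‖ ≤ A := fun j =>
    (hasCompactSupport_massBump.iteratedFDeriv j).exists_bound_of_continuous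
      (contDiff_massBump.continuous_iteratedFDeriv (m := j) (by exact_mod_cast le_top))
  choose A hA using h
  have hA0 : ∀ j, 0 ≤ A j := fun j => (norm_nonneg _).trans (hA j 0)
  refine ⟨∑ j ∈ Finset.range (k + 1), A j, fun j hj x => ?_⟩
  have hL : ‖ContinuousLinearMap.proj (R := ℝ) (φ := fun _ : Fin (2 * n) => ℝ) i‖ ≤ 1 :=
    ContinuousLinearMap.opNorm_le_bound _ zero_le_one fun y => by
      rw [one_mul]; exact norm_le_pi_norm y i
  exact (iteratedFDeriv_comp_le _ hL contDiff_massBump (hA j) x).trans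
    (Finset.single_le_sum (f := A) (fun j _ => hA0 j) (Finset.mem_range.2 (by omega)))

/-- Replace `g` by the multiple of the bump function with the same integrals in direction `i`. -/
noncomputable def concentrate (i : Fin (2 * n)) (g : PhaseSpace n → ℝ) (x : PhaseSpace n) : ℝ :=
  massBump (x i) * ∫ t : ℝ, g (x + t • Pi.single i 1)

/-- Where the bump is nonzero the line integral sees only |t| ≤ 2, so the interval [-3, 3] suffices.
This brings in the smoothness and derivative bounds for averages over segments. -/
theorem concentrate_eq (i : Fin (2 * n)) {g : PhaseSpace n → ℝ} (hs : ∀ x, g x ≠ 0 → ‖x‖ ≤ 1) :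
    concentrate i g = fun x =>
      massBump (x i) * lineAvg (fun _ => 1) 3 (Pi.single i 1 : PhaseSpace n) g x := by
  funext x
  rw [concentrate]
  by_cases h : massBump (x i) = 0
  · rw [h, zero_mul, zero_mul]
  · have h1 := abs_le.1 (abs_le_of_massBump_ne_zero h)
    congr 1
    rw [lineAvg, intervalIntegral.integral_of_le (by norm_num),
      setIntegral_eq_integral_of_forall_compl_eq_zero]
    · simp
    · intro t ht
      simp only [one_smul]
      by_contra h'
      have h2 := abs_le.1 ((norm_le_pi_norm _ i).trans (hs _ h'))
      rw [add_smul_single_self] at h2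
      exact ht ⟨by linarith, by linarith⟩

theorem contDiff_concentrate (i : Fin (2 * n)) {g : PhaseSpace n → ℝ} (hg : ContDiff ℝ ∞ g)
    (hs : ∀ x, g x ≠ 0 → ‖x‖ ≤ 1) : ContDiff ℝ ∞ (concentrate i g) := by
  rw [concentrate_eq i hs]
  exact (contDiff_massBump.comp (contDiff_apply ℝ ℝ i)).mul
    (contDiff_lineAvg continuous_const 3 _ hg (hasCompactSupport_of_forall_norm_le hs))

theorem concentrate_support (i : Fin (2 * n)) {g : PhaseSpace n → ℝ}
    (hs : ∀ x, g x ≠ 0 → ‖x‖ ≤ 1) {x : PhaseSpace n} (hx : concentrate i g x ≠ 0) : ‖x‖ ≤ 1 := by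
  refine norm_le_one_of_coord i (abs_le_of_massBump_ne_zero (left_ne_zero_of_mul hx)) fun j hj => ?_
  by_contra h
  refine right_ne_zero_of_mul hx ?_
  rw [show (fun t : ℝ => g (x + t • Pi.single i 1)) = 0 from ?_, integral_zero']
  funext t
  by_contra h'
  have := (norm_le_pi_norm _ j).trans (hs _ h')
  rw [add_smul_single_ne x hj] at this
  exact h this

theorem exists_derivBound_concentrate (i : Fin (2 * n)) (k : ℕ) : ∃ C, 0 ≤ C ∧
    ∀ g : PhaseSpace n → ℝ, ContDiff ℝ ∞ g → (∀ x, g x ≠ 0 → ‖x‖ ≤ 1) → ∀ M,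
    DerivBound k g M → DerivBound k (concentrate i g) (C * M) := by
  obtain ⟨A, hA⟩ := exists_derivBound_massBump i k
  have hA0 := hA.nonneg
  refine ⟨2 ^ k * A * (2 * 3 * 1), by positivity, fun g hg hs M hM => ?_⟩
  rw [concentrate_eq i hs, mul_assoc]
  have hc := hasCompactSupport_of_forall_norm_le hs
  exact DerivBound.mul (contDiff_massBump.comp (contDiff_apply ℝ ℝ i))
    (contDiff_lineAvg continuous_const 3 _ hg hc) hA fun j hj x =>
    norm_iteratedFDeriv_lineAvg_le continuous_const (by norm_num) (fun _ => by simp) _ j hg hc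
      (hM j hj) x

theorem integral_line_add (i : Fin (2 * n)) (g : PhaseSpace n → ℝ) (x : PhaseSpace n) (s : ℝ) :
    ∫ t : ℝ, g ((x + s • Pi.single i 1 : PhaseSpace n) + t • Pi.single i 1)
      = ∫ t : ℝ, g (x + t • Pi.single i 1) := by
  refine Eq.trans ?_ (integral_add_right_eq_self (μ := volume)
    (fun t : ℝ => g (x + t • Pi.single i 1)) s)
  refine integral_congr_ae (Filter.Eventually.of_forall fun t => ?_)
  simp only
  congr 1
  module

theorem integrable_line (i : Fin (2 * n)) {g : PhaseSpace n → ℝ} (hg : Continuous g)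
    (hs : ∀ x, g x ≠ 0 → ‖x‖ ≤ 1) (x : PhaseSpace n) :
    Integrable fun t : ℝ => g (x + t • Pi.single i 1) := by
  refine Continuous.integrable_of_hasCompactSupport (by fun_prop)
    (HasCompactSupport.intro (isCompact_Icc (a := -1 - x i) (b := 1 - x i)) fun t ht => ?_)
  by_contra h'
  have h2 := abs_le.1 ((norm_le_pi_norm _ i).trans (hs _ h'))
  rw [add_smul_single_self] at h2
  exact ht ⟨by linarith, by linarith⟩

theorem integral_line_sub_concentrate (i : Fin (2 * n)) {g : PhaseSpace n → ℝ}
    (hg : ContDiff ℝ ∞ g) (hs : ∀ x, g x ≠ 0 → ‖x‖ ≤ 1) (x : PhaseSpace n) :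
    ∫ t : ℝ, (g (x + t • Pi.single i 1) - concentrate i g (x + t • Pi.single i 1)) = 0 := by
  rw [integral_sub (integrable_line i hg.continuous hs x) (integrable_line i
    (contDiff_concentrate i hg hs).continuous (fun y hy => concentrate_support i hs hy) x)]
  simp only [concentrate, integral_line_add, add_smul_single_self]
  rw [integral_mul_const, integral_add_left_eq_self massBump, integral_massBump, one_mul, sub_self]

/-- Fubini, a translation of x by t in the i-th direction, and Fubini again leave the integral of
the bump as a factor. -/
theorem integral_concentrate (i : Fin (2 * n)) {g : PhaseSpace n → ℝ} (hg : Continuous g)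
    (hs : ∀ x, g x ≠ 0 → ‖x‖ ≤ 1) : ∫ x, concentrate i g x = ∫ x, g x := by
  have hρ : Continuous massBump := contDiff_massBump.continuous
  have hcpt : IsCompact (Metric.closedBall (0 : PhaseSpace n) 1 ×ˢ Set.Icc (-2 : ℝ) 2) :=
    (isCompact_closedBall _ _).prod isCompact_Icc
  calc ∫ x, concentrate i g x
      = ∫ x : PhaseSpace n, ∫ t : ℝ, massBump (x i) * g (x + t • Pi.single i 1) := by
        simp only [concentrate, integral_const_mul]
    _ = ∫ t : ℝ, ∫ x : PhaseSpace n, massBump (x i) * g (x + t • Pi.single i 1) := by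
        refine integral_integral_swap_of_hasCompactSupport
          (f := fun (x : PhaseSpace n) (t : ℝ) => massBump (x i) * g (x + t • Pi.single i 1))
          (by simp only [Function.uncurry_def]; fun_prop)
          (HasCompactSupport.intro hcpt fun p hp => ?_)
        by_contra h
        refine hp ⟨?_, ?_⟩
        all_goals
          have h1 := abs_le_of_massBump_ne_zero (left_ne_zero_of_mul h)
          have h2 := hs _ (right_ne_zero_of_mul h)
        · rw [mem_closedBall_zero_iff]
          refine norm_le_one_of_coord i h1 fun j hj => ?_
          have := (norm_le_pi_norm _ j).trans h2
          rwa [add_smul_single_ne _ hj] at this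
        · have h3 := abs_le.1 ((norm_le_pi_norm _ i).trans h2)
          rw [add_smul_single_self] at h3
          have h4 := abs_le.1 h1
          exact ⟨by linarith, by linarith⟩
    _ = ∫ t : ℝ, ∫ x : PhaseSpace n, massBump (x i - t) * g x := by
        refine integral_congr_ae (Filter.Eventually.of_forall fun t => ?_)
        simp only
        rw [← integral_add_right_eq_self (fun x : PhaseSpace n => massBump (x i - t) * g x)
          (t • Pi.single i 1)]
        refine integral_congr_ae (Filter.Eventually.of_forall fun x => ?_)
        simp only [add_smul_single_self, add_sub_cancel_right]
    _ = ∫ x : PhaseSpace n, ∫ t : ℝ, massBump (x i - t) * g x := by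
        symm
        refine integral_integral_swap_of_hasCompactSupport
          (f := fun (x : PhaseSpace n) (t : ℝ) => massBump (x i - t) * g x)
          (by simp only [Function.uncurry_def]; fun_prop)
          (HasCompactSupport.intro hcpt fun p hp => ?_)
        by_contra h
        have h1 := abs_le.1 (abs_le_of_massBump_ne_zero (left_ne_zero_of_mul h))
        have h2 := hs _ (right_ne_zero_of_mul h)
        have h3 := abs_le.1 ((norm_le_pi_norm _ i).trans h2)
        refine hp ⟨mem_closedBall_zero_iff.2 h2, ?_⟩
        exact ⟨by linarith, by linarith⟩
    _ = ∫ x, g x := by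
        refine integral_congr_ae (Filter.Eventually.of_forall fun x => ?_)
        simp only
        rw [integral_mul_const, integral_sub_left_eq_self massBump volume, integral_massBump,
          one_mul]

/-- `g` is the product of the bump functions in the coordinates in `S` and of a function of the
other coordinates. -/
def IsConcentrated (S : Finset (Fin (2 * n))) (g : PhaseSpace n → ℝ) : Prop :=
  ∃ G : PhaseSpace n → ℝ, (∀ i ∈ S, ∀ x, ∀ s : ℝ, G (x + s • Pi.single i 1) = G x) ∧
    ∀ x, g x = (∏ i ∈ S, massBump (x i)) * G x

theorem IsConcentrated.insert {S : Finset (Fin (2 * n))} {g : PhaseSpace n → ℝ}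
    (hg : IsConcentrated S g) {j : Fin (2 * n)} (hj : j ∉ S) :
    IsConcentrated (insert j S) (concentrate j g) := by
  obtain ⟨G, hG, hgG⟩ := hg
  refine ⟨fun x => ∫ t : ℝ, G (x + t • Pi.single j 1), fun i hi x s => ?_, fun x => ?_⟩
  · rcases Finset.mem_insert.1 hi with rfl | hi
    · exact integral_line_add i G x s
    · refine integral_congr_ae (Filter.Eventually.of_forall fun t => ?_)
      refine Eq.trans ?_ (hG i hi _ s)
      exact congrArg G (add_right_comm _ _ _)
  · rw [Finset.prod_insert hj, mul_assoc, ← integral_const_mul, concentrate]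
    congr 1
    refine integral_congr_ae (Filter.Eventually.of_forall fun t => ?_)
    simp only [hgG]
    congr 1
    refine Finset.prod_congr rfl fun i hi => ?_
    rw [add_smul_single_ne]
    rintro rfl
    exact hj hi

/-- The cofactor is invariant under shifts along every axis, hence constant; the product of bumps
has integral one, so that constant is the integral of g. -/
theorem IsConcentrated.eq_zero {g : PhaseSpace n → ℝ} (hg : IsConcentrated Finset.univ g)
    (h0 : ∫ x, g x = 0) (x : PhaseSpace n) : g x = 0 := by
  obtain ⟨G, hG, hgG⟩ := hg
  have key : ∀ (y : PhaseSpace n) (S : Finset (Fin (2 * n))),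
      G (∑ i ∈ S, y i • Pi.single i 1) = G 0 := by
    intro y S
    induction S using Finset.induction_on with
    | empty => simp
    | insert j S hj ih =>
      rw [Finset.sum_insert hj, add_comm, hG j (Finset.mem_univ j), ih]
  have hconst : ∀ y, G y = G 0 := fun y => by
    rw [← key y Finset.univ]
    congr 1
    funext k
    simp [Finset.sum_apply, Pi.single_apply]
  have h1 : ∫ x : PhaseSpace n, g x = G 0 := by
    simp only [hgG, hconst]
    rw [integral_mul_const,
      integral_fintype_prod_volume_eq_prod (fun (_ : Fin (2 * n)) (s : ℝ) => massBump s)]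
    simp [integral_massBump]
  rw [hgG, hconst, ← h1, h0, mul_zero]

/-- A function with zero integral is a sum of functions with zero mean along the lines in the
coordinate directions. -/
theorem exists_coordinate_decomposition (n : ℕ) : ∃ C, 0 < C ∧
    ∀ f : PhaseSpace n → ℝ, ContDiff ℝ ∞ f → (∀ x, f x ≠ 0 → ‖x‖ ≤ 1) → ∫ x, f x = 0 →
    ∀ M, DerivBound 3 f M →
    ∃ d : Fin (2 * n) → PhaseSpace n → ℝ, (∀ j, ContDiff ℝ ∞ (d j)) ∧
      (∀ j x, d j x ≠ 0 → ‖x‖ ≤ 1) ∧ (∀ j x, ∫ t : ℝ, d j (x + t • Pi.single j 1) = 0) ∧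
      (∀ j, DerivBound 3 (d j) (C * M)) ∧ ∀ x, f x = ∑ j, d j x := by
  have key : ∀ S : Finset (Fin (2 * n)), ∃ C, 0 < C ∧
      ∀ f : PhaseSpace n → ℝ, ContDiff ℝ ∞ f → (∀ x, f x ≠ 0 → ‖x‖ ≤ 1) →
      ∀ M, DerivBound 3 f M →
      ∃ (d : Fin (2 * n) → PhaseSpace n → ℝ) (g : PhaseSpace n → ℝ),
        ((∀ j, ContDiff ℝ ∞ (d j)) ∧ (∀ j x, d j x ≠ 0 → ‖x‖ ≤ 1) ∧
        (∀ j x, ∫ t : ℝ, d j (x + t • Pi.single j 1) = 0) ∧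
        (∀ j, DerivBound 3 (d j) (C * M))) ∧
        (ContDiff ℝ ∞ g ∧ (∀ x, g x ≠ 0 → ‖x‖ ≤ 1) ∧ DerivBound 3 g (C * M) ∧
        ∫ x, g x = ∫ x, f x ∧ IsConcentrated S g) ∧
        ∀ x, f x = ∑ j ∈ S, d j x + g x := by
    intro S
    induction S using Finset.induction_on with
    | empty =>
      refine ⟨1, one_pos, fun f hf hs M hM => ⟨fun _ _ => 0, f,
        ⟨fun _ => contDiff_const, fun _ _ h => absurd rfl h, fun _ _ => by simp, fun _ j hj x => ?_⟩,
        ⟨hf, hs, by rwa [one_mul], rfl, f, by simp, by simp⟩, by simp⟩⟩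
      rw [one_mul]
      have h0 : iteratedFDeriv ℝ j (fun _ : PhaseSpace n => (0 : ℝ)) x = 0 := by
        simp
      rw [h0, norm_zero]
      exact hM.nonneg
    | insert j S hj ih =>
      obtain ⟨C, hC0, hC⟩ := ih
      obtain ⟨A, hA0, hA⟩ := exists_derivBound_concentrate j 3
      -- The new piece is the old remainder minus its concentration, bounded by C and A · C times M
      -- respectively.
      refine ⟨C + A * C, by positivity, fun f hf hs M hM => ?_⟩
      obtain ⟨d, g, ⟨d1, d2, d3, d4⟩, ⟨g1, g2, g3, g4, g5⟩, hfd⟩ := hC f hf hs M hM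
      have hM0 := hM.nonneg
      have b1 : C * M ≤ (C + A * C) * M := by
        have : 0 ≤ A * C * M := by positivity
        linarith
      have b2 : A * (C * M) ≤ (C + A * C) * M := by
        have : 0 ≤ C * M := by positivity
        linarith
      have hc := contDiff_concentrate j g1 g2
      have hcb := hA g g1 g2 _ g3
      have hcs : ∀ x, concentrate j g x ≠ 0 → ‖x‖ ≤ 1 := fun x hx => concentrate_support j g2 hx
      refine ⟨Function.update d j fun x => g x - concentrate j g x, concentrate j g,
        ⟨?_, ?_, ?_, ?_⟩, ⟨hc, hcs, hcb.mono b2, ?_, g5.insert hj⟩, fun x => ?_⟩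
      · refine (Function.forall_update_iff d fun _ u => ContDiff ℝ ∞ u).2
          ⟨g1.sub hc, fun i _ => d1 i⟩
      · refine (Function.forall_update_iff d fun _ u => ∀ x, u x ≠ 0 → ‖x‖ ≤ 1).2
          ⟨fun x hx => ?_, fun i _ => d2 i⟩
        by_contra h
        have h1 : g x = 0 := by_contra fun h' => h (g2 x h')
        have h2 : concentrate j g x = 0 := by_contra fun h' => h (hcs x h')
        exact hx (by rw [h1, h2, sub_zero])
      · intro i
        rcases eq_or_ne i j with rfl | hij
        · rw [Function.update_self]
          exact integral_line_sub_concentrate i g1 g2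
        · rw [Function.update_of_ne hij]
          exact d3 i
      · refine (Function.forall_update_iff d fun _ u => DerivBound 3 u ((C + A * C) * M)).2
          ⟨?_, fun i _ => (d4 i).mono b1⟩
        exact (g3.sub g1 hc hcb).mono (le_of_eq (by ring))
      · rw [integral_concentrate j g1.continuous g2, g4]
      · rw [Finset.sum_insert hj, Function.update_self, hfd x,
          Finset.sum_congr rfl fun i hi => congrFun (Function.update_of_ne
            (ne_of_mem_of_not_mem hi hj) (fun x => g x - concentrate j g x) d) x]
        ring
  obtain ⟨C, hC0, hC⟩ := key Finset.univ
  refine ⟨C, hC0, fun f hf hs h0 M hM => ?_⟩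
  obtain ⟨d, g, ⟨d1, d2, d3, d4⟩, ⟨-, -, -, g4, g5⟩, hfd⟩ := hC f hf hs M hM
  refine ⟨d, d1, d2, d3, d4, fun x => ?_⟩
  rw [hfd x, g5.eq_zero (g4.trans h0), add_zero]

end CoordinateDecomposition

/-! ### Symplectic quarter turns permuting the coordinate axes. -/

section Rotation

variable {n : ℕ}

theorem conjIndex_conjIndex (i : Fin (2 * n)) : conjIndex (conjIndex i) = i := by
  ext
  by_cases h : (i : ℕ) % 2 = 0
  · have h1 : ((i : ℕ) + 1) % 2 ≠ 0 := by omega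
    simp [conjIndex, h, h1]
  · have h1 : ((i : ℕ) - 1) % 2 = 0 := by omega
    simp only [conjIndex, h, h1, dif_pos, dif_neg, not_false_eq_true]
    omega

/-- The data of an infinitesimal rotation that is symplectic and permutes the coordinate axes: the
`i`-th component of the vector field is `θ i * x (π i)`. -/
structure IsAxisRotation (π : Fin (2 * n) → Fin (2 * n)) (θ : Fin (2 * n) → ℝ) : Prop where
  invol : ∀ i, π (π i) = i
  sign : ∀ i, θ i = 0 ∨ θ i = 1 ∨ θ i = -1
  skew : ∀ i, θ (π i) = -θ i
  conj : ∀ i, π (conjIndex i) = conjIndex (π i)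
  symm : ∀ i, conjSign (conjIndex (π i)) * θ (conjIndex (π i)) = conjSign i * θ i

/-- The linear vector field of an axis rotation. -/
noncomputable def axisField (π : Fin (2 * n) → Fin (2 * n)) (θ : Fin (2 * n) → ℝ) :
    PhaseSpace n →L[ℝ] PhaseSpace n :=
  ContinuousLinearMap.pi fun i =>
    θ i • ContinuousLinearMap.proj (R := ℝ) (φ := fun _ : Fin (2 * n) => ℝ) (π i)

/-- The inverse quarter turn of an axis rotation. -/
noncomputable def axisTurn (π : Fin (2 * n) → Fin (2 * n)) (θ : Fin (2 * n) → ℝ) :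
    PhaseSpace n →L[ℝ] PhaseSpace n :=
  ContinuousLinearMap.id ℝ _ - axisField π θ + (axisField π θ).comp (axisField π θ)

variable {π : Fin (2 * n) → Fin (2 * n)} {θ : Fin (2 * n) → ℝ}

theorem axisField_apply (x : PhaseSpace n) (i : Fin (2 * n)) :
    axisField π θ x i = θ i * x (π i) := rfl

theorem IsAxisRotation.axisTurn_apply (h : IsAxisRotation π θ) (x : PhaseSpace n)
    (i : Fin (2 * n)) : axisTurn π θ x i = x i - θ i * x (π i) - θ i ^ 2 * x i := by
  have h1 : axisTurn π θ x i = x i - θ i * x (π i) + θ i * (θ (π i) * x (π (π i))) := rfl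
  rw [h1, h.invol, h.skew]
  ring

theorem IsAxisRotation.abs_le_one (h : IsAxisRotation π θ) (i : Fin (2 * n)) : |θ i| ≤ 1 := by
  rcases h.sign i with h | h | h <;> simp [h]

theorem IsAxisRotation.norm_axisField_apply_le (h : IsAxisRotation π θ) (x : PhaseSpace n) :
    ‖axisField π θ x‖ ≤ ‖x‖ := by
  rw [pi_norm_le_iff_of_nonneg (norm_nonneg x)]
  intro i
  rw [axisField_apply, norm_mul, Real.norm_eq_abs]
  calc |θ i| * ‖x (π i)‖ ≤ 1 * ‖x‖ := by
        gcongr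
        · exact h.abs_le_one i
        · exact norm_le_pi_norm x _
    _ = ‖x‖ := one_mul _

/-- The square of the field is diagonal with entries -θ², that is, 0 or -1. This yields the closed
form x + sin t Ax + (1 - cos t) A²x for the flow. -/
theorem IsAxisRotation.axisField_cube (h : IsAxisRotation π θ) (x : PhaseSpace n) :
    axisField π θ (axisField π θ (axisField π θ x)) = -axisField π θ x := by
  ext i
  simp only [axisField_apply, Pi.neg_apply, h.invol, h.skew]
  rcases h.sign i with h | h | h <;> simp [h]

/-- The turn is a signed permutation of coordinates, so it preserves the sup norm and with it the
cube. -/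
theorem IsAxisRotation.norm_axisTurn_apply (h : IsAxisRotation π θ) (x : PhaseSpace n) :
    ‖axisTurn π θ x‖ = ‖x‖ := by
  apply le_antisymm
  · rw [pi_norm_le_iff_of_nonneg (norm_nonneg x)]
    intro i
    rw [h.axisTurn_apply]
    have h1 := norm_le_pi_norm x i
    have h2 := norm_le_pi_norm x (π i)
    rcases h.sign i with h | h | h <;> simpa [h] using by assumption
  · rw [pi_norm_le_iff_of_nonneg (norm_nonneg _)]
    intro i
    have h1 := norm_le_pi_norm (axisTurn π θ x) i
    have h2 := norm_le_pi_norm (axisTurn π θ x) (π i)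
    rw [h.axisTurn_apply] at h1 h2
    rw [h.invol, h.skew] at h2
    rcases h.sign i with h | h | h <;> simp [h] at h1 h2 <;> assumption

/-- The quadratic Hamiltonian of an axis rotation. -/
noncomputable def axisHam (π : Fin (2 * n) → Fin (2 * n)) (θ : Fin (2 * n) → ℝ)
    (x : PhaseSpace n) : ℝ :=
  1 / 2 * ∑ i, conjSign i * θ i * (x (conjIndex i) * x (π i))

theorem contDiff_axisHam : ContDiff ℝ ∞ (axisHam π θ) := by
  unfold axisHam
  fun_prop

/-- The conditions `conj` and `symm` say that the bilinear form behind the quadratic Hamiltonian is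
symmetric; the two halves of the product rule then agree and absorb the factor 1/2. -/
theorem IsAxisRotation.hamVF_axisHam (h : IsAxisRotation π θ) (x : PhaseSpace n) :
    hamVF (axisHam π θ) x = axisField π θ x := by
  have hp : ∀ i, HasFDerivAt (fun y : PhaseSpace n => y i)
      (ContinuousLinearMap.proj (R := ℝ) (φ := fun _ : Fin (2 * n) => ℝ) i) x :=
    fun i => hasFDerivAt_apply (𝕜 := ℝ) i x
  have hd : HasFDerivAt (axisHam π θ) ((1 / 2 : ℝ) • ∑ i, (conjSign i * θ i) •
      (x (conjIndex i) • ContinuousLinearMap.proj (R := ℝ) (φ := fun _ : Fin (2 * n) => ℝ) (π i) +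
       x (π i) • ContinuousLinearMap.proj (R := ℝ) (φ := fun _ : Fin (2 * n) => ℝ)
        (conjIndex i))) x :=
    (HasFDerivAt.fun_sum fun i _ => ((hp (conjIndex i)).mul (hp (π i))).const_mul _).const_mul _
  -- Reindexing by this involution interchanges the two arguments of the bilinear form.
  let τ : Equiv.Perm (Fin (2 * n)) := Function.Involutive.toPerm (fun i => conjIndex (π i))
    fun i => by simp only [h.conj, conjIndex_conjIndex, h.invol]
  have hval : ∀ w : PhaseSpace n, fderiv ℝ (axisHam π θ) x w
      = ∑ i, conjSign i * θ i * (x (π i) * w (conjIndex i)) := by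
    intro w
    have h1 : ∑ i, conjSign i * θ i * (x (conjIndex i) * w (π i))
        = ∑ i, conjSign i * θ i * (x (π i) * w (conjIndex i)) := by
      rw [← Equiv.sum_comp τ]
      refine Finset.sum_congr rfl fun i _ => ?_
      have h2 : τ i = conjIndex (π i) := rfl
      rw [h2, h.symm, conjIndex_conjIndex, h.conj, h.invol]
    rw [hd.fderiv]
    have h3 : ((1 / 2 : ℝ) • ∑ i, (conjSign i * θ i) •
      (x (conjIndex i) • ContinuousLinearMap.proj (R := ℝ) (φ := fun _ : Fin (2 * n) => ℝ) (π i) +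
       x (π i) • ContinuousLinearMap.proj (R := ℝ) (φ := fun _ : Fin (2 * n) => ℝ)
        (conjIndex i))) w = 1 / 2 * (∑ i, conjSign i * θ i * (x (conjIndex i) * w (π i))
          + ∑ i, conjSign i * θ i * (x (π i) * w (conjIndex i))) := by
      simp [Finset.sum_add_distrib, mul_add]
    rw [h3, h1]
    ring
  ext i
  rw [hamVF, symplecticDual_apply, hval, Finset.sum_eq_single i]
  · have h1 : conjSign i * conjSign i = 1 := by
      rw [conjSign]; split_ifs <;> norm_num
    rw [Pi.single_eq_same, axisField_apply, mul_one, ← mul_assoc, ← mul_assoc, h1, one_mul]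
  · intro k _ hk
    rw [Pi.single_eq_of_ne, mul_zero, mul_zero]
    intro h'
    exact hk (by rw [← conjIndex_conjIndex k, h', conjIndex_conjIndex])
  · simp

/-- A quarter turn about coordinate axes is realised on the unit cube by a compactly supported
Hamiltonian diffeomorphism. -/
theorem IsAxisRotation.exists_hamDiffeo (h : IsAxisRotation π θ) :
    ∃ σ : PhaseSpace n → PhaseSpace n, IsCompactlySupportedHamDiffeo (openCube n 4) σ ∧
      ∀ d : PhaseSpace n → ℝ, (∀ x, d x ≠ 0 → ‖x‖ ≤ 1) → ∀ x, d (axisTurn π θ (σ x)) = d x := by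
  obtain ⟨χ, hχs, hχ1, hχc, hχt⟩ := exists_cutoff n
  set H : PhaseSpace n → ℝ := fun y => χ y * axisHam π θ y with hH
  have hHs : ContDiff ℝ ∞ H := hχs.mul contDiff_axisHam
  have hHc : HasCompactSupport H := hχc.mul_right
  obtain ⟨φ, hφ⟩ := exists_flow_hamVF hHs hHc
  obtain ⟨⟨K, hL⟩, -⟩ := lipschitz_and_bounded_hamVF hHs hHc
  set A := axisField π θ with hA
  have hcurve : ∀ x : PhaseSpace n, ‖x‖ ≤ 1 → ∀ t ∈ Set.Icc (-(Real.pi / 2)) (Real.pi / 2),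
      HasDerivAt (fun t => x + Real.sin t • A x + (1 - Real.cos t) • A (A x))
        (hamVF H (x + Real.sin t • A x + (1 - Real.cos t) • A (A x))) t := by
    intro x hx t ht
    have h1 : ‖A x‖ ≤ 1 := (h.norm_axisField_apply_le x).trans hx
    have h2 : ‖A (A x)‖ ≤ 1 := (h.norm_axisField_apply_le _).trans h1
    -- For |t| ≤ π/2 the three terms each have norm at most 1, so the trajectory stays where the
    -- cut-off equals 1.
    have h3 : ‖x + Real.sin t • A x + (1 - Real.cos t) • A (A x)‖ ≤ 3 := by
      have hc := Real.cos_nonneg_of_mem_Icc ht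
      have hc' := Real.cos_le_one t
      have e1 : ‖Real.sin t • A x‖ ≤ 1 := by
        rw [norm_smul, Real.norm_eq_abs]
        exact mul_le_one₀ (Real.abs_sin_le_one t) (norm_nonneg _) h1
      have e2 : ‖(1 - Real.cos t) • A (A x)‖ ≤ 1 := by
        rw [norm_smul, Real.norm_eq_abs]
        exact mul_le_one₀ (abs_le.2 ⟨by linarith, by linarith⟩) (norm_nonneg _) h2
      have e3 := norm_add_le (x + Real.sin t • A x) ((1 - Real.cos t) • A (A x))
      have e4 := norm_add_le x (Real.sin t • A x)
      linarith
    rw [hH, hamVF_cutoff hχ1 (lt_of_le_of_lt h3 (by norm_num)), h.hamVF_axisHam]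
    have hd := (((Real.hasDerivAt_sin t).smul_const (A x)).const_add x).add
      (((Real.hasDerivAt_cos t).const_sub 1).smul_const (A (A x)))
    convert! hd using 1
    rw [map_add, map_add, map_smul, map_smul, ← hA, h.axisField_cube]
    module
  have hflow : ∀ x : PhaseSpace n, ‖x‖ ≤ 1 → ∀ T ∈ Set.Icc (-(Real.pi / 2)) (Real.pi / 2),
      φ T x = x + Real.sin T • A x + (1 - Real.cos T) • A (A x) := by
    intro x hx T hT
    have h0 : (0 : ℝ) ∈ Set.Icc (-(Real.pi / 2)) (Real.pi / 2) :=
      ⟨by linarith [Real.pi_pos], by linarith [Real.pi_pos]⟩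
    have := hφ.eq_of_curve hL
      (γ := fun t => x + Real.sin t • A x + (1 - Real.cos t) • A (A x)) (T := T)
      (fun t ht => hcurve x hx t (Set.uIcc_subset_Icc h0 hT ht)) T Set.right_mem_uIcc
    simpa using this
  have hpi : -(Real.pi / 2) ≤ Real.pi / 2 := by linarith [Real.pi_pos]
  have hplus : ∀ x : PhaseSpace n, ‖x‖ ≤ 1 → φ (Real.pi / 2) x = x + A x + A (A x) :=
    fun x hx => by simpa using hflow x hx _ (Set.right_mem_Icc.2 hpi)
  have hturn : ∀ x, axisTurn π θ x = x - A x + A (A x) := fun x => rfl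
  have hminus : ∀ x : PhaseSpace n, ‖x‖ ≤ 1 → φ (-(Real.pi / 2)) x = axisTurn π θ x :=
    fun x hx => by
      rw [hflow x hx _ (Set.left_mem_Icc.2 hpi), hturn]
      simp [sub_eq_add_neg]
  refine ⟨φ (Real.pi / 2), hφ.isCompactlySupportedHamDiffeo hHs hHc
    ((tsupport_mul_subset_left (f := χ)).trans hχt) _, fun d hd x => ?_⟩
  by_cases hx : ‖x‖ ≤ 1
  · rw [hplus x hx, hturn]
    congr 1
    simp only [map_add, hA, h.axisField_cube, map_neg]
    abel
  · rw [show d x = 0 from by_contra fun h' => hx (hd x h')]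
    by_contra h'
    -- If the turned point lies in the support of d, then so does its preimage in the cube, where
    -- the turn inverts the flow; hence x itself lies in the support.
    have h1 := hd _ h'
    rw [h.norm_axisTurn_apply] at h1
    rw [← hminus _ h1, hφ.neg_apply hL] at h'
    exact hx (hd x h')

/-- There is an axis rotation whose inverse quarter turn carries the second coordinate axis to any
given one. -/
theorem exists_axisRotation (hn : 1 ≤ n) (j : Fin (2 * n)) : ∃ π θ, IsAxisRotation (n := n) π θ ∧
    axisTurn π θ (Pi.single (secondIndex hn) 1) = Pi.single j 1 := by
  by_cases hj : j = secondIndex hn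
  · have h : IsAxisRotation (n := n) id 0 :=
      ⟨fun _ => rfl, fun _ => Or.inl rfl, fun _ => by simp, fun _ => rfl, fun _ => by simp⟩
    refine ⟨id, 0, h, ?_⟩
    ext i
    rw [h.axisTurn_apply, hj]
    simp
  · set q := secondIndex hn with hq
    set p := firstIndex hn with hp
    have hpq : p ≠ q := by simp [hp, hq, firstIndex, secondIndex]
    have hcp : conjIndex p = q := by simp [hp, hq, firstIndex, secondIndex, conjIndex]
    have hcq : conjIndex q = p := by rw [← hcp, conjIndex_conjIndex]
    have hinj : ∀ a b : Fin (2 * n), conjIndex a = b → a = conjIndex b := fun a b hab => by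
      rw [← hab, conjIndex_conjIndex]
    have hcc : ∀ i : Fin (2 * n), conjIndex (conjIndex i) = i := conjIndex_conjIndex
    have hsc : ∀ i : Fin (2 * n), conjSign (conjIndex i) = -conjSign i := by
      intro i
      by_cases h : (i : ℕ) % 2 = 0
      · have h1 : ((i : ℕ) + 1) % 2 ≠ 0 := by omega
        simp [conjIndex, conjSign, h, h1]
      · have h1 : ((i : ℕ) - 1) % 2 = 0 := by omega
        simp [conjIndex, conjSign, h, h1]
    have hsp : conjSign p = 1 := by simp [conjSign, hp, firstIndex]
    have hs : ∀ i : Fin (2 * n), conjSign i = 1 ∨ conjSign i = -1 := fun i => by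
      rw [conjSign]; split_ifs <;> simp
    have hsq : conjSign q = -1 := by rw [← hcp, hsc, hsp]
    have hne : ∀ i : Fin (2 * n), conjIndex i ≠ i := fun i hi => by
      have := hsc i
      rw [hi] at this
      rcases hs i with h | h <;> rw [h] at this <;> norm_num at this
    -- Rotate the plane of j and q, and the conjugate plane of p and `conjIndex j` by the
    -- compensating amount that symplecticity forces; this fixes the signs `conjSign j`. When j = p
    -- the two planes coincide and the first two branches decide.
    have h : IsAxisRotation (n := n)
        (fun i => if i = j then q else if i = q then j else if i = p then conjIndex j
          else if i = conjIndex j then p else i)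
        (fun i => if i = j then -1 else if i = q then 1 else if i = p then -conjSign j
          else if i = conjIndex j then conjSign j else 0) := by
      constructor
      · intro i; grind
      · intro i; grind
      · intro i; grind
      · intro i; grind
      · intro i; grind
    refine ⟨_, _, h, ?_⟩
    ext i
    rw [h.axisTurn_apply]
    simp only [Pi.single_apply]
    grind

end Rotation

/-! ### The statement on the unit cube. -/

section UnitScale

open MeasureTheory

variable {n : ℕ}

/-- A small function with zero mean along the lines in a coordinate direction is the sum of two
differences of Hamiltonian pullbacks of the first coordinate. -/
theorem exists_hamDiffeo_of_integral_line_eq_zero (hn : 1 ≤ n) : ∃ C, 0 < C ∧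
    ∀ (j : Fin (2 * n)) (d : PhaseSpace n → ℝ), ContDiff ℝ ∞ d → (∀ x, d x ≠ 0 → ‖x‖ ≤ 1) →
    (∀ x, ∫ t : ℝ, d (x + t • Pi.single j 1) = 0) → DerivBound 3 d C →
    ∃ Φ Ψ : Fin 2 → PhaseSpace n → PhaseSpace n,
      (∀ l, IsCompactlySupportedHamDiffeo (openCube n 4) (Φ l)) ∧
      (∀ l, IsCompactlySupportedHamDiffeo (openCube n 4) (Ψ l)) ∧
      ∀ x, d x = ∑ l, (Φ l x (firstIndex hn) - Ψ l x (firstIndex hn)) := by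
  obtain ⟨C, hC0, hC⟩ := exists_coboundary_decomposition (secondIndex hn)
  -- Chosen so that the coboundary functions have partial derivatives at most 1/50, as the pair
  -- construction requires.
  refine ⟨1 / (50 * C), by positivity, fun j d hd hs hint hM => ?_⟩
  obtain ⟨π, θ, hr, hrj⟩ := exists_axisRotation hn j
  obtain ⟨σ, hσ, hσd⟩ := hr.exists_hamDiffeo
  set L := axisTurn π θ with hL
  have hL1 : ‖L‖ ≤ 1 := L.opNorm_le_bound zero_le_one fun x => by
    rw [one_mul, hL, hr.norm_axisTurn_apply]
  have hline : ∀ x, ∫ t : ℝ, (d ∘ L) (x + t • Pi.single (secondIndex hn) 1) = 0 := by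
    intro x
    rw [← hint (L x)]
    refine integral_congr_ae (Filter.Eventually.of_forall fun t => ?_)
    simp only [Function.comp, map_add, map_smul, hrj]
  obtain ⟨F, hF1, hF2, hF3, hF4⟩ := hC (d ∘ L) (hd.comp L.contDiff)
    (fun x hx => by rw [← hr.norm_axisTurn_apply x]; exact hs _ hx) hline _
    (fun k hk x => iteratedFDeriv_comp_le L hL1 hd (hM k hk) x)
  have hpart : ∀ l x i, |fderiv ℝ (F l) x (Pi.single i 1)| ≤ 1 / 50 := by
    intro l x i
    have h1 := (fderiv ℝ (F l) x).le_opNorm (Pi.single i 1)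
    have h2 : ‖(Pi.single i 1 : PhaseSpace n)‖ = 1 := by
      rw [Pi.norm_single, norm_one]
    rw [h2, mul_one] at h1
    refine h1.trans ((hF3 l x).trans (le_of_eq ?_))
    field_simp
  obtain ⟨hs1, hs2⟩ := sqrt_two_bounds
  have hpair : ∀ l : Fin 2, ∃ Φ Ψ : PhaseSpace n → PhaseSpace n,
      IsCompactlySupportedHamDiffeo (openCube n 4) Φ ∧
      IsCompactlySupportedHamDiffeo (openCube n 4) Ψ ∧
      ∀ x, F l x - F l (x + (![1 / 8, √2 / 8] l : ℝ) • Pi.single (secondIndex hn) 1)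
        = Φ x (firstIndex hn) - Ψ x (firstIndex hn) := fun l => by
    refine exists_pair_translate hn (hF1 l) (fun x hx => (hF2 l x hx).trans (by norm_num))
      (hpart l) ?_ ?_
    · fin_cases l
      · norm_num
      · change 0 ≤ √2 / 8
        positivity
    · fin_cases l
      · norm_num
      · change √2 / 8 ≤ 1 / 5
        linarith
  choose Φ Ψ hΦ hΨ hΦΨ using hpair
  refine ⟨fun l => Φ l ∘ σ, fun l => Ψ l ∘ σ, fun l => (hΦ l).comp hσ, fun l => (hΨ l).comp hσ,
    fun x => ?_⟩
  -- Pulling back by σ undoes the turn on the support of d, so composing every diffeomorphism with σ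
  -- transfers the identity from `d ∘ L` to d.
  have h1 : d x = (d ∘ L) (σ x) := (hσd d hs x).symm
  rw [h1, hF4, Fin.sum_univ_two]
  exact congrArg₂ (· + ·) (hΦΨ 0 (σ x)) (hΦΨ 1 (σ x))

theorem exists_hamDiffeo_of_integral_eq_zero (hn : 1 ≤ n) : ∃ C, 0 < C ∧
    ∀ f : PhaseSpace n → ℝ, ContDiff ℝ ∞ f → (∀ x, f x ≠ 0 → ‖x‖ ≤ 1) → ∫ x, f x = 0 →
    DerivBound 3 f C →
    ∃ Φ Ψ : Fin (4 * n) → PhaseSpace n → PhaseSpace n,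
      (∀ i, IsCompactlySupportedHamDiffeo (openCube n 4) (Φ i)) ∧
      (∀ i, IsCompactlySupportedHamDiffeo (openCube n 4) (Ψ i)) ∧
      ∀ x, f x = ∑ i, (Φ i x (firstIndex hn) - Ψ i x (firstIndex hn)) := by
  obtain ⟨C₁, hC₁0, hC₁⟩ := exists_coordinate_decomposition n
  obtain ⟨C₂, hC₂0, hC₂⟩ := exists_hamDiffeo_of_integral_line_eq_zero hn
  refine ⟨C₂ / C₁, by positivity, fun f hf hs h0 hM => ?_⟩
  obtain ⟨d, d1, d2, d3, d4, hfd⟩ := hC₁ f hf hs h0 _ hM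
  rw [mul_div_cancel₀ _ hC₁0.ne'] at d4
  choose Φ Ψ hΦ hΨ hd using fun j => hC₂ j (d j) (d1 j) (d2 j) (d3 j) (d4 j)
  -- Two coboundaries for each of the 2n directions.
  let κ : Fin (4 * n) ≃ Fin (2 * n) × Fin 2 := (finCongr (by ring)).trans finProdFinEquiv.symm
  refine ⟨fun i => Φ (κ i).1 (κ i).2, fun i => Ψ (κ i).1 (κ i).2, fun i => hΦ _ _, fun i => hΨ _ _,
    fun x => ?_⟩
  rw [hfd, κ.sum_comp fun q => Φ q.1 q.2 x (firstIndex hn) - Ψ q.1 q.2 x (firstIndex hn),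
    Fintype.sum_prod_type]
  exact Finset.sum_congr rfl fun j _ => hd j x

end UnitScale

/-! ### Bounding all derivatives by the third-order partial derivatives. -/

section DerivativeBounds

variable {n : ℕ}

/-- Expanding each argument in the standard basis produces (2n)^k terms, with coefficients bounded
by the sup norms of the arguments. -/
theorem norm_le_of_forall_single {k : ℕ}
    (m : ContinuousMultilinearMap ℝ (fun _ : Fin k => PhaseSpace n) ℝ) {C : ℝ} (hC : 0 ≤ C)
    (h : ∀ i : Fin k → Fin (2 * n), |m fun l => Pi.single (i l) 1| ≤ C) :
    ‖m‖ ≤ (2 * n) ^ k * C := by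
  refine m.opNorm_le_bound (by positivity) fun v => ?_
  have h1 : v = fun l => ∑ i, v l i • (Pi.single i 1 : PhaseSpace n) := by
    funext l
    ext a
    simp [Finset.sum_apply, Pi.single_apply]
  have h2 : m v = ∑ r : Fin k → Fin (2 * n), (∏ l, v l (r l)) * m fun l => Pi.single (r l) 1 := by
    conv_lhs => rw [h1]
    rw [m.map_sum]
    refine Finset.sum_congr rfl fun r _ => ?_
    rw [m.map_smul_univ, smul_eq_mul]
  rw [h2]
  refine (norm_sum_le _ _).trans ((Finset.sum_le_card_nsmul _ _ ((∏ l, ‖v l‖) * C)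
    fun r _ => ?_).trans (le_of_eq ?_))
  · rw [norm_mul, norm_prod]
    refine mul_le_mul (Finset.prod_le_prod (fun _ _ => norm_nonneg _) fun l _ =>
      norm_le_pi_norm (v l) (r l)) (h r) (norm_nonneg _) (Finset.prod_nonneg fun _ _ => norm_nonneg _)
  · simp
    ring

/-- For functions supported in the unit cube, all derivatives are controlled by those of highest
order. -/
theorem derivBound_of_top (hn : 1 ≤ n) {f : PhaseSpace n → ℝ} (hf : ContDiff ℝ ∞ f)
    (hs : ∀ x, f x ≠ 0 → ‖x‖ ≤ 1) {k : ℕ} {M : ℝ} (hM : ∀ x, ‖iteratedFDeriv ℝ k f x‖ ≤ M) :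
    DerivBound k f (3 ^ k * M) := by
  have hM0 : 0 ≤ M := (norm_nonneg _).trans (hM 0)
  have hz : ∀ (j : ℕ) (x : PhaseSpace n), 1 < ‖x‖ → iteratedFDeriv ℝ j f x = 0 := by
    intro j x hx
    by_contra h
    have := tsupport_subset_closedBall hs (support_iteratedFDeriv_subset j h)
    rw [mem_closedBall_zero_iff] at this
    linarith
  have key : ∀ m ≤ k, ∀ x, ‖iteratedFDeriv ℝ (k - m) f x‖ ≤ 3 ^ m * M := by
    intro m
    induction m with
    | zero => intro _ x; simpa using hM x
    | succ m ih =>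
      intro hm x
      by_cases hx : 1 < ‖x‖
      · rw [hz _ x hx, norm_zero]
        positivity
      -- A shift by 3 leaves the unit cube, where the derivative vanishes; the mean value inequality
      -- then costs a factor 3 per order.
      · set y : PhaseSpace n := x + (3 : ℝ) • Pi.single (firstIndex hn) 1 with hy
        have hy1 : 1 < ‖y‖ := by
          have h1 := abs_le.1 ((norm_le_pi_norm x (firstIndex hn)).trans (not_lt.1 hx))
          refine lt_of_lt_of_le ?_ (norm_le_pi_norm y (firstIndex hn))
          rw [hy, add_smul_single_self]
          exact lt_of_lt_of_le (by linarith) (le_abs_self _)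
        have hd : ∀ z, ‖fderiv ℝ (iteratedFDeriv ℝ (k - (m + 1)) f) z‖ ≤ 3 ^ m * M := by
          intro z
          rw [norm_fderiv_iteratedFDeriv, show k - (m + 1) + 1 = k - m by omega]
          exact ih (by omega) z
        have h2 := convex_univ.norm_image_sub_le_of_norm_fderiv_le (𝕜 := ℝ)
          (fun z _ => (hf.differentiable_iteratedFDeriv (m := k - (m + 1))
            (WithTop.coe_lt_coe.2 (ENat.natCast_lt_top (k - (m + 1))))) z)
          (fun z _ => hd z) (Set.mem_univ y) (Set.mem_univ x)
        rw [hz _ y hy1, sub_zero] at h2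
        refine h2.trans ?_
        have h3 : ‖x - y‖ = 3 := by
          rw [hy, sub_add_cancel_left, norm_neg, norm_smul, Pi.norm_single]
          norm_num
        rw [h3, pow_succ]
        linarith
  intro j hj x
  have h1 := key (k - j) (by omega) x
  rw [show k - (k - j) = j by omega] at h1
  refine h1.trans ?_
  gcongr
  · norm_num
  · omega

end DerivativeBounds

/-! ### Extension by zero, rescaling, and the final statement. -/

section Extension

open MeasureTheory

variable {n : ℕ}

theorem isOpen_openCube (n : ℕ) (r : ℝ) : IsOpen (openCube n r) := by
  have h : openCube n r = ⋂ i, (fun x : PhaseSpace n => x i) ⁻¹' Set.Ioo (-r) r := by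
    ext x
    simp [openCube]
  rw [h]
  exact isOpen_iInter_of_finite fun i => isOpen_Ioo.preimage (continuous_apply i)

theorem openCube_mono {r s : ℝ} (h : r ≤ s) : openCube n r ⊆ openCube n s :=
  fun _ hx i => ⟨by linarith [(hx i).1], by linarith [(hx i).2]⟩

theorem tsupport_indicator_eq (W : Set (PhaseSpace n)) (f : PhaseSpace n → ℝ) :
    tsupport (W.indicator f) = closure {x | x ∈ W ∧ f x ≠ 0} := by
  rw [tsupport, Set.support_indicator]
  rfl

/-- Extension by zero of a function with closed support inside the open set `W`. -/
theorem contDiff_indicator {W : Set (PhaseSpace n)} (hW : IsOpen W) {f : PhaseSpace n → ℝ}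
    (hf : ContDiffOn ℝ ∞ f W) (hs : tsupport (W.indicator f) ⊆ W) :
    ContDiff ℝ ∞ (W.indicator f) := by
  rw [contDiff_iff_contDiffAt]
  intro x
  by_cases hx : x ∈ W
  · refine (hf.contDiffAt (hW.mem_nhds hx)).congr_of_eventuallyEq ?_
    filter_upwards [hW.mem_nhds hx] with y hy using Set.indicator_of_mem hy f
  · have h : W.indicator f =ᶠ[nhds x] fun _ => 0 :=
      notMem_tsupport_iff_eventuallyEq.1 fun h => hx (hs h)
    exact contDiffAt_const.congr_of_eventuallyEq h

theorem abs_iteratedFDeriv_indicator_le {W : Set (PhaseSpace n)} (hW : IsOpen W)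
    {f : PhaseSpace n → ℝ} (hs : tsupport (W.indicator f) ⊆ W) {k : ℕ} {M : ℝ} (hM : 0 ≤ M)
    (hb : derivSupNorm k W f ≤ ENNReal.ofReal M) (x : PhaseSpace n) (i : Fin k → Fin (2 * n)) :
    |iteratedFDeriv ℝ k (W.indicator f) x fun l => Pi.single (i l) 1| ≤ M := by
  by_cases hx : x ∈ W
  · have h1 : W.indicator f =ᶠ[nhds x] f := by
      filter_upwards [hW.mem_nhds hx] with y hy using Set.indicator_of_mem hy f
    rw [(h1.iteratedFDeriv ℝ k).eq_of_nhds]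
    refine (ENNReal.ofReal_le_ofReal_iff hM).1 (le_trans ?_ hb)
    exact le_iSup_of_le i (le_iSup₂_of_le x hx le_rfl)
  · have h1 : iteratedFDeriv ℝ k (W.indicator f) x = 0 := by
      by_contra h
      exact hx (hs (support_iteratedFDeriv_subset k h))
    simpa [h1] using hM

/-- The derivatives of a rescaled function. -/
theorem iteratedFDeriv_comp_const_smul_apply {g : PhaseSpace n → ℝ} (hg : ContDiff ℝ ∞ g) (ε : ℝ) (k : ℕ)
    (x : PhaseSpace n) (v : Fin k → PhaseSpace n) :
    iteratedFDeriv ℝ k (fun y => g (ε • y)) x v = ε ^ k * iteratedFDeriv ℝ k g (ε • x) v := by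
  rw [iteratedFDeriv_comp_const_smul ε (hg.of_le (by exact_mod_cast le_top))]
  rfl

end Extension

/-- Functions on the cube `(-4ε, 4ε)^{2n}` are represented by functions on `ℝ^{2n}` whose values
outside the cube are irrelevant. The volume form `ω^n` is `n!` times Lebesgue measure, so that the
zero-integral condition is the one for Lebesgue measure. -/
theorem theorem5 (n : ℕ) (hn : 1 ≤ n) :
    ∃ C : ℝ, 0 < C ∧ ∀ ε : ℝ, 0 < ε → ∀ b : ℝ, ∀ f : PhaseSpace n → ℝ,
      ContDiffOn ℝ ∞ f (openCube n (4 * ε)) →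
      closure {x | x ∈ openCube n (4 * ε) ∧ f x ≠ 0} ⊆ openCube n ε →
      derivSupNorm 3 (openCube n (4 * ε)) f ≤ ENNReal.ofReal (C / ε ^ 3) →
      (∫ x in openCube n ε, f x) = 0 →
      ∃ Φp Φm : Fin (4 * n) → PhaseSpace n → PhaseSpace n,
        (∀ i, IsCompactlySupportedHamDiffeo (openCube n (4 * ε)) (Φp i)) ∧
        (∀ i, IsCompactlySupportedHamDiffeo (openCube n (4 * ε)) (Φm i)) ∧
        ∀ x ∈ openCube n (4 * ε),
          f x = ∑ i, (firstCoordProfile hn ε b (Φp i x) - firstCoordProfile hn ε b (Φm i x)) := by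
  obtain ⟨C, hC0, hC⟩ := exists_hamDiffeo_of_integral_eq_zero hn
  have hn0 : (0 : ℝ) < 2 * n := by
    have : (0 : ℝ) < n := by exact_mod_cast hn
    linarith
  -- The factor (2n)³ passes from partial derivatives to the norm of the third derivative, and 3³
  -- from there to all lower orders.
  refine ⟨C / (3 ^ 3 * (2 * n) ^ 3), by positivity, fun ε hε b f hf hsupp hbound hint => ?_⟩
  set c := C / (3 ^ 3 * (2 * n) ^ 3) with hc
  have hc0 : 0 ≤ c := by positivity
  set W := openCube n (4 * ε) with hW
  have hWo : IsOpen W := isOpen_openCube n _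
  have hsub : openCube n ε ⊆ W := openCube_mono (by linarith)
  rw [← tsupport_indicator_eq] at hsupp
  have hgs := contDiff_indicator hWo hf (hsupp.trans hsub)
  have hpart := abs_iteratedFDeriv_indicator_le hWo (hsupp.trans hsub) (M := c / ε ^ 3)
    (by positivity) hbound
  set g := W.indicator f with hg
  have hzero : ∀ x ∉ openCube n ε, g x = 0 := fun x hx =>
    image_eq_zero_of_notMem_tsupport fun h => hx (hsupp h)
  have h1s : ContDiff ℝ ∞ fun x => g (ε • x) := hgs.comp (contDiff_const_smul ε)
  have h1supp : ∀ x, g (ε • x) ≠ 0 → ‖x‖ ≤ 1 := by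
    intro x hx
    have h : ε • x ∈ openCube n ε := by_contra fun h => hx (hzero _ h)
    rw [pi_norm_le_iff_of_nonneg zero_le_one]
    intro i
    have h2 := h i
    simp only [Pi.smul_apply, smul_eq_mul, Set.mem_Ioo] at h2
    rw [Real.norm_eq_abs, abs_le]
    constructor <;> nlinarith [h2.1, h2.2]
  have h1int : ∫ x : PhaseSpace n, g (ε • x) = 0 := by
    rw [MeasureTheory.Measure.integral_comp_smul,
      ← MeasureTheory.setIntegral_eq_integral_of_forall_compl_eq_zero hzero,
      MeasureTheory.setIntegral_congr_fun (isOpen_openCube n ε).measurableSet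
        (fun x hx => Set.indicator_of_mem (hsub hx) f), hint, smul_zero]
  have h1bound : DerivBound 3 (fun x => g (ε • x)) C := by
    have h := derivBound_of_top hn h1s h1supp (k := 3) (M := (2 * n) ^ 3 * c) fun x =>
      norm_le_of_forall_single _ hc0 fun i => by
        rw [iteratedFDeriv_comp_const_smul_apply hgs, abs_mul, abs_of_pos (pow_pos hε 3)]
        calc ε ^ 3 * |_| ≤ ε ^ 3 * (c / ε ^ 3) := by
              gcongr
              exact hpart _ i
          _ = c := by field_simp
    refine h.mono (le_of_eq ?_)
    rw [hc]
    field_simp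
  obtain ⟨Φ, Ψ, hΦ, hΨ, hΦΨ⟩ := hC _ h1s h1supp h1int h1bound
  refine ⟨fun i x => ε • Φ i (ε⁻¹ • x), fun i x => ε • Ψ i (ε⁻¹ • x),
    fun i => (hΦ i).rescale hε, fun i => (hΨ i).rescale hε, fun x hx => ?_⟩
  -- The factor `ε` in the rescaled maps cancels the division by `ε` in the profile, and `b` drops
  -- out of each difference.
  have h1 := hΦΨ (ε⁻¹ • x)
  rw [smul_smul, mul_inv_cancel₀ hε.ne', one_smul, hg, Set.indicator_of_mem hx] at h1
  rw [h1]
  refine Finset.sum_congr rfl fun i _ => ?_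
  simp only [firstCoordProfile, firstIndex, Pi.smul_apply, smul_eq_mul]
  field_simp
  ring
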